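/- Let $S_n$ be the symmetric group on $\{1,\dots,n\}$ and, for $\sigma\in S_n$, let $\alpha_j(\sigma)$ be the number of cycles of $\sigma$ of length $j$. Let $0<d^-\le d^+$ and let $p$ be fixed with $\max\{2,1/d^-\}<p\le\infty$. Then there is a constant $K=K(d^-,d^+,p)>0$ such that the following holds for every $n\ge 1$, all real numbers $\hat d(1),\dots,\hat d(n)$ with $d^-\le \hat d(j)\le d^+$ for $1\le j\le n$, and all real numbers $\hat h(1),\dots,\hat h(n)$ with $$\sum_{k=1}^n \hat d(k)\frac{\hat h(k)^2}{k}=1 .$$ Put $d(\sigma)=\prod_{j}\hat d(j)^{\alpha_j(\sigma)}$, where for $\sigma\in S_m$, $m\le n$, the product is over $1\le j\le m$; let $p_m=\frac1{m!}\sum_{\sigma\in S_m}d(\sigma)$ for $0\le m\le n$ (so $p_0=1$), let $\nu_{n,d}$ be the probability measure on $S_n$ with $\nu_{n,d}(\sigma)=d(\sigma)/\sum_{\tau\in S_n}d(\tau)$, and let $h(\sigma)=\sum_{j=1}^n\hat h(j)\alpha_j(\sigma)$ for $\sigma\in S_n$. Put $$A(n)=\sum_{k=1}^n\hat d(k)\frac{\hat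 h(k)}{k},\qquad C_n=\sum_{j=1}^n\hat d(j)\frac{\hat h(j)}{j}\Bigl(\frac{p_{n-j}}{p_n}-1\Bigr),$$ $$L_{n,r}=\sum_{k=1}^n\frac{|\hat h(k)|^r}{k}\quad(0<r<\infty),\qquad L_{n,2}'=\sum_{j=1}^n\frac{\hat h(j)^2}{j}\Bigl|\frac{p_{n-j}}{p_n}-1\Bigr|,$$ $F_n(x)=\nu_{n,d}\bigl(h(\sigma)-A(n)<x\bigr)$ and $\Phi(x)=\frac1{\sqrt{2\pi}}\int_{-\infty}^x e^{-u^2/2}\,du$. Then $$\sup_{x\in\mathbb R}\Bigl|F_n(x)-\Phi(x)+\frac{1}{\sqrt{2\pi}}e^{-x^2/2}\,C_n\Bigr|\le K\bigl(L_{n,3}+L_{n,p}^{2/p}+L_{n,2}'\bigr),$$ where for $p=\infty$ the term $L_{n,p}^{2/p}$ means $\bigl(\max_{1\le j\le n}|\hat h(j)|\bigr)^2$. -/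

import Mathlib

open scoped ENNReal

noncomputable section

namespace RandPerm

/-- `α_j(σ)`: the number of cycles of length `j` of `σ ∈ S_n`.  `Equiv.Perm.partition` is the
multiset of all cycle lengths, fixed points included as cycles of length `1`. -/
def cycleCount {n : ℕ} (j : ℕ) (σ : Equiv.Perm (Fin n)) : ℕ :=
  σ.partition.parts.count j

/-- The additive function `h(σ) = ∑_{j=1}^n ĥ(j) α_j(σ)` on `S_n`. -/
def additive {n : ℕ} (h : ℕ → ℝ) (σ : Equiv.Perm (Fin n)) : ℝ :=
  ∑ j ∈ Finset.Icc 1 n, h j * (cycleCount j σ : ℝ)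

/-- The multiplicative function `d(σ) = ∏_{j=1}^n d̂(j)^{α_j(σ)}` on `S_n`. -/
def multiplicative {n : ℕ} (d : ℕ → ℝ) (σ : Equiv.Perm (Fin n)) : ℝ :=
  ∏ j ∈ Finset.Icc 1 n, d j ^ cycleCount j σ

/-- The point masses `ν_{n,d}(σ) = d(σ) / ∑_{τ ∈ S_n} d(τ)`. -/
def nuMass {n : ℕ} (d : ℕ → ℝ) (σ : Equiv.Perm (Fin n)) : ℝ :=
  multiplicative d σ / ∑ τ : Equiv.Perm (Fin n), multiplicative d τ

open Classical in
/-- The probability `ν_{n,d}(E)` of an event `E ⊆ S_n`. -/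
def nu {n : ℕ} (d : ℕ → ℝ) (E : Set (Equiv.Perm (Fin n))) : ℝ :=
  ∑ σ : Equiv.Perm (Fin n) with σ ∈ E, nuMass d σ

/-- `p_n = (1 / n!) ∑_{σ ∈ S_n} d(σ)`. -/
def pCoeff (d : ℕ → ℝ) (n : ℕ) : ℝ :=
  (1 / (n.factorial : ℝ)) * ∑ σ : Equiv.Perm (Fin n), multiplicative d σ

/-- The centering `A(n) = ∑_{k=1}^n d̂(k) ĥ(k) / k`. -/
def A (d h : ℕ → ℝ) (n : ℕ) : ℝ :=
  ∑ k ∈ Finset.Icc 1 n, d k * (h k / k)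

/-- `C_n = ∑_{j=1}^n d̂(j) (ĥ(j) / j) (p_{n-j} / p_n - 1)`. -/
def C (d h : ℕ → ℝ) (n : ℕ) : ℝ :=
  ∑ j ∈ Finset.Icc 1 n, d j * (h j / j) * (pCoeff d (n - j) / pCoeff d n - 1)

/-- `L_{n,p} = ∑_{k=1}^n |ĥ(k)|^p / k` for a finite exponent `p`. -/
def L (h : ℕ → ℝ) (n : ℕ) (p : ℝ) : ℝ :=
  ∑ k ∈ Finset.Icc 1 n, |h k| ^ p / k

/-- `L_{n,p}^{1/p}` for `0 < p ≤ ∞`, with the value `max_{1 ≤ j ≤ n} |ĥ(j)|` at `p = ∞`. -/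
def LRoot (h : ℕ → ℝ) (n : ℕ) (p : ℝ≥0∞) : ℝ :=
  if p = ∞ then ((Finset.Icc 1 n).sup (fun j => ‖h j‖₊) : NNReal)
  else L h n p.toReal ^ (1 / p.toReal)

/-- `L'_{n,2} = ∑_{j=1}^n (ĥ(j)^2 / j) |p_{n-j} / p_n - 1|`. -/
def L2' (d h : ℕ → ℝ) (n : ℕ) : ℝ :=
  ∑ j ∈ Finset.Icc 1 n, h j ^ 2 / j * |pCoeff d (n - j) / pCoeff d n - 1|

/-- The distribution function `F_n(x) = ν_{n,d}(h(σ) - A(n) < x)`. -/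
def F (d h : ℕ → ℝ) (n : ℕ) (x : ℝ) : ℝ :=
  nu d {σ : Equiv.Perm (Fin n) | additive h σ - A d h n < x}

/-- The standard normal distribution function. -/
def Phi (x : ℝ) : ℝ :=
  ProbabilityTheory.cdf (ProbabilityTheory.gaussianReal 0 1) x

end RandPerm

end

open scoped ENNReal

namespace RandPerm

/-! ### The exponential formula for weighted permutations. -/

section Combinatorics

open Finset

variable {K : Type*} [Field K]

/-! Let `expCoeff x n` be the coefficient of z^n in exp(∑ x_j z^j / j), given by its recursion.
Grouping permutations by cycle type (`sum_perm_eq_expCoeff`) shows that p_n is `expCoeff d n`, and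
that the characteristic function of h(σ) at t is `expCoeff` for the weights d_j e^{i t h_j}, divided
by p_n. So everything is a comparison of two coefficients. As the d_j are merely bounded above and
below, there is no singularity to analyse, and all estimates are made on the unit circle.

The two coefficients are joined by a path: M_k(s) is the k-th coefficient for the weights d_j (1 +
s(e^{i t h_j} - 1)). Put a_j = d_j (e^{i t h_j} - 1)/j and Λ = ∑ a_j. Then M_n' = ∑ a_j M_{n-j} = Λ
M_n + ∑ a_j (M_{n-j} - M_n), so M_n(s) is e^{sΛ} p_n up to the effect of the increments. For the
next order, p_n M_{n-j} - p_{n-j} M_n vanishes at s = 0 and solves the same kind of equation, forced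
by what is essentially a second difference. This gives M_n(1) = e^Λ p_n (1 + ∑ a_j (p_{n-j}/p_n -
1)) with a quadratic error (`CoeffSystem.norm_sub_second_order_le`). Expanding the exponentials, Λ
is i t A(n) - t²/2 up to t³ L_{n,3}, the linear term is i t C_n up to t² L'_{n,2}, and by Hölder
(`exists_sum_abs_mul_growth_le`) the quadratic error is of size t² L_{n,p}^{2/p}. Hence the centred
characteristic function is close to e^{-t²/2}(1 + i t C_n), the transform of Φ - C_n φ, and
`exists_esseen_inequality` concludes.

The analytic core is a bound, uniform in d, h and n, for M_k(s) and its increments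
(`exists_coefficient_bounds`): |M_k| is at most a constant times p_n ((n+1)/(k+1))^β e^{-κ t² s},
and M_{k+j} - M_k gains a further factor (j/n)^θ. It comes from a Halász-type argument: the
recursion k M_k = ∑ x_i M_{k-i} together with Parseval bounds ∑ |M_k| over dyadic blocks by the
supremum of the generating function on the circle, the increments being treated through the factor 1
- z^j. The supremum is controlled by `le_sum_one_sub_cos`, which extracts at once a Gaussian gain in
t and a gain log(1 + n|φ|) away from z = 1. The exponent β + θ can be taken as close to max(0, 1 -
d^-) as desired, and Hölder needs it below 1 - 1/p; this is where p > 1/d^- enters. -/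

noncomputable def expCoeff (x : ℕ → K) : ℕ → K
  | 0 => 1
  | n + 1 => (1 / ((n : K) + 1)) * ∑ j : Fin (n + 1), x (j + 1) * expCoeff x (n - j)
decreasing_by omega

theorem expCoeff_zero (x : ℕ → K) : expCoeff x 0 = 1 := by
  rw [expCoeff]

theorem sum_Icc_one_eq_sum_range {E : Type*} [AddCommMonoid E] (f : ℕ → E) (n : ℕ) :
    ∑ j ∈ Icc 1 n, f j = ∑ j ∈ range n, f (j + 1) := by
  rw [Finset.range_eq_Ico, Finset.sum_Ico_add' f 0 n 1]
  rfl

theorem prod_pow_count_eq_prod_map (x : ℕ → K) {n : ℕ} (q : n.Partition) :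
    ∏ j ∈ Icc 1 n, x j ^ q.parts.count j = (q.parts.map x).prod := by
  rw [Finset.prod_multiset_map_count]
  symm
  refine Finset.prod_subset (fun j hj => ?_) fun j _ hj => ?_
  · rw [Multiset.mem_toFinset] at hj
    rw [Finset.mem_Icc]
    exact ⟨q.parts_pos hj, q.le_of_mem_parts hj⟩
  · rw [Multiset.mem_toFinset] at hj
    simp [Multiset.count_eq_zero_of_notMem hj]

variable [CharZero K]

theorem expCoeff_rec (x : ℕ → K) (n : ℕ) :
    (n : K) * expCoeff x n = ∑ j ∈ Icc 1 n, x j * expCoeff x (n - j) := by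
  cases n with
  | zero => simp
  | succ n =>
    have h : ((n : K) + 1) ≠ 0 := by exact_mod_cast Nat.succ_ne_zero n
    rw [expCoeff, sum_Icc_one_eq_sum_range, Finset.sum_range]
    push_cast
    field_simp

/-- The recursion determines the coefficients. Permutation sums, Taylor coefficients, truncated
weights and complexified weights are all identified through it; the bound N allows the recursion to
be known only up to some index. -/
theorem expCoeff_unique (x m : ℕ → K) (N : ℕ) (h0 : m 0 = 1)
    (h : ∀ n, n ≤ N → (n : K) * m n = ∑ j ∈ Icc 1 n, x j * m (n - j)) :
    ∀ n, n ≤ N → m n = expCoeff x n := by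
  intro n
  induction n using Nat.strong_induction_on with
  | _ n ih =>
    intro hn
    rcases Nat.eq_zero_or_pos n with rfl | hpos
    · rw [h0, expCoeff_zero]
    · have hne : (n : K) ≠ 0 := by exact_mod_cast hpos.ne'
      apply mul_left_cancel₀ hne
      rw [h n hn, expCoeff_rec]
      refine Finset.sum_congr rfl fun j hj => ?_
      rw [Finset.mem_Icc] at hj
      rw [ih (n - j) (by omega) (by omega)]

theorem expCoeff_congr (x y : ℕ → K) (N : ℕ) (h : ∀ j ∈ Icc 1 N, x j = y j) :
    ∀ n, n ≤ N → expCoeff x n = expCoeff y n := by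
  refine expCoeff_unique y (expCoeff x) N (expCoeff_zero x) fun n hn => ?_
  rw [expCoeff_rec]
  refine Finset.sum_congr rfl fun j hj => ?_
  rw [Finset.mem_Icc] at hj
  rw [h j (by rw [Finset.mem_Icc]; omega)]

/-- The weight of a cycle type: `∏ (x_j / j)^{m_j} / m_j!`. -/
noncomputable def cycleWeight (x : ℕ → K) (s : Multiset ℕ) : K :=
  (s.map fun j => x j / (j : K)).prod * ∏ j ∈ s.toFinset, ((s.count j).factorial : K)⁻¹

/-- Inserting one more part a multiplies the multiplicity factorial by the new multiplicity of a,
which is the factor on the left. This is the weight side of removing one cycle from a cycle type. -/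
theorem cycleWeight_cons (x : ℕ → K) (s : Multiset ℕ) (a : ℕ) :
    cycleWeight x (a ::ₘ s) * ((a ::ₘ s).count a : K) = x a / (a : K) * cycleWeight x s := by
  have h1 : ∏ j ∈ s.toFinset, ((s.count j).factorial : K)⁻¹
      = ∏ j ∈ insert a s.toFinset, ((s.count j).factorial : K)⁻¹ := by
    refine Finset.prod_subset (Finset.subset_insert _ _) fun j _ hj => ?_
    rw [Multiset.mem_toFinset] at hj
    simp [Multiset.count_eq_zero_of_notMem hj]
  have hc : ((s.count a + 1 : ℕ) : K) ≠ 0 := by exact_mod_cast Nat.succ_ne_zero (s.count a)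
  have h2 : ∏ j ∈ (insert a s.toFinset).erase a, (((a ::ₘ s).count j).factorial : K)⁻¹
      = ∏ j ∈ (insert a s.toFinset).erase a, ((s.count j).factorial : K)⁻¹ :=
    Finset.prod_congr rfl fun j hj => by
      rw [Multiset.count_cons_of_ne (Finset.ne_of_mem_erase hj)]
  rw [cycleWeight, cycleWeight, h1, Multiset.toFinset_cons,
    ← Finset.mul_prod_erase _ _ (Finset.mem_insert_self a s.toFinset),
    ← Finset.mul_prod_erase _ _ (Finset.mem_insert_self a s.toFinset), h2, Multiset.map_cons,
    Multiset.prod_cons, Multiset.count_cons_self, Nat.factorial_succ]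
  push_cast at hc ⊢
  field_simp

/-- Double counting: write n as the sum over j of j times the multiplicity of j, and exchange the
sums. Partitions without the part j contribute nothing; the others biject with partitions of n - j
by removal of one part j, and `cycleWeight_cons` turns the multiplicity into x_j / j. -/
theorem sum_partition_cycleWeight (x : ℕ → K) (n : ℕ) :
    (n : K) * ∑ q : n.Partition, cycleWeight x q.parts
      = ∑ j ∈ Icc 1 n, x j * ∑ q : (n - j).Partition, cycleWeight x q.parts := by
  have h1 : ∀ q : n.Partition, (n : K) = ∑ j ∈ Icc 1 n, (j : K) * (q.parts.count j : K) := by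
    intro q
    have h := q.parts_sum
    rw [Finset.sum_multiset_count_of_subset q.parts (Icc 1 n)] at h
    · have h' := congrArg (Nat.cast : ℕ → K) h
      rw [← h']
      push_cast
      exact Finset.sum_congr rfl fun j _ => by simp [mul_comm]
    · intro j hj
      rw [Multiset.mem_toFinset] at hj
      rw [Finset.mem_Icc]
      exact ⟨q.parts_pos hj, q.le_of_mem_parts hj⟩
  have h2 : ∀ j ∈ Icc 1 n, x j * ∑ q : (n - j).Partition, cycleWeight x q.parts
      = ∑ q : n.Partition, (j : K) * (q.parts.count j : K) * cycleWeight x q.parts := by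
    intro j hj
    rw [Finset.mem_Icc] at hj
    have hj0 : (j : K) ≠ 0 := by exact_mod_cast (by omega : j ≠ 0)
    rw [← Finset.sum_subset (Finset.filter_subset (fun q : n.Partition => j ∈ q.parts) univ)
      (fun q _ hq => ?_)]
    · rw [← Finset.sum_subtype_eq_sum_filter]
      rw [Finset.subtype_univ, Finset.mul_sum]
      rw [← Equiv.sum_comp (Nat.Partition.partitionWithPartEquiv hj.1 hj.2)]
      refine Finset.sum_congr rfl fun q _ => ?_
      have := cycleWeight_cons x (q.1.parts.erase j) j
      rw [Multiset.cons_erase q.2] at this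
      rw [Nat.Partition.partitionWithPartEquiv_apply_parts]
      calc _ = (j : K) * (x j / (j : K) * cycleWeight x (q.1.parts.erase j)) := by
            field_simp
        _ = _ := by rw [← this]; ring
    · simp only [Finset.mem_filter, Finset.mem_univ, true_and] at hq
      simp [Multiset.count_eq_zero_of_notMem hq]
  rw [Finset.sum_congr rfl h2, Finset.sum_comm, Finset.mul_sum]
  refine Finset.sum_congr rfl fun q _ => ?_
  rw [← Finset.sum_mul, ← h1 q]

theorem sum_partition_cycleWeight_eq (x : ℕ → K) (n : ℕ) :
    ∑ q : n.Partition, cycleWeight x q.parts = expCoeff x n := by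
  refine expCoeff_unique x (fun n => ∑ q : n.Partition, cycleWeight x q.parts) n ?_
    (fun m _ => sum_partition_cycleWeight x m) n le_rfl
  simp [cycleWeight]

/-- `Equiv.Perm.cycleType` records only cycles of length at least 2, so the parts equal to 1 are
split off. They contribute nothing to the product of the parts and exactly the factorial of their
number to the other factor. -/
theorem card_partition_eq {n : ℕ} (q : n.Partition) :
    #{σ : Equiv.Perm (Fin n) | σ.partition.parts = q.parts} *
      (q.parts.prod * ∏ j ∈ q.parts.toFinset, (q.parts.count j).factorial) = n.factorial := by
  set m := q.parts.filter (fun j => 2 ≤ j) with hm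
  have hsplit : q.parts = m + Multiset.replicate (q.parts.count 1) 1 := by
    ext j
    rw [Multiset.count_add, Multiset.count_replicate, hm, Multiset.count_filter]
    rcases Nat.lt_trichotomy j 1 with hj | rfl | hj
    · have : j ∉ q.parts := fun h => by have := q.parts_pos h; omega
      rw [Multiset.count_eq_zero_of_notMem this]
      split_ifs <;> omega
    · simp
    · rw [if_pos (by omega), if_neg (by omega)]
      rfl
  have hsum : m.sum + q.parts.count 1 = n := by
    have h := q.parts_sum
    rw [hsplit] at h
    simpa using h
  have hset : ({σ : Equiv.Perm (Fin n) | σ.partition.parts = q.parts} : Finset _)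
      = ({σ : Equiv.Perm (Fin n) | σ.cycleType = m} : Finset _) := by
    ext σ
    simp only [Finset.mem_filter, Finset.mem_univ, true_and]
    constructor
    · intro h
      rw [← Equiv.Perm.filter_parts_partition_eq_cycleType, h]
    · intro h
      rw [Equiv.Perm.parts_partition, h, ← Equiv.Perm.sum_cycleType, h, Fintype.card_fin,
        show n - m.sum = q.parts.count 1 by omega]
      exact hsplit.symm
  have h := Equiv.Perm.card_of_cycleType_mul_eq (Fin n) m
  rw [Fintype.card_fin, if_pos ⟨by omega, fun a ha => (Multiset.mem_filter.1 ha).2⟩] at h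
  rw [hset, ← h, show n - m.sum = q.parts.count 1 by omega]
  have h1 : q.parts.prod = m.prod := by
    conv_lhs => rw [hsplit]
    simp
  have h2 : ∏ j ∈ q.parts.toFinset, (q.parts.count j).factorial
      = (q.parts.count 1).factorial * ∏ j ∈ m.toFinset, (m.count j).factorial := by
    have h3 : ∏ j ∈ q.parts.toFinset, (q.parts.count j).factorial
        = ∏ j ∈ insert 1 q.parts.toFinset, (q.parts.count j).factorial := by
      refine Finset.prod_subset (Finset.subset_insert _ _) fun j _ hj => ?_
      rw [Multiset.mem_toFinset] at hj
      simp [Multiset.count_eq_zero_of_notMem hj]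
    have h4 : (insert 1 q.parts.toFinset).erase 1 = m.toFinset := by
      ext j
      simp only [Finset.mem_erase, Finset.mem_insert, Multiset.mem_toFinset, hm,
        Multiset.mem_filter]
      constructor
      · rintro ⟨h1, h2 | h2⟩
        · exact absurd h2 h1
        · have := q.parts_pos h2
          exact ⟨h2, by omega⟩
      · rintro ⟨h1, h2⟩
        exact ⟨by omega, Or.inr h1⟩
    rw [h3, ← Finset.mul_prod_erase _ _ (Finset.mem_insert_self 1 _), h4]
    congr 1
    refine Finset.prod_congr rfl fun j hj => ?_
    rw [Multiset.mem_toFinset, hm, Multiset.mem_filter] at hj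
    rw [hm, Multiset.count_filter, if_pos hj.2]
  rw [h1, h2]
  ring

/-- The partition of `n` given by the cycle lengths of a permutation of `Fin n`. -/
def cyclePartition {n : ℕ} (σ : Equiv.Perm (Fin n)) : n.Partition where
  parts := σ.partition.parts
  parts_pos := σ.partition.parts_pos
  parts_sum := by rw [σ.partition.parts_sum, Fintype.card_fin]

/-- On a fixed cycle type the summand is constant, and the number of permutations of that type
divided by n! turns it into `cycleWeight`. -/
theorem sum_perm_eq_expCoeff (x : ℕ → K) (n : ℕ) :
    (1 / (n.factorial : K)) * ∑ σ : Equiv.Perm (Fin n), ∏ j ∈ Icc 1 n, x j ^ cycleCount j σ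
      = expCoeff x n := by
  rw [← sum_partition_cycleWeight_eq,
    ← Finset.sum_fiberwise_of_maps_to (s := univ) (t := univ) (g := cyclePartition)
      (fun σ _ => Finset.mem_univ _), Finset.mul_sum]
  refine Finset.sum_congr rfl fun q _ => ?_
  have h1 : ∀ σ ∈ (univ.filter fun σ : Equiv.Perm (Fin n) => cyclePartition σ = q),
      ∏ j ∈ Icc 1 n, x j ^ cycleCount j σ = (q.parts.map x).prod := by
    intro σ hσ
    rw [Finset.mem_filter] at hσ
    rw [← prod_pow_count_eq_prod_map, ← hσ.2]
    rfl
  have h2 : (univ.filter fun σ : Equiv.Perm (Fin n) => cyclePartition σ = q)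
      = univ.filter fun σ : Equiv.Perm (Fin n) => σ.partition.parts = q.parts := by
    ext σ
    simp [Nat.Partition.ext_iff, cyclePartition]
  rw [Finset.sum_congr rfl h1, Finset.sum_const, nsmul_eq_mul, h2, cycleWeight]
  have h3 := congrArg (Nat.cast : ℕ → K) (card_partition_eq q)
  have h4 : (q.parts.map fun j => x j / (j : K)).prod = (q.parts.map x).prod / (q.parts.prod : K) := by
    rw [Multiset.prod_map_div]
    congr 1
    exact (Multiset.prod_hom q.parts (Nat.castRingHom K)).trans (by simp)
  have h5 : (q.parts.prod : K) ≠ 0 := by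
    have : q.parts.prod ≠ 0 := fun h => by
      have := q.parts_pos (Multiset.prod_eq_zero_iff.1 h)
      omega
    exact_mod_cast this
  have h6 : (∏ j ∈ q.parts.toFinset, ((q.parts.count j).factorial : K)) ≠ 0 :=
    Finset.prod_ne_zero_iff.2 fun j _ => by exact_mod_cast Nat.factorial_ne_zero _
  have h7 : (n.factorial : K) ≠ 0 := by exact_mod_cast Nat.factorial_ne_zero _
  rw [h4, Finset.prod_inv_distrib]
  rw [Nat.cast_mul, Nat.cast_mul, Nat.cast_prod] at h3
  field_simp
  rw [← h3]
  ring

end Combinatorics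

theorem pCoeff_eq_expCoeff (d : ℕ → ℝ) (n : ℕ) : pCoeff d n = expCoeff d n :=
  sum_perm_eq_expCoeff d n

end RandPerm

namespace RandPerm

/-! ### Parseval bounds and the power series of exp(∑ x_i z^i / i). -/

section PowerSeries

open Finset Polynomial Filter Topology

theorem circleAverage_mono_of_le {f g : ℂ → ℝ} (hf : Continuous f) (hg : Continuous g)
    (h : ∀ z : ℂ, ‖z‖ = 1 → f z ≤ g z) :
    Real.circleAverage f 0 1 ≤ Real.circleAverage g 0 1 := by
  refine Real.circleAverage_mono hf.continuousOn.circleIntegrable'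
    hg.continuousOn.circleIntegrable' fun z hz => h z ?_
  simpa using hz

theorem sum_sq_norm_coeff_mul_le (X G : ℂ[X]) (S : ℝ)
    (hS : ∀ z : ℂ, ‖z‖ = 1 → ‖G.eval z‖ ≤ S) (s : Finset ℕ) :
    ∑ k ∈ s, ‖(X * G).coeff k‖ ^ 2 ≤ S ^ 2 * ∑ k ∈ X.support, ‖X.coeff k‖ ^ 2 := by
  have h1 : ∑ k ∈ s, ‖(X * G).coeff k‖ ^ 2 ≤ ∑ k ∈ (X * G).support, ‖(X * G).coeff k‖ ^ 2 := by
    rw [← Finset.sum_subset (Finset.inter_subset_left : s ∩ (X * G).support ⊆ s)]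
    · exact Finset.sum_le_sum_of_subset_of_nonneg Finset.inter_subset_right
        fun _ _ _ => by positivity
    · intro k hk hk'
      have : k ∉ (X * G).support := fun h => hk' (Finset.mem_inter.2 ⟨hk, h⟩)
      rw [Polynomial.notMem_support_iff.1 this]
      simp
  refine h1.trans ?_
  rw [Polynomial.sum_sq_norm_coeff_eq_circleAverage, Polynomial.sum_sq_norm_coeff_eq_circleAverage,
    ← smul_eq_mul (S ^ 2), ← Real.circleAverage_fun_smul]
  refine circleAverage_mono_of_le (by fun_prop) (by fun_prop) fun z hz => ?_
  rw [Polynomial.eval_mul, norm_mul, mul_pow, smul_eq_mul, mul_comm]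
  gcongr
  exact hS z hz

/-- The convolution consists of coefficients of X(z) U(z), with X the polynomial of the x_i and U
the series of the u_k, so Parseval gives the bound with S dominating |U| on the circle. As Parseval
is applied to polynomials, U is truncated at degree K ≥ N: coefficients up to N do not change, the
supremum changes by at most the tail of ∑ |u_k|, and K tends to infinity. -/
theorem sum_sq_norm_conv_le (u x : ℕ → ℂ) (hu : Summable fun k => ‖u k‖) (S : ℝ)
    (hS : ∀ z : ℂ, ‖z‖ = 1 → ‖∑' k, u k * z ^ k‖ ≤ S) (N : ℕ) :
    ∑ k ∈ range (N + 1), ‖∑ i ∈ Icc 1 k, x i * u (k - i)‖ ^ 2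
      ≤ S ^ 2 * ∑ i ∈ Icc 1 N, ‖x i‖ ^ 2 := by
  set X : ℂ[X] := ∑ i ∈ Icc 1 N, Polynomial.monomial i (x i) with hX
  have hXc : ∀ a, X.coeff a = if a ∈ Icc 1 N then x a else 0 := by
    intro a
    rw [hX, Polynomial.finsetSum_coeff]
    simp only [Polynomial.coeff_monomial]
    rw [Finset.sum_ite_eq' (Icc 1 N) a x]
  have hXs : ∑ k ∈ X.support, ‖X.coeff k‖ ^ 2 ≤ ∑ i ∈ Icc 1 N, ‖x i‖ ^ 2 := by
    have : X.support ⊆ Icc 1 N := fun a ha => by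
      by_contra hna
      rw [Polynomial.mem_support_iff, hXc, if_neg hna] at ha
      exact ha rfl
    refine (Finset.sum_le_sum_of_subset_of_nonneg this fun _ _ _ => by positivity).trans
      (Finset.sum_le_sum fun a ha => ?_)
    rw [hXc, if_pos ha]
  have key : ∀ K, N ≤ K → ∑ k ∈ range (N + 1), ‖∑ i ∈ Icc 1 k, x i * u (k - i)‖ ^ 2
      ≤ (S + ∑' k, ‖u (k + (K + 1))‖) ^ 2 * ∑ i ∈ Icc 1 N, ‖x i‖ ^ 2 := by
    intro K hK
    set G : ℂ[X] := ∑ i ∈ range (K + 1), Polynomial.monomial i (u i) with hG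
    have hGc : ∀ a, a ≤ K → G.coeff a = u a := by
      intro a ha
      rw [hG, Polynomial.finsetSum_coeff]
      simp only [Polynomial.coeff_monomial]
      rw [Finset.sum_ite_eq' (range (K + 1)) a u, if_pos (by simp; omega)]
    have hGe : ∀ z : ℂ, ‖z‖ = 1 → ‖G.eval z‖ ≤ S + ∑' k, ‖u (k + (K + 1))‖ := by
      intro z hz
      have hn : ∀ k, ‖u k * z ^ k‖ = ‖u k‖ := fun k => by simp [hz]
      have hs : Summable fun k => u k * z ^ k := Summable.of_norm (by simpa only [hn] using hu)
      have he : G.eval z = ∑' k, u k * z ^ k - ∑' k, u (k + (K + 1)) * z ^ (k + (K + 1)) := by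
        rw [← hs.sum_add_tsum_nat_add (K + 1), hG, Polynomial.eval_finsetSum]
        simp [Polynomial.eval_monomial]
      rw [he]
      refine (norm_sub_le _ _).trans (add_le_add (hS z hz) ?_)
      have hs' : Summable fun k => ‖u (k + (K + 1)) * z ^ (k + (K + 1))‖ := by
        simp only [hn]
        exact (summable_nat_add_iff (K + 1)).2 hu
      refine (norm_tsum_le_tsum_norm hs').trans (le_of_eq ?_)
      simp only [hn]
    refine le_trans (le_of_eq ?_) ((sum_sq_norm_coeff_mul_le X G _ hGe (range (N + 1))).trans
      (mul_le_mul_of_nonneg_left hXs (sq_nonneg _)))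
    refine Finset.sum_congr rfl fun k hk => ?_
    rw [Finset.mem_range] at hk
    congr 2
    rw [Polynomial.coeff_mul, Finset.Nat.sum_antidiagonal_eq_sum_range_succ_mk,
      ← Finset.sum_subset (s₁ := Icc 1 k) (s₂ := range k.succ)]
    · refine Finset.sum_congr rfl fun i hi => ?_
      rw [Finset.mem_Icc] at hi
      rw [hXc, hGc _ (by omega), if_pos (by rw [Finset.mem_Icc]; omega)]
    · intro i hi
      rw [Finset.mem_Icc] at hi
      simp
      omega
    · intro i hi hi'
      rw [hXc, if_neg, zero_mul]
      rw [Finset.mem_Icc] at hi' ⊢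
      rw [Finset.mem_range] at hi
      omega
  have hlim : Tendsto (fun K => (S + ∑' k, ‖u (k + (K + 1))‖) ^ 2 * ∑ i ∈ Icc 1 N, ‖x i‖ ^ 2) atTop
      (𝓝 ((S + 0) ^ 2 * ∑ i ∈ Icc 1 N, ‖x i‖ ^ 2)) := by
    have h0 : Tendsto (fun K => ∑' k, ‖u (k + (K + 1))‖) atTop (𝓝 0) :=
      (tendsto_sum_nat_add fun k => ‖u k‖).comp (tendsto_add_atTop_nat 1)
    exact ((h0.const_add S).pow 2).mul_const _
  rw [add_zero] at hlim
  exact ge_of_tendsto hlim ((eventually_ge_atTop N).mono fun K hK => key K hK)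

/-- The sequence `x` cut off after the index `N`. -/
def cutoff (N : ℕ) (x : ℕ → ℂ) (i : ℕ) : ℂ := if i ≤ N then x i else 0

/-- The function `exp (∑_{i=1}^N x_i z^i / i)`. -/
noncomputable def expPoly (N : ℕ) (x : ℕ → ℂ) (z : ℂ) : ℂ :=
  Complex.exp (∑ i ∈ Icc 1 N, x i * z ^ i / i)

theorem expCoeff_cutoff (N : ℕ) (x : ℕ → ℂ) {k : ℕ} (hk : k ≤ N) :
    expCoeff (cutoff N x) k = expCoeff x k :=
  expCoeff_congr _ _ N (fun _ hj => if_pos (Finset.mem_Icc.1 hj).2) k hk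

theorem hasDerivAt_expPoly (N : ℕ) (x : ℕ → ℂ) (z : ℂ) :
    HasDerivAt (expPoly N x) (expPoly N x z * ∑ i ∈ range N, x (i + 1) * z ^ i) z := by
  refine HasDerivAt.cexp ?_
  have he := sum_Icc_one_eq_sum_range (fun i => x i * z ^ (i - 1)) N
  simp only [Nat.add_sub_cancel] at he
  rw [← he]
  refine HasDerivAt.fun_sum fun i hi => ?_
  have hi0 : (i : ℂ) ≠ 0 := by
    rw [Finset.mem_Icc] at hi
    exact_mod_cast (by omega : i ≠ 0)
  have := ((hasDerivAt_pow i z).const_mul (x i)).div_const (i : ℂ)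
  refine this.congr_deriv ?_
  field_simp

/-- The logarithmic derivative of the function is a polynomial, and Leibniz' rule at 0 is then
precisely the recursion of `expCoeff`. The weights are cut off at N to make the function entire, so
that its series may be used on the unit circle itself. -/
theorem hasSum_expPoly (N : ℕ) (x : ℕ → ℂ) (z : ℂ) :
    HasSum (fun k => expCoeff (cutoff N x) k * z ^ k) (expPoly N x z) := by
  have hdiff : Differentiable ℂ (expPoly N x) :=
    fun z => (hasDerivAt_expPoly N x z).differentiableAt
  have hder : deriv (expPoly N x)
      = (expPoly N x) * fun z => ∑ i ∈ range N, x (i + 1) * z ^ i :=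
    funext fun z => (hasDerivAt_expPoly N x z).deriv
  have hpoly : ∀ k, iteratedDeriv k (fun z : ℂ => ∑ i ∈ range N, x (i + 1) * z ^ i) 0
      = k.factorial * cutoff N x (k + 1) := by
    intro k
    rw [iteratedDeriv_fun_sum fun i _ => by fun_prop]
    simp only [iteratedDeriv_const_mul_field, iteratedDeriv_fun_pow_zero]
    by_cases hk : k + 1 ≤ N
    · rw [cutoff, if_pos hk, Finset.sum_eq_single k]
      · rw [if_pos rfl, mul_comm]
      · intro b _ hb
        simp [Ne.symm hb]
      · intro h
        rw [Finset.mem_range] at h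
        omega
    · rw [cutoff, if_neg hk, mul_zero]
      refine Finset.sum_eq_zero fun i hi => ?_
      rw [Finset.mem_range] at hi
      have hki : k ≠ i := by omega
      simp [hki]
  have hcoeff : ∀ k, (k.factorial : ℂ)⁻¹ * iteratedDeriv k (expPoly N x) 0
      = expCoeff (cutoff N x) k := by
    intro k
    refine expCoeff_unique (cutoff N x)
      (fun k => (k.factorial : ℂ)⁻¹ * iteratedDeriv k (expPoly N x) 0) k ?_ (fun n _ => ?_) k le_rfl
    · have : ∑ i ∈ Icc 1 N, x i * (0 : ℂ) ^ i / i = 0 := by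
        refine Finset.sum_eq_zero fun i hi => ?_
        rw [Finset.mem_Icc] at hi
        rw [zero_pow (by omega), mul_zero, zero_div]
      simp [expPoly, this]
    · cases n with
      | zero => simp
      | succ n =>
        rw [iteratedDeriv_succ', hder,
          iteratedDeriv_mul hdiff.contDiff.contDiffAt (by fun_prop),
          sum_Icc_one_eq_sum_range, ← Finset.sum_range_reflect, Finset.mul_sum, Finset.mul_sum]
        refine Finset.sum_congr rfl fun i hi => ?_
        rw [Finset.mem_range] at hi
        rw [hpoly, show n + 1 - 1 - i = n - i by omega, show n - (n - i) = i by omega,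
          show n + 1 - (i + 1) = n - i by omega, Nat.choose_symm (by omega : i ≤ n),
          Nat.choose_eq_factorial_div_factorial (by omega : i ≤ n),
          Nat.cast_div (Nat.factorial_mul_factorial_dvd_factorial (by omega))
            (by exact_mod_cast (by positivity))]
        have h1 : (i.factorial : ℂ) ≠ 0 := by exact_mod_cast Nat.factorial_ne_zero _
        have h2 : ((n - i).factorial : ℂ) ≠ 0 := by exact_mod_cast Nat.factorial_ne_zero _
        have h3 : (n.factorial : ℂ) ≠ 0 := by exact_mod_cast Nat.factorial_ne_zero _
        have h4 : (n : ℂ) + 1 ≠ 0 := by exact_mod_cast Nat.succ_ne_zero n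
        rw [Nat.factorial_succ]
        push_cast
        field_simp
  have h := Complex.hasSum_taylorSeries_of_entire hdiff 0 z
  refine h.congr_fun fun k => ?_
  rw [← hcoeff, sub_zero, smul_eq_mul, smul_eq_mul]
  ring

end PowerSeries
end RandPerm

namespace RandPerm

/-! ### Lower bounds for p_n by harmonic sums of the weights. -/

section PartitionFunction

open Finset

theorem expCoeff_ofReal (d : ℕ → ℝ) (n : ℕ) :
    expCoeff (fun i => (d i : ℂ)) n = ((expCoeff d n : ℝ) : ℂ) := by
  refine (expCoeff_unique (fun i => (d i : ℂ)) (fun n => ((expCoeff d n : ℝ) : ℂ)) n ?_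
    (fun m _ => ?_) n le_rfl).symm
  · simp [expCoeff_zero]
  · have := congrArg (fun r : ℝ => (r : ℂ)) (expCoeff_rec d m)
    push_cast at this
    exact this

theorem expCoeff_nonneg {d : ℕ → ℝ} {N : ℕ} (hd : ∀ i ∈ Icc 1 N, 0 ≤ d i) :
    ∀ k, k ≤ N → 0 ≤ expCoeff d k := by
  intro k
  induction k using Nat.strong_induction_on with
  | _ k ih =>
    intro hk
    rcases Nat.eq_zero_or_pos k with rfl | hpos
    · rw [expCoeff_zero]
      exact zero_le_one
    · have h := expCoeff_rec d k
      have hk0 : (0 : ℝ) < k := by exact_mod_cast hpos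
      have : 0 ≤ (k : ℝ) * expCoeff d k := by
        rw [h]
        refine Finset.sum_nonneg fun i hi => ?_
        rw [Finset.mem_Icc] at hi
        exact mul_nonneg (hd i (by rw [Finset.mem_Icc]; omega)) (ih _ (by omega) (by omega))
      exact nonneg_of_mul_nonneg_right this hk0

/-- `∑_{i=1}^N d_i / i`. -/
noncomputable def harmSum (d : ℕ → ℝ) (N : ℕ) : ℝ := ∑ i ∈ Icc 1 N, d i / i

theorem hasSum_exp_sum_real (N : ℕ) (d : ℕ → ℝ) (z : ℝ) :
    HasSum (fun k => expCoeff (fun i => if i ≤ N then d i else 0) k * z ^ k)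
      (Real.exp (∑ i ∈ Icc 1 N, d i * z ^ i / i)) := by
  have h := hasSum_expPoly N (fun i => (d i : ℂ)) (z : ℂ)
  have h1 : cutoff N (fun i => (d i : ℂ)) = fun i => ((if i ≤ N then d i else 0 : ℝ) : ℂ) := by
    funext i
    rw [cutoff]
    split_ifs <;> simp
  rw [h1, expPoly] at h
  simp only [expCoeff_ofReal] at h
  rw [← Complex.hasSum_ofReal]
  push_cast
  exact h

/-- Compare the generating function F of the cut off weights at z and z² for a z < 1 with 1 - z of
order 1/N. The part of F(z²) beyond degree N is at most z^N F(z), and F(z) ≤ e^{dp} F(z²); hence the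
first N + 1 terms carry at least half of F(z²), which in turn is comparable to e^{D_N}, D_N being
the harmonic sum. -/
theorem exp_harmSum_le_sum_expCoeff {dp : ℝ} {d : ℕ → ℝ} {N : ℕ}
    (hd : ∀ i ∈ Icc 1 N, 0 ≤ d i ∧ d i ≤ dp) (hdp : 0 ≤ dp) :
    Real.exp (harmSum d N) ≤
      2 * Real.exp (2 * dp * (dp + 1)) * ∑ k ∈ range (N + 1), expCoeff d k := by
  rcases Nat.eq_zero_or_pos N with rfl | hN
  · have : 1 ≤ Real.exp (2 * dp * (dp + 1)) := Real.one_le_exp (by positivity)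
    simp [harmSum, expCoeff_zero]
    linarith
  have hN0 : (0 : ℝ) < N := by exact_mod_cast hN
  -- This choice gives z^N e^{dp} = e^{-1} ≤ 1/2, so the tail of F(z²) can be absorbed.
  set z : ℝ := Real.exp (-((dp + 1) / N)) with hz
  have hz0 : 0 < z := Real.exp_pos _
  have hz1 : z < 1 := by
    rw [hz, Real.exp_lt_one_iff]
    have : 0 < (dp + 1) / N := by positivity
    linarith
  set a : ℕ → ℝ := fun k => expCoeff (fun i => if i ≤ N then d i else 0) k with ha
  have ha0 : ∀ k, 0 ≤ a k := fun k => by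
    refine expCoeff_nonneg (N := k) (fun i hi => ?_) k le_rfl
    rw [Finset.mem_Icc] at hi
    split_ifs with h
    · exact (hd i (by rw [Finset.mem_Icc]; omega)).1
    · exact le_rfl
  have hak : ∀ k, k ≤ N → a k = expCoeff d k := fun k hk =>
    expCoeff_congr _ _ N (fun i hi => if_pos (Finset.mem_Icc.1 hi).2) k hk
  have hs1 := hasSum_exp_sum_real N d z
  have hs2 := hasSum_exp_sum_real N d (z ^ 2)
  set F1 := Real.exp (∑ i ∈ Icc 1 N, d i * z ^ i / i) with hF1
  set F2 := Real.exp (∑ i ∈ Icc 1 N, d i * (z ^ 2) ^ i / i) with hF2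
  have hzN : z ^ N = Real.exp (-(dp + 1)) := by
    rw [hz, ← Real.exp_nat_mul]
    congr 1
    field_simp
  have htail : F2 ≤ ∑ k ∈ range (N + 1), expCoeff d k + z ^ N * F1 := by
    rw [← hs2.tsum_eq, ← hs2.summable.sum_add_tsum_nat_add (N + 1)]
    refine add_le_add (Finset.sum_le_sum fun k hk => ?_) ?_
    · rw [Finset.mem_range] at hk
      change a k * _ ≤ _
      rw [hak k (by omega)]
      refine mul_le_of_le_one_right ?_ (pow_le_one₀ (by positivity) (pow_le_one₀ hz0.le hz1.le))
      rw [← hak k (by omega)]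
      exact ha0 k
    · rw [← hs1.tsum_eq, ← tsum_mul_left]
      have hsA := (summable_nat_add_iff (N + 1)).2 hs2.summable
      have hsB := hs1.summable.mul_left (z ^ N)
      have hsC := (summable_nat_add_iff (N + 1)).2 hsB
      refine (Summable.tsum_le_tsum (fun k => ?_) hsA hsC).trans ?_
      · rw [← pow_mul]
        have h1 : z ^ (2 * (k + (N + 1))) ≤ z ^ N * z ^ (k + (N + 1)) := by
          rw [← pow_add]
          exact pow_le_pow_of_le_one hz0.le hz1.le (by omega)
        calc _ ≤ a (k + (N + 1)) * (z ^ N * z ^ (k + (N + 1))) :=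
              mul_le_mul_of_nonneg_left h1 (ha0 _)
          _ = _ := by ring
      · rw [← hsB.sum_add_tsum_nat_add (N + 1)]
        refine le_add_of_nonneg_left (Finset.sum_nonneg fun k _ => ?_)
        exact mul_nonneg (by positivity) (mul_nonneg (ha0 k) (by positivity))
  have hbern : ∀ w : ℝ, 0 ≤ w → w ≤ 1 → ∀ i : ℕ, 1 - w ^ i ≤ i * (1 - w) := by
    intro w hw0 hw1 i
    have := one_add_mul_le_pow (a := w - 1) (by linarith) i
    rw [add_sub_cancel] at this
    linarith
  have hratio : F1 ≤ Real.exp dp * F2 := by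
    rw [hF1, hF2, ← Real.exp_add]
    refine Real.exp_le_exp.2 ?_
    rw [← sub_le_iff_le_add, ← Finset.sum_sub_distrib]
    calc ∑ i ∈ Icc 1 N, (d i * z ^ i / i - d i * (z ^ 2) ^ i / i)
        ≤ ∑ i ∈ Icc 1 N, dp * ((1 - z) * z ^ i) := by
          refine Finset.sum_le_sum fun i hi => ?_
          have hdi := hd i hi
          rw [Finset.mem_Icc] at hi
          have hi0 : (0 : ℝ) < i := by exact_mod_cast (by omega : 0 < i)
          have h1 : d i * z ^ i / i - d i * (z ^ 2) ^ i / i = d i * (z ^ i * ((1 - z ^ i) / i)) := by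
            rw [← pow_mul, mul_comm 2 i, pow_mul]
            field_simp
          rw [h1]
          have h2 : (1 - z ^ i) / i ≤ 1 - z := by
            rw [div_le_iff₀ hi0, mul_comm]
            exact hbern z hz0.le hz1.le i
          have h3 : z ^ i * ((1 - z ^ i) / i) ≤ (1 - z) * z ^ i := by
            rw [mul_comm]
            exact mul_le_mul_of_nonneg_right h2 (by positivity)
          have h4 : 0 ≤ (1 - z) * z ^ i := mul_nonneg (by linarith) (by positivity)
          exact (mul_le_mul_of_nonneg_left h3 hdi.1).trans (mul_le_mul_of_nonneg_right hdi.2 h4)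
      _ = dp * ((1 - z) * ∑ i ∈ Icc 1 N, z ^ i) := by rw [← Finset.mul_sum, ← Finset.mul_sum]
      _ ≤ dp * 1 := by
          refine mul_le_mul_of_nonneg_left ?_ hdp
          rw [sum_Icc_one_eq_sum_range]
          have h5 : (1 - z) * ∑ j ∈ range N, z ^ (j + 1) = z * (1 - z ^ N) := by
            have := mul_neg_geom_sum z N
            simp only [pow_succ']
            rw [← Finset.mul_sum, ← this]
            ring
          rw [h5]
          have : z ^ N ≤ 1 := pow_le_one₀ hz0.le hz1.le
          have : 0 < z ^ N := by positivity
          nlinarith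
      _ = dp := mul_one _
  have hhalf : F2 ≤ 2 * ∑ k ∈ range (N + 1), expCoeff d k := by
    have h1 : z ^ N * F1 ≤ F2 / 2 := by
      calc z ^ N * F1 ≤ z ^ N * (Real.exp dp * F2) := by gcongr
        _ = Real.exp (-1) * F2 := by
            rw [hzN, ← mul_assoc, ← Real.exp_add]
            congr 2
            ring
        _ ≤ _ := by
            have h2 : Real.exp (-1) ≤ 1 / 2 := by
              rw [Real.exp_neg, inv_eq_one_div]
              have := Real.add_one_le_exp (1 : ℝ)
              exact one_div_le_one_div_of_le (by norm_num) (by linarith)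
            have := mul_le_mul_of_nonneg_right h2 (Real.exp_pos _ : 0 < F2).le
            linarith
    linarith
  have hlow : Real.exp (harmSum d N) ≤ Real.exp (2 * dp * (dp + 1)) * F2 := by
    rw [hF2, ← Real.exp_add]
    refine Real.exp_le_exp.2 ?_
    rw [harmSum, ← sub_le_iff_le_add, ← Finset.sum_sub_distrib]
    have hz2 : N * (1 - z ^ 2) ≤ 2 * (dp + 1) := by
      have h1 : z ^ 2 = Real.exp (-(2 * (dp + 1) / N)) := by
        rw [hz, ← Real.exp_nat_mul]
        congr 1
        push_cast
        ring
      have h2 := Real.add_one_le_exp (-(2 * (dp + 1) / N))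
      rw [h1]
      calc N * (1 - Real.exp (-(2 * (dp + 1) / N))) ≤ N * (2 * (dp + 1) / N) := by
            refine mul_le_mul_of_nonneg_left ?_ hN0.le
            linarith
        _ = _ := by field_simp
    calc ∑ i ∈ Icc 1 N, (d i / i - d i * (z ^ 2) ^ i / i) ≤ ∑ i ∈ Icc 1 N, dp * (1 - z ^ 2) := by
          refine Finset.sum_le_sum fun i hi => ?_
          have hdi := hd i hi
          rw [Finset.mem_Icc] at hi
          have hi0 : (0 : ℝ) < i := by exact_mod_cast (by omega : 0 < i)
          have h1 : d i / i - d i * (z ^ 2) ^ i / i = d i * ((1 - (z ^ 2) ^ i) / i) := by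
            field_simp
          have hzz : z ^ 2 ≤ 1 := pow_le_one₀ hz0.le hz1.le
          have h2 : (1 - (z ^ 2) ^ i) / i ≤ 1 - z ^ 2 := by
            rw [div_le_iff₀ hi0, mul_comm]
            exact hbern (z ^ 2) (by positivity) hzz i
          rw [h1]
          exact (mul_le_mul_of_nonneg_left h2 hdi.1).trans
            (mul_le_mul_of_nonneg_right hdi.2 (by linarith))
      _ = dp * (N * (1 - z ^ 2)) := by
          rw [Finset.sum_const, Nat.card_Icc, nsmul_eq_mul, Nat.add_sub_cancel]
          ring
      _ ≤ dp * (2 * (dp + 1)) := mul_le_mul_of_nonneg_left hz2 hdp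
      _ = _ := by ring
  calc _ ≤ Real.exp (2 * dp * (dp + 1)) * F2 := hlow
    _ ≤ Real.exp (2 * dp * (dp + 1)) * (2 * ∑ k ∈ range (N + 1), expCoeff d k) := by gcongr
    _ = _ := by ring

theorem harmSum_succ (d : ℕ → ℝ) (N : ℕ) :
    harmSum d (N + 1) = harmSum d N + d (N + 1) / ((N : ℝ) + 1) := by
  rw [harmSum, Finset.sum_Icc_succ_top (by omega)]
  push_cast
  rfl

theorem sum_Icc_reflect {E : Type*} [AddCommMonoid E] (f : ℕ → E) (k : ℕ) :
    ∑ i ∈ Icc 1 k, f (k - i) = ∑ i ∈ range k, f i := by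
  rw [sum_Icc_one_eq_sum_range, ← Finset.sum_range_reflect f k]
  refine Finset.sum_congr rfl fun i _ => ?_
  congr 1
  omega

/-- The recursion passes from the mean to a single coefficient: N p_N = ∑ d_i p_{N-i} ≥ dm ∑_{k<N}
p_k. The factor N + 1 in place of N keeps the statement meaningful at N = 0. -/
theorem exp_harmSum_le_expCoeff {dm dp : ℝ} (hdm : 0 < dm) (hdd : dm ≤ dp) :
    ∃ C : ℝ, 0 < C ∧ ∀ (d : ℕ → ℝ) (N : ℕ), (∀ i ∈ Icc 1 N, dm ≤ d i ∧ d i ≤ dp) →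
      Real.exp (harmSum d N) ≤ C * ((N + 1 : ℝ) * expCoeff d N) := by
  refine ⟨max 1 (2 * Real.exp (2 * dp * (dp + 1)) * Real.exp dp / dm), by positivity, ?_⟩
  intro d N hd
  cases N with
  | zero =>
    simp [harmSum, expCoeff_zero]
  | succ k =>
    have hdp : 0 ≤ dp := hdm.le.trans hdd
    have hd' : ∀ i ∈ Icc 1 k, 0 ≤ d i ∧ d i ≤ dp := fun i hi => by
      rw [Finset.mem_Icc] at hi
      have := hd i (by rw [Finset.mem_Icc]; omega)
      exact ⟨hdm.le.trans this.1, this.2⟩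
    have hd0 : ∀ i ∈ Icc 1 (k + 1), 0 ≤ d i := fun i hi => hdm.le.trans (hd i hi).1
    have h1 := exp_harmSum_le_sum_expCoeff hd' hdp
    have h2 : Real.exp (harmSum d (k + 1)) ≤ Real.exp dp * Real.exp (harmSum d k) := by
      rw [harmSum_succ, Real.exp_add, mul_comm]
      refine mul_le_mul_of_nonneg_right (Real.exp_le_exp.2 ?_) (Real.exp_pos _).le
      refine (div_le_self (hd0 _ (by simp)) ?_).trans (hd (k + 1) (by simp)).2
      have : (0 : ℝ) ≤ k := k.cast_nonneg
      linarith
    have h3 : dm * ∑ i ∈ range (k + 1), expCoeff d i ≤ ((k : ℝ) + 1) * expCoeff d (k + 1) := by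
      have := expCoeff_rec d (k + 1)
      push_cast at this
      rw [this, ← sum_Icc_reflect, Finset.mul_sum]
      refine Finset.sum_le_sum fun i hi => mul_le_mul_of_nonneg_right (hd i hi).1 ?_
      exact expCoeff_nonneg hd0 _ (by omega)
    have h4 : 0 ≤ expCoeff d (k + 1) := expCoeff_nonneg hd0 _ le_rfl
    calc Real.exp (harmSum d (k + 1))
        ≤ Real.exp dp * (2 * Real.exp (2 * dp * (dp + 1)) * ∑ i ∈ range (k + 1), expCoeff d i) :=
          h2.trans (mul_le_mul_of_nonneg_left h1 (Real.exp_pos _).le)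
      _ = (2 * Real.exp (2 * dp * (dp + 1)) * Real.exp dp / dm)
            * (dm * ∑ i ∈ range (k + 1), expCoeff d i) := by field_simp
      _ ≤ (2 * Real.exp (2 * dp * (dp + 1)) * Real.exp dp / dm)
            * (((k : ℝ) + 1 + 1) * expCoeff d (k + 1)) := by
          refine mul_le_mul_of_nonneg_left (h3.trans ?_) (by positivity)
          refine mul_le_mul_of_nonneg_right (by linarith) h4
      _ ≤ _ := by
          push_cast
          refine mul_le_mul_of_nonneg_right (le_max_right _ _) ?_
          positivity

/-- Used to trade a difference of harmonic sums for a power of (n + 1)/(N + 1), here and in all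
growth estimates. -/
theorem log_le_harmSum_sub {dm : ℝ} (hdm : 0 ≤ dm) {d : ℕ → ℝ} {N n : ℕ} (hNn : N ≤ n)
    (hd : ∀ i ∈ Icc 1 n, dm ≤ d i) :
    dm * Real.log ((n + 1 : ℝ) / (N + 1)) ≤ harmSum d n - harmSum d N := by
  induction n, hNn using Nat.le_induction with
  | base =>
    have : ((N : ℝ) + 1) ≠ 0 := by positivity
    simp [div_self this]
  | succ n hn ih =>
    have ih' := ih fun i hi => hd i (by rw [Finset.mem_Icc] at hi ⊢; omega)
    have hn1 : (0 : ℝ) < n + 1 := by positivity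
    have h1 : Real.log (((n + 1 : ℕ) + 1 : ℝ) / (N + 1))
        = Real.log ((n + 1 : ℝ) / (N + 1)) + Real.log (1 + 1 / (n + 1 : ℝ)) := by
      rw [← Real.log_mul (by positivity) (by positivity)]
      congr 1
      push_cast
      field_simp
    have h2 : Real.log (1 + 1 / (n + 1 : ℝ)) ≤ 1 / (n + 1 : ℝ) := by
      have := Real.log_le_sub_one_of_pos (show (0 : ℝ) < 1 + 1 / (n + 1 : ℝ) by positivity)
      linarith
    have h3 : dm / (n + 1 : ℝ) ≤ d (n + 1) / (n + 1 : ℝ) :=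
      div_le_div_of_nonneg_right (hd _ (by simp)) hn1.le
    rw [h1, harmSum_succ]
    have h4 : dm * Real.log (1 + 1 / (n + 1 : ℝ)) ≤ dm / (n + 1 : ℝ) := by
      rw [div_eq_mul_one_div dm]
      exact mul_le_mul_of_nonneg_left h2 hdm
    linarith [mul_add dm (Real.log ((n + 1 : ℝ) / (N + 1))) (Real.log (1 + 1 / (n + 1 : ℝ)))]

theorem harmSum_half_le {dm : ℝ} {d : ℕ → ℝ} {N : ℕ} (hN : 1 ≤ N) (hdm : 0 ≤ dm)
    (hd : ∀ i ∈ Icc 1 N, dm ≤ d i) : harmSum d (N / 2) + dm / 2 ≤ harmSum d N := by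
  have hN0 : (0 : ℝ) < N := by exact_mod_cast hN
  have h1 : harmSum d N = harmSum d (N / 2) + ∑ i ∈ Ioc (N / 2) N, d i / i := by
    rw [harmSum, harmSum, ← Finset.sum_union]
    · congr 1
      ext i
      simp only [Finset.mem_union, Finset.mem_Icc, Finset.mem_Ioc]
      omega
    · rw [Finset.disjoint_left]
      intro i
      simp only [Finset.mem_Icc, Finset.mem_Ioc]
      omega
  rw [h1]
  refine add_le_add_right ?_ _
  have h2 : ∑ i ∈ Ioc (N / 2) N, dm / N ≤ ∑ i ∈ Ioc (N / 2) N, d i / i := by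
    refine Finset.sum_le_sum fun i hi => ?_
    rw [Finset.mem_Ioc] at hi
    have hi0 : (0 : ℝ) < i := by exact_mod_cast (by omega : 0 < i)
    have hdi := hd i (by rw [Finset.mem_Icc]; omega)
    exact div_le_div₀ (hdm.trans hdi) hdi hi0 (by exact_mod_cast hi.2)
  refine le_trans ?_ h2
  rw [Finset.sum_const, Nat.card_Ioc, nsmul_eq_mul]
  have h3 : (N : ℝ) / 2 ≤ ((N - N / 2 : ℕ) : ℝ) := by
    rw [div_le_iff₀ (by norm_num)]
    exact_mod_cast (by omega : N ≤ (N - N / 2) * 2)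
  calc dm / 2 = (N : ℝ) / 2 * (dm / N) := by field_simp
    _ ≤ _ := mul_le_mul_of_nonneg_right h3 (by positivity)

end PartitionFunction
end RandPerm

namespace RandPerm

/-! ### Halász-type bounds for sums of absolute values of coefficients. -/

section MeanValue

open Finset

/-- `∑_{i=1}^N (d_i / i) (1 - Re (f_i e^{i i φ}))`, the logarithmic decay of the generating
function at the point `e^{i φ}`. -/
noncomputable def decaySum (d : ℕ → ℝ) (f : ℕ → ℂ) (N : ℕ) (φ : ℝ) : ℝ :=
  ∑ i ∈ Icc 1 N, d i / i * (1 - (f i * Complex.exp (i * φ * Complex.I)).re)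

/-- Weights between `dm` and `dp`, multipliers of modulus at most one, and a lower bound for the
decay of the generating function on the unit circle. -/
structure Decay (dm dp : ℝ) (d : ℕ → ℝ) (f : ℕ → ℂ) (n : ℕ) (y th Cy : ℝ) : Prop where
  bounds : ∀ i ∈ Icc 1 n, dm ≤ d i ∧ d i ≤ dp
  norm_le : ∀ i ∈ Icc 1 n, ‖f i‖ ≤ 1
  le_decaySum : ∀ φ : ℝ, |φ| ≤ Real.pi →
    y + th * Real.log (1 + n * |φ|) - Cy ≤ decaySum d f n φ

theorem norm_expPoly (N : ℕ) (d : ℕ → ℝ) (f : ℕ → ℂ) {z : ℂ} (hz : ‖z‖ = 1) :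
    ‖expPoly N (fun i => d i * f i) z‖ = Real.exp (harmSum d N - decaySum d f N z.arg) := by
  rw [expPoly, Complex.norm_exp, Complex.re_sum, harmSum, decaySum, ← Finset.sum_sub_distrib]
  congr 1
  refine Finset.sum_congr rfl fun i _ => ?_
  have h1 : z ^ i = Complex.exp (i * z.arg * Complex.I) := by
    have h := Complex.norm_mul_exp_arg_mul_I z
    rw [hz, Complex.ofReal_one, one_mul] at h
    conv_lhs => rw [← h, ← Complex.exp_nat_mul]
    congr 1
    ring
  rw [h1]
  have h2 : (d i : ℂ) * f i * Complex.exp (i * z.arg * Complex.I) / i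
      = ((d i / i : ℝ) : ℂ) * (f i * Complex.exp (i * z.arg * Complex.I)) := by
    push_cast
    ring
  rw [h2, Complex.re_ofReal_mul]
  ring

theorem re_mul_exp_bounds {w : ℂ} (hw : ‖w‖ ≤ 1) (i : ℕ) (φ : ℝ) :
    0 ≤ 1 - (w * Complex.exp (i * φ * Complex.I)).re ∧
      1 - (w * Complex.exp (i * φ * Complex.I)).re ≤ 2 := by
  have h1 : ‖w * Complex.exp (i * φ * Complex.I)‖ ≤ 1 := by
    rw [norm_mul, show ((i : ℂ) * φ * Complex.I) = ((i * φ : ℝ) : ℂ) * Complex.I by push_cast; ring,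
      Complex.norm_exp_ofReal_mul_I, mul_one]
    exact hw
  have h2 := (Complex.abs_re_le_norm _).trans h1
  rw [abs_le] at h2
  exact ⟨by linarith [h2.2], by linarith [h2.1]⟩

theorem decaySum_nonneg {d : ℕ → ℝ} {f : ℕ → ℂ} {N : ℕ} (hd : ∀ i ∈ Icc 1 N, 0 ≤ d i)
    (hf : ∀ i ∈ Icc 1 N, ‖f i‖ ≤ 1) (φ : ℝ) : 0 ≤ decaySum d f N φ :=
  Finset.sum_nonneg fun i hi =>
    mul_nonneg (div_nonneg (hd i hi) i.cast_nonneg) (re_mul_exp_bounds (hf i hi) i φ).1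

theorem decaySum_sub_le {d : ℕ → ℝ} {f : ℕ → ℂ} {N n : ℕ} (hN : N ≤ n)
    (hd : ∀ i ∈ Icc 1 n, 0 ≤ d i) (hf : ∀ i ∈ Icc 1 n, ‖f i‖ ≤ 1) (φ : ℝ) :
    decaySum d f n φ - decaySum d f N φ ≤ 2 * (harmSum d n - harmSum d N) := by
  have hsub : Icc 1 N ⊆ Icc 1 n := Finset.Icc_subset_Icc_right hN
  rw [decaySum, decaySum, harmSum, harmSum, ← Finset.sum_sdiff hsub,
    ← Finset.sum_sdiff (f := fun i => d i / (i : ℝ)) hsub, add_sub_cancel_right,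
    add_sub_cancel_right, Finset.mul_sum]
  refine Finset.sum_le_sum fun i hi => ?_
  have hi' := (Finset.mem_sdiff.1 hi).1
  rw [mul_comm 2]
  exact mul_le_mul_of_nonneg_left (re_mul_exp_bounds (hf i hi') i φ).2
    (div_nonneg (hd i hi') i.cast_nonneg)

theorem decaySum_le {d : ℕ → ℝ} {f : ℕ → ℂ} {n : ℕ} (hd : ∀ i ∈ Icc 1 n, 0 ≤ d i)
    (hf : ∀ i ∈ Icc 1 n, ‖f i‖ ≤ 1) (φ : ℝ) : decaySum d f n φ ≤ 2 * harmSum d n := by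
  have := decaySum_sub_le (Nat.zero_le n) hd hf φ
  simpa [decaySum, harmSum] using this

theorem harmSum_mono {d : ℕ → ℝ} {N n : ℕ} (hN : N ≤ n) (hd : ∀ i ∈ Icc 1 n, 0 ≤ d i) :
    harmSum d N ≤ harmSum d n :=
  Finset.sum_le_sum_of_subset_of_nonneg (Finset.Icc_subset_Icc_right hN)
    fun i hi _ => div_nonneg (hd i hi) i.cast_nonneg

/-- On a dyadic block 1/k is at most 2/N, so Cauchy–Schwarz reduces the sum to the ℓ² norm of the
convolution, which Parseval bounds by S dp √N. The powers of N cancel. -/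
theorem sum_block_le {u x : ℕ → ℂ} (hu : Summable fun k => ‖u k‖) {S dp : ℝ} {N : ℕ}
    (hN : 1 ≤ N) (hdp : 0 ≤ dp) (hS : ∀ z : ℂ, ‖z‖ = 1 → ‖∑' k, u k * z ^ k‖ ≤ S)
    (hx : ∀ i ∈ Icc 1 N, ‖x i‖ ≤ dp) :
    ∑ k ∈ Ioc (N / 2) N, ‖∑ i ∈ Icc 1 k, x i * u (k - i)‖ / k ≤ 2 * dp * S := by
  have hN0 : (0 : ℝ) < N := by exact_mod_cast hN
  have hS0 : 0 ≤ S := (norm_nonneg _).trans (hS 1 (by simp))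
  set c : ℕ → ℝ := fun k => ‖∑ i ∈ Icc 1 k, x i * u (k - i)‖ with hc
  have h1 : ∑ k ∈ Ioc (N / 2) N, c k / k ≤ (2 / N) * ∑ k ∈ Ioc (N / 2) N, c k := by
    rw [Finset.mul_sum]
    refine Finset.sum_le_sum fun k hk => ?_
    rw [Finset.mem_Ioc] at hk
    have hk0 : (0 : ℝ) < k := by exact_mod_cast (by omega : 0 < k)
    rw [div_eq_mul_inv, mul_comm]
    refine mul_le_mul_of_nonneg_right ?_ (norm_nonneg _)
    rw [inv_eq_one_div, div_le_div_iff₀ hk0 hN0]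
    exact_mod_cast (by omega : 1 * N ≤ 2 * k)
  have h2 : (∑ k ∈ Ioc (N / 2) N, c k) ^ 2 ≤ (N * (S * dp)) ^ 2 := by
    calc (∑ k ∈ Ioc (N / 2) N, c k) ^ 2 ≤ #(Ioc (N / 2) N) * ∑ k ∈ Ioc (N / 2) N, c k ^ 2 :=
          sq_sum_le_card_mul_sum_sq
      _ ≤ N * (S ^ 2 * (N * dp ^ 2)) := by
          refine mul_le_mul ?_ ?_ (Finset.sum_nonneg fun _ _ => sq_nonneg _) hN0.le
          · rw [Nat.card_Ioc]
            exact_mod_cast Nat.sub_le _ _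
          · calc ∑ k ∈ Ioc (N / 2) N, c k ^ 2 ≤ ∑ k ∈ range (N + 1), c k ^ 2 := by
                  refine Finset.sum_le_sum_of_subset_of_nonneg (fun k hk => ?_)
                    fun _ _ _ => sq_nonneg _
                  rw [Finset.mem_Ioc] at hk
                  rw [Finset.mem_range]
                  omega
              _ ≤ S ^ 2 * ∑ i ∈ Icc 1 N, ‖x i‖ ^ 2 := sum_sq_norm_conv_le u x hu S hS N
              _ ≤ S ^ 2 * (N * dp ^ 2) := by
                  refine mul_le_mul_of_nonneg_left ?_ (sq_nonneg _)
                  calc ∑ i ∈ Icc 1 N, ‖x i‖ ^ 2 ≤ ∑ i ∈ Icc 1 N, dp ^ 2 :=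
                        Finset.sum_le_sum fun i hi =>
                          pow_le_pow_left₀ (norm_nonneg _) (hx i hi) 2
                    _ = _ := by simp
      _ = _ := by ring
  have h3 := abs_le_of_sq_le_sq' h2 (by positivity)
  calc _ ≤ (2 / N) * ∑ k ∈ Ioc (N / 2) N, c k := h1
    _ ≤ (2 / N) * (N * (S * dp)) := mul_le_mul_of_nonneg_left h3.2 (by positivity)
    _ = _ := by field_simp

/-- Summation of a geometric series over dyadic blocks: the majorant W shrinks by γ under halving,
and the constant A/(1 - γ) is the fixed point of the induction. -/
theorem le_of_dyadic_step {S W : ℕ → ℝ} {n : ℕ} {A γ : ℝ} (hγ : γ < 1) (hA : 0 ≤ A)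
    (h0 : S 0 ≤ A / (1 - γ) * W 0)
    (hS : ∀ N, 1 ≤ N → N ≤ n → S N ≤ S (N / 2) + A * W N)
    (hW : ∀ N, 1 ≤ N → N ≤ n → W (N / 2) ≤ γ * W N) :
    ∀ N, N ≤ n → S N ≤ A / (1 - γ) * W N := by
  intro N
  induction N using Nat.strong_induction_on with
  | _ N ih =>
    intro hN
    rcases Nat.eq_zero_or_pos N with rfl | hpos
    · exact h0
    have h1 := ih (N / 2) (by omega) (by omega)
    have h2 : A / (1 - γ) * W (N / 2) ≤ A / (1 - γ) * (γ * W N) :=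
      mul_le_mul_of_nonneg_left (hW N hpos hN) (div_nonneg hA (by linarith))
    have h3 : A / (1 - γ) * (γ * W N) + A * W N = A / (1 - γ) * W N := by
      have : 1 - γ ≠ 0 := by linarith
      field_simp
      ring
    linarith [hS N hpos hN]

/-- The size `exp (D_N + c (D_n - D_N) - c₀ y)` to which partial sums of coefficients are
compared. -/
noncomputable def envelope (d : ℕ → ℝ) (n : ℕ) (c c0 y : ℝ) (N : ℕ) : ℝ :=
  Real.exp (harmSum d N + c * (harmSum d n - harmSum d N) - c0 * y)

theorem envelope_pos (d : ℕ → ℝ) (n : ℕ) (c c0 y : ℝ) (N : ℕ) : 0 < envelope d n c c0 y N :=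
  Real.exp_pos _

/-- Halving N lowers the harmonic sum by at least dm/2, and c ≤ 1/2 keeps at least half of that
loss; this is the ratio γ of the dyadic induction. -/
theorem envelope_half_le {dm : ℝ} {d : ℕ → ℝ} {n N : ℕ} {c c0 y : ℝ} (hN : 1 ≤ N) (hNn : N ≤ n)
    (hdm : 0 ≤ dm) (hc : c ≤ 1 / 2) (hd : ∀ i ∈ Icc 1 n, dm ≤ d i) :
    envelope d n c c0 y (N / 2) ≤ Real.exp (-(dm / 4)) * envelope d n c c0 y N := by
  rw [envelope, envelope, ← Real.exp_add]
  refine Real.exp_le_exp.2 ?_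
  have h := harmSum_half_le hN hdm fun i hi => hd i (Finset.Icc_subset_Icc_right hNn hi)
  nlinarith

/-- A factor ((n+1)/(N+1))^th is paid for by raising c by th/dm, because the harmonic sum grows by
at least dm log((n+1)/(N+1)) from N to n. -/
theorem envelope_gain {dm : ℝ} {d : ℕ → ℝ} {n N : ℕ} {c c0 y th : ℝ} (hNn : N ≤ n)
    (hdm : 0 < dm) (hth : 0 ≤ th) (hd : ∀ i ∈ Icc 1 n, dm ≤ d i) :
    envelope d n c c0 y N * ((n + 1 : ℝ) / (N + 1)) ^ th
      ≤ envelope d n (c + th / dm) c0 y N := by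
  have h := log_le_harmSum_sub hdm.le hNn hd
  rw [envelope, envelope, Real.rpow_def_of_pos (by positivity), ← Real.exp_add]
  refine Real.exp_le_exp.2 ?_
  have h1 : th / dm * (dm * Real.log ((n + 1 : ℝ) / (N + 1)))
      ≤ th / dm * (harmSum d n - harmSum d N) :=
    mul_le_mul_of_nonneg_left h (by positivity)
  have h2 : th / dm * (dm * Real.log ((n + 1 : ℝ) / (N + 1)))
      = Real.log ((n + 1 : ℝ) / (N + 1)) * th := by
    field_simp
  nlinarith

variable {dm dp : ℝ} {d : ℕ → ℝ} {f : ℕ → ℂ} {n : ℕ} {y th Cy : ℝ}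

/-- The decay hypothesis concerns the full sum up to n, whereas the function is truncated at N. The
missing terms cost at most 2(D_n - D_N), which would be ruinous; since the decay at N is nonnegative
it may first be multiplied by c0 ≤ 1, and the cost becomes 2 c0 (D_n - D_N), the value c = 2 c0 of
the envelope. -/
theorem Decay.norm_expPoly_le (h : Decay dm dp d f n y th Cy) (hdm : 0 < dm) {c0 : ℝ}
    (hc0 : 0 ≤ c0) (hc1 : c0 ≤ 1) {N : ℕ} (hN : N ≤ n) {z : ℂ} (hz : ‖z‖ = 1) :
    ‖expPoly N (fun i => d i * f i) z‖
      ≤ Real.exp (c0 * Cy) * envelope d n (2 * c0) c0 y N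
        * (1 + n * |z.arg|) ^ (-(c0 * th)) := by
  have hd0 : ∀ i ∈ Icc 1 n, 0 ≤ d i := fun i hi => hdm.le.trans (h.bounds i hi).1
  have hY := h.le_decaySum z.arg (Complex.abs_arg_le_pi z)
  have h0 : 0 ≤ decaySum d f N z.arg :=
    decaySum_nonneg (fun i hi => hd0 i (Finset.Icc_subset_Icc_right hN hi))
      (fun i hi => h.norm_le i (Finset.Icc_subset_Icc_right hN hi)) _
  have h2 := decaySum_sub_le hN hd0 h.norm_le z.arg
  rw [norm_expPoly N d f hz, envelope, Real.rpow_def_of_pos (by positivity), ← Real.exp_add,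
    ← Real.exp_add]
  refine Real.exp_le_exp.2 ?_
  have h3 : c0 * decaySum d f N z.arg ≤ decaySum d f N z.arg := mul_le_of_le_one_left h0 hc1
  have h4 := mul_le_mul_of_nonneg_left hY hc0
  have h5 := mul_le_mul_of_nonneg_left h2 hc0
  linarith

/-- The start of the dyadic inductions, where the coefficient of index 0 equals 1. The decay sum at
φ = 0 never exceeds 2 D_n, so y - Cy ≤ 2 D_n and the factor e^{-c0 y} cannot make the envelope at 0
small. -/
theorem Decay.one_le_envelope (h : Decay dm dp d f n y th Cy) (hdm : 0 < dm) {c0 c : ℝ}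
    (hc0 : 0 ≤ c0) (hc : 2 * c0 ≤ c) :
    1 ≤ Real.exp (c0 * Cy) * envelope d n c c0 y 0 := by
  have hd0 : ∀ i ∈ Icc 1 n, 0 ≤ d i := fun i hi => hdm.le.trans (h.bounds i hi).1
  have hY := h.le_decaySum 0 (by simp [Real.pi_pos.le])
  have h1 := decaySum_le hd0 h.norm_le 0
  simp only [abs_zero, mul_zero, add_zero, Real.log_one] at hY
  rw [envelope, ← Real.exp_add]
  refine Real.one_le_exp ?_
  have h2 : harmSum d 0 = 0 := by simp [harmSum]
  have h3 : 0 ≤ harmSum d n := h2 ▸ harmSum_mono (Nat.zero_le n) hd0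
  have h4 := mul_le_mul_of_nonneg_left (hY.trans h1) hc0
  have h5 := mul_le_mul_of_nonneg_right hc h3
  rw [h2]
  linarith

theorem sum_range_succ_eq_half_add {E : Type*} [AddCommMonoid E] (g : ℕ → E) (N : ℕ) :
    ∑ k ∈ range (N + 1), g k = ∑ k ∈ range (N / 2 + 1), g k + ∑ k ∈ Ioc (N / 2) N, g k := by
  rw [← Finset.sum_union]
  · congr 1
    ext i
    simp only [Finset.mem_union, Finset.mem_range, Finset.mem_Ioc]
    omega
  · rw [Finset.disjoint_left]
    intro i
    simp only [Finset.mem_range, Finset.mem_Ioc]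
    omega

theorem summable_norm_expCoeff_cutoff (N : ℕ) (x : ℕ → ℂ) :
    Summable fun k => ‖expCoeff (cutoff N x) k‖ := by
  have := (hasSum_expPoly N x 1).summable.norm
  simpa using this

theorem norm_mul_le_of_mem {dp : ℝ} {d : ℕ → ℝ} {f : ℕ → ℂ} {i : ℕ} (hd : 0 ≤ d i ∧ d i ≤ dp)
    (hf : ‖f i‖ ≤ 1) : ‖(d i : ℂ) * f i‖ ≤ dp := by
  rw [norm_mul, Complex.norm_real, Real.norm_of_nonneg hd.1]
  exact (mul_le_of_le_one_right hd.1 hf).trans hd.2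

/-- By the recursion |M_k| is a convolution divided by k, so `sum_block_le` applies on each dyadic
block, and the blocks are added by `le_of_dyadic_step`. The extra 1 in 2 dp + 1 covers N = 0. -/
theorem Decay.sum_norm_expCoeff_le (h : Decay dm dp d f n y th Cy) (hdm : 0 < dm)
    (hdp : 0 ≤ dp) {c0 : ℝ} (hc0 : 0 ≤ c0) (hc1 : c0 ≤ 1 / 4) (hth : 0 ≤ th) :
    ∀ N, N ≤ n → ∑ k ∈ range (N + 1), ‖expCoeff (fun i => d i * f i) k‖
      ≤ (2 * dp + 1) / (1 - Real.exp (-(dm / 4))) *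
        (Real.exp (c0 * Cy) * envelope d n (2 * c0) c0 y N) := by
  have hγ : Real.exp (-(dm / 4)) < 1 := by
    rw [Real.exp_lt_one_iff]
    linarith
  refine le_of_dyadic_step hγ (by linarith) ?_ (fun N hN1 hN => ?_) (fun N hN1 hN => ?_)
  · have h1 := h.one_le_envelope hdm hc0 le_rfl
    have h2 : 1 ≤ (2 * dp + 1) / (1 - Real.exp (-(dm / 4))) := by
      rw [le_div_iff₀ (by linarith)]
      have := Real.exp_pos (-(dm / 4))
      linarith
    simp only [zero_add, Finset.sum_range_one, expCoeff_zero, norm_one]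
    exact one_le_mul_of_one_le_of_one_le h2 h1
  · rw [sum_range_succ_eq_half_add]
    refine add_le_add_right ?_ _
    set x : ℕ → ℂ := fun i => d i * f i with hx
    have hS : ∀ z : ℂ, ‖z‖ = 1 → ‖∑' k, expCoeff (cutoff N x) k * z ^ k‖
        ≤ Real.exp (c0 * Cy) * envelope d n (2 * c0) c0 y N := by
      intro z hz
      rw [(hasSum_expPoly N x z).tsum_eq]
      refine (h.norm_expPoly_le hdm hc0 (by linarith) hN hz).trans ?_
      refine mul_le_of_le_one_right (mul_nonneg (Real.exp_pos _).le (envelope_pos _ _ _ _ _ _).le) ?_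
      refine Real.rpow_le_one_of_one_le_of_nonpos ?_ (by linarith [mul_nonneg hc0 hth])
      have : 0 ≤ (n : ℝ) * |z.arg| := by positivity
      linarith
    have hb := sum_block_le (summable_norm_expCoeff_cutoff N x) hN1 hdp hS (x := x)
      (fun i hi => by
        have hi' := Finset.Icc_subset_Icc_right hN hi
        exact norm_mul_le_of_mem ⟨hdm.le.trans (h.bounds i hi').1, (h.bounds i hi').2⟩
          (h.norm_le i hi'))
    refine (le_of_eq ?_).trans (hb.trans ?_)
    · refine Finset.sum_congr rfl fun k hk => ?_
      rw [Finset.mem_Ioc] at hk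
      have hk0 : (0 : ℝ) < k := by exact_mod_cast (by omega : 0 < k)
      have h1 : ∑ i ∈ Icc 1 k, x i * expCoeff (cutoff N x) (k - i) = k * expCoeff x k := by
        rw [expCoeff_rec]
        exact Finset.sum_congr rfl fun i _ => by rw [expCoeff_cutoff N x (by omega)]
      rw [h1, norm_mul, Complex.norm_natCast]
      field_simp
    · refine mul_le_mul_of_nonneg_right (by linarith) ?_
      exact mul_nonneg (Real.exp_pos _).le (envelope_pos _ _ _ _ _ _).le
  · have := envelope_half_le (c := 2 * c0) (c0 := c0) (y := y) hN1 hN hdm.le (by linarith)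
      fun i hi => (h.bounds i hi).1
    have := mul_le_mul_of_nonneg_left this (Real.exp_pos (c0 * Cy)).le
    linarith

end MeanValue
end RandPerm

namespace RandPerm

/-! ### Increments of the coefficients, through the factor 1 - z^j. -/

section Increments

open Finset

/-- The coefficients `M_k - M_{k-j}` of `(1 - z^j) ∑ M_k z^k`. -/
noncomputable def diffCoeff (x : ℕ → ℂ) (j k : ℕ) : ℂ :=
  expCoeff x k - if j ≤ k then expCoeff x (k - j) else 0

/-- Applying z d/dz to (1 - z^j) F(z) reproduces the recursion, with the extra term -j z^j F(z) from
the derivative of the first factor. -/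
theorem diffCoeff_rec (x : ℕ → ℂ) (j k : ℕ) :
    (k : ℂ) * diffCoeff x j k = ∑ i ∈ Icc 1 k, x i * diffCoeff x j (k - i)
      - if j ≤ k then (j : ℂ) * expCoeff x (k - j) else 0 := by
  simp only [diffCoeff, mul_sub, Finset.sum_sub_distrib]
  rw [expCoeff_rec, sub_sub]
  congr 1
  split_ifs with h
  · have h1 : ∑ i ∈ Icc 1 k, x i * (if j ≤ k - i then expCoeff x (k - i - j) else 0)
        = ((k - j : ℕ) : ℂ) * expCoeff x (k - j) := by
      rw [expCoeff_rec, ← Finset.sum_subset (Finset.Icc_subset_Icc_right (Nat.sub_le k j))]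
      · refine Finset.sum_congr rfl fun i hi => ?_
        rw [Finset.mem_Icc] at hi
        rw [if_pos (by omega), show k - i - j = k - j - i by omega]
      · intro i hi hi'
        rw [Finset.mem_Icc] at hi hi'
        rw [if_neg (by omega), mul_zero]
    rw [h1, Nat.cast_sub h]
    ring
  · rw [mul_zero, add_zero]
    symm
    refine Finset.sum_eq_zero fun i _ => ?_
    rw [if_neg (by omega), mul_zero]

theorem diffCoeff_cutoff (N : ℕ) (x : ℕ → ℂ) (j : ℕ) {k : ℕ} (hk : k ≤ N) :
    diffCoeff (cutoff N x) j k = diffCoeff x j k := by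
  rw [diffCoeff, diffCoeff, expCoeff_cutoff N x hk]
  split_ifs
  · rw [expCoeff_cutoff N x (by omega)]
  · rfl

theorem hasSum_diffCoeff (N : ℕ) (x : ℕ → ℂ) (j : ℕ) (z : ℂ) :
    HasSum (fun k => diffCoeff (cutoff N x) j k * z ^ k) ((1 - z ^ j) * expPoly N x z) := by
  have h := hasSum_expPoly N x z
  have h1 : HasSum (fun k => (if j ≤ k then expCoeff (cutoff N x) (k - j) else 0) * z ^ k)
      (z ^ j * expPoly N x z) := by
    have h2 := h.mul_left (z ^ j)
    have h3 := (hasSum_nat_add_iff (f := fun k => (if j ≤ k then expCoeff (cutoff N x) (k - j)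
      else 0) * z ^ k) j (g := z ^ j * expPoly N x z)).1 (by
        refine h2.congr_fun fun k => ?_
        rw [if_pos (by omega), Nat.add_sub_cancel, pow_add]
        ring)
    rw [Finset.sum_eq_zero fun i hi => by
      rw [Finset.mem_range] at hi
      rw [if_neg (by omega), zero_mul], add_zero] at h3
    exact h3
  rw [sub_mul, one_mul]
  refine (h.sub h1).congr_fun fun k => ?_
  rw [diffCoeff, sub_mul]

/-- Interpolation between the bounds 2 and j |arg z|. -/
theorem norm_one_sub_pow_le {z : ℂ} (hz : ‖z‖ = 1) (j : ℕ) {θ : ℝ} (h0 : 0 ≤ θ) (h1 : θ ≤ 1) :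
    ‖1 - z ^ j‖ ≤ 2 * (j * |z.arg|) ^ θ := by
  have hj : 0 ≤ (j : ℝ) * |z.arg| := by positivity
  rcases le_or_gt 1 ((j : ℝ) * |z.arg|) with h | h
  · have h2 : ‖1 - z ^ j‖ ≤ 2 := by
      refine (norm_sub_le _ _).trans ?_
      rw [norm_one, norm_pow, hz, one_pow]
      norm_num
    have := Real.one_le_rpow h h0
    linarith
  · have h2 : ‖1 - z ^ j‖ ≤ j * |z.arg| := by
      have h3 : z ^ j = Complex.exp (Complex.I * ((j * z.arg : ℝ) : ℂ)) := by
        have h := Complex.norm_mul_exp_arg_mul_I z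
        rw [hz, Complex.ofReal_one, one_mul] at h
        conv_lhs => rw [← h, ← Complex.exp_nat_mul]
        congr 1
        push_cast
        ring
      rw [norm_sub_rev, h3]
      refine (Real.norm_exp_I_mul_ofReal_sub_one_le).trans ?_
      rw [Real.norm_eq_abs, abs_mul, Nat.abs_cast]
    have h3 : (j : ℝ) * |z.arg| ≤ (j * |z.arg|) ^ θ := by
      rcases hj.eq_or_lt with h' | h'
      · rw [← h']
        exact Real.rpow_nonneg le_rfl _
      · conv_lhs => rw [← Real.rpow_one (j * |z.arg|)]
        exact Real.rpow_le_rpow_of_exponent_ge h' h.le h1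
    have h4 : 0 ≤ (j * |z.arg|) ^ θ := Real.rpow_nonneg hj _
    linarith

variable {dm dp : ℝ} {d : ℕ → ℝ} {f : ℕ → ℂ} {n : ℕ} {y th Cy : ℝ}

/-- The zero of 1 - z^j at z = 1 and the decay of the generating function away from 1 are
complementary: (j|φ|)^θ (1 + n|φ|)^{-θ} ≤ (j/n)^θ with θ = c0 th. -/
theorem Decay.norm_diff_expPoly_le (h : Decay dm dp d f n y th Cy) (hdm : 0 < dm) {c0 : ℝ}
    (hc0 : 0 ≤ c0) (hc1 : c0 ≤ 1) (hth : 0 ≤ th) (hθ : c0 * th ≤ 1) {N j : ℕ} (hN : N ≤ n)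
    (hn : 1 ≤ n) {z : ℂ} (hz : ‖z‖ = 1) :
    ‖(1 - z ^ j) * expPoly N (fun i => d i * f i) z‖
      ≤ 2 * (Real.exp (c0 * Cy) * (((j : ℝ) / n) ^ (c0 * th) * envelope d n (2 * c0) c0 y N)) := by
  have hθ0 : 0 ≤ c0 * th := mul_nonneg hc0 hth
  have hn0 : (0 : ℝ) < n := by exact_mod_cast hn
  have hE : 0 ≤ Real.exp (c0 * Cy) * envelope d n (2 * c0) c0 y N :=
    mul_nonneg (Real.exp_pos _).le (envelope_pos _ _ _ _ _ _).le
  have h1 : ((j : ℝ) * |z.arg|) ^ (c0 * th) * (1 + n * |z.arg|) ^ (-(c0 * th))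
      ≤ ((j : ℝ) / n) ^ (c0 * th) := by
    rw [Real.rpow_neg (by positivity), ← div_eq_mul_inv,
      ← Real.div_rpow (by positivity) (by positivity)]
    refine Real.rpow_le_rpow (by positivity) ?_ hθ0
    rw [div_le_div_iff₀ (by positivity) hn0]
    have : 0 ≤ (j : ℝ) := j.cast_nonneg
    nlinarith
  calc ‖(1 - z ^ j) * expPoly N (fun i => d i * f i) z‖
      ≤ (2 * (j * |z.arg|) ^ (c0 * th)) * (Real.exp (c0 * Cy) * envelope d n (2 * c0) c0 y N
        * (1 + n * |z.arg|) ^ (-(c0 * th))) := by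
        rw [norm_mul]
        exact mul_le_mul (norm_one_sub_pow_le hz j hθ0 hθ)
          (h.norm_expPoly_le hdm hc0 hc1 hN hz) (norm_nonneg _) (by positivity)
    _ = 2 * (Real.exp (c0 * Cy) * envelope d n (2 * c0) c0 y N) *
        (((j : ℝ) * |z.arg|) ^ (c0 * th) * (1 + n * |z.arg|) ^ (-(c0 * th))) := by ring
    _ ≤ 2 * (Real.exp (c0 * Cy) * envelope d n (2 * c0) c0 y N) * ((j : ℝ) / n) ^ (c0 * th) :=
        mul_le_mul_of_nonneg_left h1 (by linarith)
    _ = _ := by ring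

theorem div_le_rpow_mul_rpow {n N j : ℕ} {θ : ℝ} (hn : 1 ≤ n) (hN : 1 ≤ N) (hj : j ≤ N)
    (h0 : 0 ≤ θ) (h1 : θ ≤ 1) :
    (j : ℝ) / N ≤ 2 * (((j : ℝ) / n) ^ θ * ((n + 1 : ℝ) / (N + 1)) ^ θ) := by
  have hn0 : (0 : ℝ) < n := by exact_mod_cast hn
  have hN0 : (0 : ℝ) < N := by exact_mod_cast hN
  have hN1 : (1 : ℝ) ≤ N := by exact_mod_cast hN
  have hjN : (j : ℝ) / N ≤ 1 := by
    rw [div_le_one hN0]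
    exact_mod_cast hj
  have h2 : (j : ℝ) / N ≤ ((j : ℝ) / N) ^ θ := by
    rcases (by positivity : 0 ≤ (j : ℝ) / N).eq_or_lt with h' | h'
    · rw [← h']
      exact Real.rpow_nonneg le_rfl _
    · conv_lhs => rw [← Real.rpow_one ((j : ℝ) / N)]
      exact Real.rpow_le_rpow_of_exponent_ge h' hjN h1
  rw [← Real.mul_rpow (by positivity) (by positivity)]
  calc (j : ℝ) / N ≤ ((j : ℝ) / N) ^ θ := h2
    _ ≤ (2 * ((j : ℝ) / n * ((n + 1 : ℝ) / (N + 1)))) ^ θ := by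
        refine Real.rpow_le_rpow (by positivity) ?_ h0
        rw [div_mul_div_comm, ← mul_div_assoc, div_le_div_iff₀ hN0 (by positivity)]
        have : 0 ≤ (j : ℝ) := j.cast_nonneg
        nlinarith [mul_nonneg this hn0.le, mul_nonneg (mul_nonneg this hn0.le) (sub_nonneg.2 hN1), mul_nonneg this hN0.le]
    _ = (2 : ℝ) ^ θ * ((j : ℝ) / n * ((n + 1 : ℝ) / (N + 1))) ^ θ :=
        Real.mul_rpow (by norm_num) (by positivity)
    _ ≤ 2 * ((j : ℝ) / n * ((n + 1 : ℝ) / (N + 1))) ^ θ := by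
        refine mul_le_mul_of_nonneg_right ?_ (by positivity)
        conv_rhs => rw [← Real.rpow_one (2 : ℝ)]
        exact Real.rpow_le_rpow_of_exponent_le (by norm_num) h1

/-- The dyadic argument for (1 - z^j) F. The convolution part is bounded as before, now with
supremum of order (j/n)^θ. The inhomogeneous term j M_{k-j}, divided by k > N/2, is at most
(2j/N)|M_{k-j}| and is present only if j ≤ N; there j/N is bounded by (j/n)^θ ((n+1)/(N+1))^θ, and
the last factor is absorbed by raising c by θ/dm. -/
theorem Decay.sum_norm_diffCoeff_le (h : Decay dm dp d f n y th Cy) (hdm : 0 < dm)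
    (hdp : 0 ≤ dp) {c0 : ℝ} (hc0 : 0 ≤ c0) (hth : 0 ≤ th) (hθ : c0 * th ≤ 1)
    (hc : 2 * c0 + c0 * th / dm ≤ 1 / 2) {j : ℕ} (hj1 : 1 ≤ j) (hjn : j ≤ n) :
    ∀ N, N ≤ n → ∑ k ∈ range (N + 1), ‖diffCoeff (fun i => d i * f i) j k‖
      ≤ (4 * dp + 1 + 4 * ((2 * dp + 1) / (1 - Real.exp (-(dm / 4)))))
          / (1 - Real.exp (-(dm / 4))) *
        (Real.exp (c0 * Cy) * (((j : ℝ) / n) ^ (c0 * th) *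
          envelope d n (2 * c0 + c0 * th / dm) c0 y N)) := by
  have hγ : Real.exp (-(dm / 4)) < 1 := by
    rw [Real.exp_lt_one_iff]
    linarith
  have hγ0 := Real.exp_pos (-(dm / 4))
  have hn : 1 ≤ n := hj1.trans hjn
  have hn0 : (0 : ℝ) < n := by exact_mod_cast hn
  have hj0 : (0 : ℝ) < j := by exact_mod_cast hj1
  have hθ0 : 0 ≤ c0 * th := mul_nonneg hc0 hth
  have hcθ : 0 ≤ c0 * th / dm := div_nonneg hθ0 hdm.le
  have hd : ∀ i ∈ Icc 1 n, dm ≤ d i := fun i hi => (h.bounds i hi).1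
  set K := (2 * dp + 1) / (1 - Real.exp (-(dm / 4))) with hK
  have hK0 : 0 ≤ K := div_nonneg (by linarith) (by linarith)
  have henv : ∀ N, N ≤ n → envelope d n (2 * c0) c0 y N * ((n + 1 : ℝ) / (N + 1)) ^ (c0 * th)
      ≤ envelope d n (2 * c0 + c0 * th / dm) c0 y N := fun N hN => envelope_gain hN hdm hθ0 hd
  have hone : ∀ N : ℕ, N ≤ n → 1 ≤ ((n + 1 : ℝ) / (N + 1)) ^ (c0 * th) := fun N hN => by
    refine Real.one_le_rpow ?_ hθ0
    rw [one_le_div (by positivity)]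
    have : (N : ℝ) ≤ n := by exact_mod_cast hN
    linarith
  refine le_of_dyadic_step hγ (by linarith) ?_ (fun N hN1 hN => ?_) (fun N hN1 hN => ?_)
  · have h1 := h.one_le_envelope hdm hc0 le_rfl
    have h2 : 1 ≤ (4 * dp + 1 + 4 * K) / (1 - Real.exp (-(dm / 4))) := by
      rw [le_div_iff₀ (by linarith)]
      linarith
    have h3 : diffCoeff (fun i => d i * f i) j 0 = 1 := by
      rw [diffCoeff, if_neg (by omega), expCoeff_zero, sub_zero]
    simp only [zero_add, Finset.sum_range_one, h3, norm_one]
    refine one_le_mul_of_one_le_of_one_le h2 (h1.trans ?_)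
    refine mul_le_mul_of_nonneg_left ?_ (Real.exp_pos _).le
    have h4 := henv 0 (Nat.zero_le n)
    -- At N = 0 the possibly small factor (j/n)^θ is compensated by the gain (n + 1)^θ, because j ≥
    -- 1.
    have h5 : 1 ≤ ((j : ℝ) / n) ^ (c0 * th) * ((n + 1 : ℝ) / ((0 : ℕ) + 1)) ^ (c0 * th) := by
      rw [← Real.mul_rpow (by positivity) (by positivity)]
      refine Real.one_le_rpow ?_ hθ0
      rw [div_mul_div_comm, one_le_div (by positivity)]
      have : (1 : ℝ) ≤ j := by exact_mod_cast hj1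
      push_cast
      nlinarith
    calc envelope d n (2 * c0) c0 y 0 ≤ envelope d n (2 * c0) c0 y 0 *
          (((j : ℝ) / n) ^ (c0 * th) * ((n + 1 : ℝ) / ((0 : ℕ) + 1)) ^ (c0 * th)) :=
          le_mul_of_one_le_right (envelope_pos _ _ _ _ _ _).le h5
      _ = ((j : ℝ) / n) ^ (c0 * th) * (envelope d n (2 * c0) c0 y 0 *
          ((n + 1 : ℝ) / ((0 : ℕ) + 1)) ^ (c0 * th)) := by ring
      _ ≤ _ := mul_le_mul_of_nonneg_left h4 (by positivity)
  · rw [sum_range_succ_eq_half_add]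
    refine add_le_add_right ?_ _
    have hN0 : (0 : ℝ) < N := by exact_mod_cast hN1
    set x : ℕ → ℂ := fun i => d i * f i with hx
    set E := Real.exp (c0 * Cy) * (((j : ℝ) / n) ^ (c0 * th) *
      envelope d n (2 * c0 + c0 * th / dm) c0 y N) with hE
    have hE0 : 0 ≤ E := mul_nonneg (Real.exp_pos _).le
      (mul_nonneg (by positivity) (envelope_pos _ _ _ _ _ _).le)
    have hS : ∀ z : ℂ, ‖z‖ = 1 → ‖∑' k, diffCoeff (cutoff N x) j k * z ^ k‖ ≤ 2 * E := by
      intro z hz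
      rw [(hasSum_diffCoeff N x j z).tsum_eq]
      refine (h.norm_diff_expPoly_le hdm hc0 (by linarith) hth hθ hN hn hz).trans ?_
      have : envelope d n (2 * c0) c0 y N ≤ envelope d n (2 * c0 + c0 * th / dm) c0 y N :=
        (le_mul_of_one_le_right (envelope_pos _ _ _ _ _ _).le (hone N hN)).trans (henv N hN)
      rw [hE]
      gcongr
    have hsum : Summable fun k => ‖diffCoeff (cutoff N x) j k‖ := by
      have := (hasSum_diffCoeff N x j 1).summable.norm
      simpa using this
    have hb := sum_block_le hsum hN1 hdp hS (x := x)
      (fun i hi => by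
        have hi' := Finset.Icc_subset_Icc_right hN hi
        exact norm_mul_le_of_mem ⟨hdm.le.trans (h.bounds i hi').1, (h.bounds i hi').2⟩
          (h.norm_le i hi'))
    have hterm : ∀ k ∈ Ioc (N / 2) N, ‖diffCoeff x j k‖
        ≤ ‖∑ i ∈ Icc 1 k, x i * diffCoeff (cutoff N x) j (k - i)‖ / k
          + (if j ≤ k then (2 * j / N : ℝ) * ‖expCoeff x (k - j)‖ else 0) := by
      intro k hk
      rw [Finset.mem_Ioc] at hk
      have hk0 : (0 : ℝ) < k := by exact_mod_cast (by omega : 0 < k)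
      have h1 : ∑ i ∈ Icc 1 k, x i * diffCoeff (cutoff N x) j (k - i)
          = k * diffCoeff x j k + if j ≤ k then (j : ℂ) * expCoeff x (k - j) else 0 := by
        rw [diffCoeff_rec, sub_add_cancel]
        exact Finset.sum_congr rfl fun i _ => by rw [diffCoeff_cutoff N x j (by omega)]
      have h2 : ‖(k : ℂ) * diffCoeff x j k‖ ≤ ‖∑ i ∈ Icc 1 k, x i * diffCoeff (cutoff N x) j (k - i)‖
          + ‖if j ≤ k then (j : ℂ) * expCoeff x (k - j) else 0‖ := by
        rw [h1]
        have := norm_sub_le ((k : ℂ) * diffCoeff x j k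
          + if j ≤ k then (j : ℂ) * expCoeff x (k - j) else 0)
          (if j ≤ k then (j : ℂ) * expCoeff x (k - j) else 0)
        rwa [add_sub_cancel_right] at this
      rw [norm_mul, Complex.norm_natCast] at h2
      have h3 : ‖diffCoeff x j k‖ ≤ ‖∑ i ∈ Icc 1 k, x i * diffCoeff (cutoff N x) j (k - i)‖ / k
          + ‖if j ≤ k then (j : ℂ) * expCoeff x (k - j) else 0‖ / k := by
        rw [← add_div, le_div_iff₀ hk0, mul_comm]
        exact h2
      refine h3.trans (add_le_add_right ?_ _)
      split_ifs
      · rw [norm_mul, Complex.norm_natCast, mul_div_right_comm]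
        refine mul_le_mul_of_nonneg_right ?_ (norm_nonneg _)
        rw [div_le_div_iff₀ hk0 hN0]
        have : (N : ℝ) ≤ 2 * k := by exact_mod_cast (by omega : N ≤ 2 * k)
        nlinarith
      · simp
    have hsecond : ∑ k ∈ Ioc (N / 2) N, (if j ≤ k then (2 * j / N : ℝ) * ‖expCoeff x (k - j)‖ else 0)
        ≤ 4 * K * E := by
      rcases Nat.lt_or_ge N j with hNj | hNj
      · rw [Finset.sum_eq_zero]
        · positivity
        · intro k hk
          rw [Finset.mem_Ioc] at hk
          rw [if_neg (by omega)]
      · have hSN := h.sum_norm_expCoeff_le hdm hdp hc0 (by linarith) hth N hN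
        have h1 : ∑ k ∈ Ioc (N / 2) N,
            (if j ≤ k then (2 * j / N : ℝ) * ‖expCoeff x (k - j)‖ else 0)
            ≤ (2 * j / N : ℝ) * ∑ k ∈ range (N + 1), ‖expCoeff x k‖ := by
          rw [← Finset.sum_filter, ← Finset.mul_sum]
          refine mul_le_mul_of_nonneg_left ?_ (by positivity)
          rw [← Finset.sum_image (f := fun k => ‖expCoeff x k‖) (g := fun k => k - j)]
          · refine Finset.sum_le_sum_of_subset_of_nonneg (fun k hk => ?_) fun _ _ _ => norm_nonneg _
            simp only [Finset.mem_image, Finset.mem_filter, Finset.mem_Ioc] at hk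
            rw [Finset.mem_range]
            omega
          · intro a ha b hb hab
            simp only [Finset.coe_filter, Finset.mem_Ioc, Set.mem_ofPred_eq] at ha hb
            simp only at hab
            omega
        have h2 := div_le_rpow_mul_rpow hn hN1 hNj hθ0 hθ
        have hW := (envelope_pos d n (2 * c0) c0 y N).le
        calc _ ≤ (2 * j / N : ℝ) * ∑ k ∈ range (N + 1), ‖expCoeff x k‖ := h1
          _ ≤ (2 * j / N : ℝ) * (K * (Real.exp (c0 * Cy) * envelope d n (2 * c0) c0 y N)) :=
              mul_le_mul_of_nonneg_left hSN (by positivity)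
          _ = 2 * ((j : ℝ) / N) * (K * (Real.exp (c0 * Cy) * envelope d n (2 * c0) c0 y N)) := by
              ring
          _ ≤ 2 * (2 * (((j : ℝ) / n) ^ (c0 * th) * ((n + 1 : ℝ) / (N + 1)) ^ (c0 * th)))
                * (K * (Real.exp (c0 * Cy) * envelope d n (2 * c0) c0 y N)) := by gcongr
          _ = 4 * K * (Real.exp (c0 * Cy) * (((j : ℝ) / n) ^ (c0 * th) *
                (envelope d n (2 * c0) c0 y N * ((n + 1 : ℝ) / (N + 1)) ^ (c0 * th)))) := by ring
          _ ≤ 4 * K * E := by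
              rw [hE]
              refine mul_le_mul_of_nonneg_left (mul_le_mul_of_nonneg_left
                (mul_le_mul_of_nonneg_left (henv N hN) (by positivity)) (Real.exp_pos _).le) ?_
              linarith
    have h1 := Finset.sum_le_sum hterm
    rw [Finset.sum_add_distrib] at h1
    nlinarith
  · have := envelope_half_le (c := 2 * c0 + c0 * th / dm) (c0 := c0) (y := y) hN1 hN hdm.le hc hd
    have := mul_le_mul_of_nonneg_left this
      (by positivity : 0 ≤ Real.exp (c0 * Cy) * ((j : ℝ) / n) ^ (c0 * th))
    linarith

end Increments
end RandPerm

namespace RandPerm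

/-! ### Pointwise bounds for coefficients and their increments. -/

section CoefficientBounds

open Finset

/-- Writing e^{D_N} through e^{D_n}, the loss D_n - D_N ≥ dm log((n+1)/(N+1)) gives the power -(1-c)
dm; replacing e^{D_n} by a multiple of (n+1) p_n and dividing by N + 1 gives one more power. This is
the origin of the exponent 1 - (1-c) dm. -/
theorem envelope_div_le {dm dp : ℝ} (hdm : 0 < dm) (hdd : dm ≤ dp) :
    ∃ C : ℝ, 0 < C ∧ ∀ (d : ℕ → ℝ) (n N : ℕ) (c c0 y β : ℝ), N ≤ n → c ≤ 1 →
      (∀ i ∈ Icc 1 n, dm ≤ d i ∧ d i ≤ dp) → 1 - (1 - c) * dm ≤ β →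
      envelope d n c c0 y N / (N + 1)
        ≤ C * (expCoeff d n * ((n + 1 : ℝ) / (N + 1)) ^ β * Real.exp (-(c0 * y))) := by
  obtain ⟨C, hC, hCb⟩ := exp_harmSum_le_expCoeff hdm hdd
  refine ⟨C, hC, fun d n N c c0 y β hN hc hd hβ => ?_⟩
  have hp : 0 ≤ expCoeff d n := expCoeff_nonneg (fun i hi => hdm.le.trans (hd i hi).1) n le_rfl
  have hR1 : 1 ≤ (n + 1 : ℝ) / (N + 1) := by
    rw [one_le_div (by positivity)]
    have : (N : ℝ) ≤ n := by exact_mod_cast hN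
    linarith
  set R : ℝ := (n + 1 : ℝ) / (N + 1) with hR
  have hR0 : 0 < R := by linarith
  have h1 := log_le_harmSum_sub hdm.le hN fun i hi => (hd i hi).1
  have h2 : envelope d n c c0 y N
      ≤ Real.exp (harmSum d n) * R ^ (-((1 - c) * dm)) * Real.exp (-(c0 * y)) := by
    rw [envelope, Real.rpow_def_of_pos hR0, ← Real.exp_add, ← Real.exp_add]
    refine Real.exp_le_exp.2 ?_
    have := mul_le_mul_of_nonneg_left h1 (by linarith : 0 ≤ 1 - c)
    linarith
  have h3 : R ^ (1 - (1 - c) * dm) = R * R ^ (-((1 - c) * dm)) := by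
    rw [sub_eq_add_neg, Real.rpow_add hR0, Real.rpow_one]
  calc envelope d n c c0 y N / (N + 1)
      ≤ (Real.exp (harmSum d n) * R ^ (-((1 - c) * dm)) * Real.exp (-(c0 * y))) / (N + 1) := by
        gcongr
    _ ≤ (C * ((n + 1 : ℝ) * expCoeff d n) * R ^ (-((1 - c) * dm)) * Real.exp (-(c0 * y)))
        / (N + 1) := by
        gcongr
        exact hCb d n hd
    _ = C * (expCoeff d n * R ^ (1 - (1 - c) * dm) * Real.exp (-(c0 * y))) := by
        rw [h3, hR]
        field_simp
    _ ≤ _ := by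
        have := Real.rpow_le_rpow_of_exponent_le hR1 hβ
        gcongr

theorem div_add_le_rpow_mul_rpow {n k j : ℕ} {θ : ℝ} (hn : 1 ≤ n) (hj : 1 ≤ j)
    (h0 : 0 ≤ θ) (h1 : θ ≤ 1) :
    (j : ℝ) / ((k + j : ℕ) : ℝ) ≤ ((j : ℝ) / n) ^ θ * ((n + 1 : ℝ) / (k + 1)) ^ θ := by
  have hn0 : (0 : ℝ) < n := by exact_mod_cast hn
  have hj0 : (0 : ℝ) < j := by exact_mod_cast hj
  have hN0 : (0 : ℝ) < ((k + j : ℕ) : ℝ) := by exact_mod_cast (by omega : 0 < k + j)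
  have hle1 : (j : ℝ) / ((k + j : ℕ) : ℝ) ≤ 1 := by
    rw [div_le_one hN0]
    exact_mod_cast Nat.le_add_left j k
  have h2 : (j : ℝ) / ((k + j : ℕ) : ℝ) ≤ ((j : ℝ) / ((k + j : ℕ) : ℝ)) ^ θ := by
    conv_lhs => rw [← Real.rpow_one ((j : ℝ) / ((k + j : ℕ) : ℝ))]
    exact Real.rpow_le_rpow_of_exponent_ge (by positivity) hle1 h1
  refine h2.trans ?_
  rw [← Real.mul_rpow (by positivity) (by positivity)]
  refine Real.rpow_le_rpow (by positivity) ?_ h0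
  rw [div_mul_div_comm, div_le_div_iff₀ hN0 (by positivity)]
  have hj1 : (1 : ℝ) ≤ j := by exact_mod_cast hj
  have hk0 : (0 : ℝ) ≤ k := k.cast_nonneg
  push_cast
  have h5 : (n : ℝ) * (k + 1) ≤ (n + 1) * (k + j) := by nlinarith
  calc (j : ℝ) * (n * (k + 1)) ≤ j * ((n + 1) * (k + j)) := mul_le_mul_of_nonneg_left h5 hj0.le
    _ = _ := by ring

-- Summed bounds become pointwise through the recursions: k |M_k| ≤ dp ∑_{i<k} |M_i|, and likewise
-- for increments with the additional term j |M_{k-j}|. The envelope is then converted into p_n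
-- times a power of (n+1)/(k+1). The condition on β is 1 - (1-c) dm ≤ β for the larger of the two
-- envelope parameters, c = 2 c0 + c0 th / dm.
set_option maxHeartbeats 1000000 in
theorem exists_coefficient_bounds {dm dp th Cy c0 β : ℝ} (hdm : 0 < dm) (hdd : dm ≤ dp)
    (hc0 : 0 ≤ c0) (hth : 0 ≤ th) (hθ : c0 * th ≤ 1) (hc : 2 * c0 + c0 * th / dm ≤ 1 / 2)
    (hβ0 : 0 ≤ β) (hβ : 1 - dm + 2 * c0 * dm + c0 * th ≤ β) :
    ∃ C : ℝ, 0 < C ∧ ∀ (d : ℕ → ℝ) (f : ℕ → ℂ) (n : ℕ) (y : ℝ), 1 ≤ n →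
      Decay dm dp d f n y th Cy →
      (∀ k, k ≤ n → ‖expCoeff (fun i => d i * f i) k‖
        ≤ C * (expCoeff d n * ((n + 1 : ℝ) / (k + 1)) ^ β * Real.exp (-(c0 * y)))) ∧
      (∀ k j, k + j ≤ n →
        ‖expCoeff (fun i => d i * f i) (k + j) - expCoeff (fun i => d i * f i) k‖
        ≤ C * (expCoeff d n * ((j : ℝ) / n) ^ (c0 * th) * ((n + 1 : ℝ) / (k + 1)) ^ β
          * Real.exp (-(c0 * y)))) := by
  obtain ⟨C, hC, hCb⟩ := envelope_div_le hdm hdd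
  have hdp : 0 ≤ dp := hdm.le.trans hdd
  have hγ : Real.exp (-(dm / 4)) < 1 := by
    rw [Real.exp_lt_one_iff]
    linarith
  have hγ0 := Real.exp_pos (-(dm / 4))
  have hcθ : 0 ≤ c0 * th / dm := div_nonneg (mul_nonneg hc0 hth) hdm.le
  have hθ0 : 0 ≤ c0 * th := mul_nonneg hc0 hth
  set K1 := (2 * dp + 1) / (1 - Real.exp (-(dm / 4))) with hK1
  have hK10 : 1 ≤ K1 := by
    rw [hK1, le_div_iff₀ (by linarith)]
    linarith
  set K2 := (4 * dp + 1 + 4 * K1) / (1 - Real.exp (-(dm / 4))) with hK2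
  have hK20 : 0 ≤ K2 := div_nonneg (by linarith) (by linarith)
  set e := Real.exp (c0 * Cy) with he
  have he0 : 0 < e := Real.exp_pos _
  -- pointwise bounds in terms of the envelope
  have hM : ∀ (d : ℕ → ℝ) (f : ℕ → ℂ) (n : ℕ) (y : ℝ), 1 ≤ n → Decay dm dp d f n y th Cy →
      ∀ k, k ≤ n → ‖expCoeff (fun i => d i * f i) k‖
        ≤ 2 * (dp + 1) * K1 * e * (envelope d n (2 * c0) c0 y k / (k + 1)) := by
    intro d f n y hn h k hk
    have hW := envelope_pos d n (2 * c0) c0 y k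
    cases k with
    | zero =>
      have h1 := h.one_le_envelope hdm hc0 le_rfl
      simp only [expCoeff_zero, norm_one, Nat.cast_zero, zero_add, div_one]
      have h2 : 1 ≤ 2 * (dp + 1) * K1 := by nlinarith
      calc (1 : ℝ) ≤ (2 * (dp + 1) * K1) * (e * envelope d n (2 * c0) c0 y 0) :=
            one_le_mul_of_one_le_of_one_le h2 h1
        _ = _ := by ring
    | succ k =>
      have hS := h.sum_norm_expCoeff_le hdm hdp hc0 (by linarith) hth (k + 1) hk
      set x : ℕ → ℂ := fun i => d i * f i with hx
      have h1 : ((k : ℝ) + 1) * ‖expCoeff x (k + 1)‖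
          ≤ dp * ∑ i ∈ range (k + 1 + 1), ‖expCoeff x i‖ := by
        have h2 := congrArg norm (expCoeff_rec x (k + 1))
        rw [norm_mul, Complex.norm_natCast] at h2
        push_cast at h2
        rw [h2, Finset.sum_range_succ, mul_add]
        refine (norm_sum_le _ _).trans ((?_ : _ ≤ dp * ∑ i ∈ range (k + 1), ‖expCoeff x i‖).trans
          (le_add_of_nonneg_right (by positivity)))
        rw [← sum_Icc_reflect, Finset.mul_sum]
        refine Finset.sum_le_sum fun i hi => ?_
        rw [norm_mul]
        have hi' := Finset.Icc_subset_Icc_right hk hi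
        exact mul_le_mul_of_nonneg_right (norm_mul_le_of_mem
          ⟨hdm.le.trans (h.bounds i hi').1, (h.bounds i hi').2⟩ (h.norm_le i hi')) (norm_nonneg _)
      have hk0 : (0 : ℝ) < k + 1 := by positivity
      have h3 : ‖expCoeff x (k + 1)‖ ≤ dp * (K1 * (e * envelope d n (2 * c0) c0 y (k + 1)))
          / (k + 1) := by
        rw [le_div_iff₀ hk0, mul_comm]
        exact h1.trans (mul_le_mul_of_nonneg_left hS hdp)
      refine h3.trans ?_
      push_cast
      rw [← mul_div_assoc, div_le_div_iff₀ hk0 (by positivity)]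
      have hX : 0 ≤ K1 * (e * envelope d n (2 * c0) c0 y (k + 1)) := by positivity
      nlinarith [mul_nonneg hX hk0.le, mul_nonneg (mul_nonneg hX hk0.le) hdp, mul_nonneg (mul_nonneg hX (k.cast_nonneg : (0 : ℝ) ≤ k)) hdp]
  refine ⟨C * (2 * (dp + 1) * K1 * e + 2 * dp * K2 * e), by positivity, ?_⟩
  intro d f n y hn h
  have hd0 : ∀ i ∈ Icc 1 n, 0 ≤ d i := fun i hi => hdm.le.trans (h.bounds i hi).1
  have hd : ∀ i ∈ Icc 1 n, dm ≤ d i := fun i hi => (h.bounds i hi).1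
  have hp : 0 ≤ expCoeff d n := expCoeff_nonneg hd0 n le_rfl
  have hn0 : (0 : ℝ) < n := by exact_mod_cast hn
  refine ⟨fun k hk => ?_, fun k j hkj => ?_⟩
  · have h1 := hM d f n y hn h k hk
    have h2 := hCb d n k (2 * c0) c0 y β hk (by linarith) h.bounds (by linarith)
    set Z := expCoeff d n * ((n + 1 : ℝ) / (k + 1)) ^ β * Real.exp (-(c0 * y)) with hZ
    have hZ0 : 0 ≤ Z := by positivity
    calc _ ≤ 2 * (dp + 1) * K1 * e * (C * Z) :=
          h1.trans (mul_le_mul_of_nonneg_left h2 (by positivity))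
      _ ≤ 2 * (dp + 1) * K1 * e * (C * Z) + 2 * dp * K2 * e * (C * Z) :=
          le_add_of_nonneg_right (by positivity)
      _ = _ := by ring
  · rcases Nat.eq_zero_or_pos j with rfl | hj
    · simp only [add_zero, sub_self, norm_zero]
      positivity
    have hj0 : (0 : ℝ) < j := by exact_mod_cast hj
    have hN0 : (0 : ℝ) < ((k + j : ℕ) : ℝ) := by exact_mod_cast (by omega : 0 < k + j)
    set x : ℕ → ℂ := fun i => d i * f i with hx
    set t := ((j : ℝ) / n) ^ (c0 * th) with ht
    have ht0 : 0 ≤ t := by positivity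
    set c1 := 2 * c0 + c0 * th / dm with hc1
    have hT := h.sum_norm_diffCoeff_le hdm hdp hc0 hth hθ hc hj (by omega) (k + j) hkj
    have hdiff : diffCoeff x j (k + j) = expCoeff x (k + j) - expCoeff x k := by
      rw [diffCoeff, if_pos (by omega), Nat.add_sub_cancel]
    have hrec : ((k + j : ℕ) : ℝ) * ‖diffCoeff x j (k + j)‖
        ≤ dp * ∑ i ∈ range (k + j + 1), ‖diffCoeff x j i‖ + j * ‖expCoeff x k‖ := by
      have h2 := congrArg norm (diffCoeff_rec x j (k + j))
      rw [norm_mul, Complex.norm_natCast, if_pos (by omega), Nat.add_sub_cancel] at h2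
      rw [h2]
      refine (norm_sub_le _ _).trans (add_le_add ?_ (by rw [norm_mul, Complex.norm_natCast]))
      rw [Finset.sum_range_succ, mul_add]
      refine (norm_sum_le _ _).trans ((?_ : _ ≤ dp * ∑ i ∈ range (k + j), ‖diffCoeff x j i‖).trans
        (le_add_of_nonneg_right (by positivity)))
      rw [← sum_Icc_reflect, Finset.mul_sum]
      refine Finset.sum_le_sum fun i hi => ?_
      rw [norm_mul]
      have hi' := Finset.Icc_subset_Icc_right hkj hi
      exact mul_le_mul_of_nonneg_right (norm_mul_le_of_mem
        ⟨hdm.le.trans (h.bounds i hi').1, (h.bounds i hi').2⟩ (h.norm_le i hi')) (norm_nonneg _)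
    have hc1' : 1 - (1 - c1) * dm ≤ β := by
      have : c0 * th / dm * dm = c0 * th := by field_simp
      rw [hc1]
      nlinarith
    have hbN := hCb d n (k + j) c1 c0 y β hkj (by linarith) h.bounds hc1'
    have hbk := hCb d n k c1 c0 y β (by omega) (by linarith) h.bounds hc1'
    set Z := expCoeff d n * ((n + 1 : ℝ) / (k + 1)) ^ β * Real.exp (-(c0 * y)) with hZ
    have hZ0 : 0 ≤ Z := by positivity
    have hZN : expCoeff d n * ((n + 1 : ℝ) / ((k + j : ℕ) + 1)) ^ β * Real.exp (-(c0 * y)) ≤ Z := by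
      rw [hZ]
      have : (n + 1 : ℝ) / ((k + j : ℕ) + 1) ≤ (n + 1 : ℝ) / (k + 1) := by
        refine div_le_div_of_nonneg_left (by positivity) (by positivity) ?_
        push_cast
        linarith
      gcongr
    -- the two contributions
    have hA : dp * (∑ i ∈ range (k + j + 1), ‖diffCoeff x j i‖) / ((k + j : ℕ) : ℝ)
        ≤ 2 * dp * K2 * e * (C * (t * Z)) := by
      have h3 : envelope d n c1 c0 y (k + j) / ((k + j : ℕ) : ℝ)
          ≤ 2 * (envelope d n c1 c0 y (k + j) / ((k + j : ℕ) + 1)) := by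
        have hW := envelope_pos d n c1 c0 y (k + j)
        rw [← mul_div_assoc, div_le_div_iff₀ hN0 (by positivity)]
        have : (1 : ℝ) ≤ ((k + j : ℕ) : ℝ) := by exact_mod_cast (by omega : 1 ≤ k + j)
        nlinarith
      calc dp * (∑ i ∈ range (k + j + 1), ‖diffCoeff x j i‖) / ((k + j : ℕ) : ℝ)
          ≤ dp * (K2 * (e * (t * envelope d n c1 c0 y (k + j)))) / ((k + j : ℕ) : ℝ) := by gcongr
        _ = dp * K2 * e * t * (envelope d n c1 c0 y (k + j) / ((k + j : ℕ) : ℝ)) := by ring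
        _ ≤ dp * K2 * e * t * (2 * (C * Z)) := by
            refine mul_le_mul_of_nonneg_left (h3.trans ?_) (by positivity)
            refine mul_le_mul_of_nonneg_left (hbN.trans ?_) (by norm_num)
            exact mul_le_mul_of_nonneg_left hZN hC.le
        _ = _ := by ring
    have hB : j * ‖expCoeff x k‖ / ((k + j : ℕ) : ℝ)
        ≤ 2 * (dp + 1) * K1 * e * (C * (t * Z)) := by
      have h1 := hM d f n y hn h k (by omega)
      have hW := envelope_pos d n (2 * c0) c0 y k
      have hratio := div_add_le_rpow_mul_rpow (k := k) hn hj hθ0 hθ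
      calc j * ‖expCoeff x k‖ / ((k + j : ℕ) : ℝ) = (j : ℝ) / ((k + j : ℕ) : ℝ) * ‖expCoeff x k‖ := by
            ring
        _ ≤ (t * ((n + 1 : ℝ) / (k + 1)) ^ (c0 * th)) *
            (2 * (dp + 1) * K1 * e * (envelope d n (2 * c0) c0 y k / (k + 1))) :=
            mul_le_mul hratio h1 (norm_nonneg _) (by positivity)
        _ = 2 * (dp + 1) * K1 * e * (t * ((envelope d n (2 * c0) c0 y k *
            ((n + 1 : ℝ) / (k + 1)) ^ (c0 * th)) / (k + 1))) := by ring
        _ ≤ 2 * (dp + 1) * K1 * e * (t * (C * Z)) := by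
            refine mul_le_mul_of_nonneg_left (mul_le_mul_of_nonneg_left
              (le_trans ?_ hbk) ht0) (by positivity)
            gcongr
            exact envelope_gain (by omega) hdm hθ0 hd
        _ = _ := by ring
    have hfin : ‖diffCoeff x j (k + j)‖
        ≤ dp * (∑ i ∈ range (k + j + 1), ‖diffCoeff x j i‖) / ((k + j : ℕ) : ℝ)
          + j * ‖expCoeff x k‖ / ((k + j : ℕ) : ℝ) := by
      rw [← add_div, le_div_iff₀ hN0, mul_comm]
      exact hrec
    rw [← hdiff]
    have hgoal : C * (2 * (dp + 1) * K1 * e + 2 * dp * K2 * e) *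
        (expCoeff d n * t * ((n + 1 : ℝ) / (k + 1)) ^ β * Real.exp (-(c0 * y)))
        = 2 * dp * K2 * e * (C * (t * Z)) + 2 * (dp + 1) * K1 * e * (C * (t * Z)) := by
      rw [hZ]
      ring
    rw [hgoal]
    linarith

end CoefficientBounds
end RandPerm

namespace RandPerm

/-! ### Decay of the generating function on the unit circle. -/

section DecayBound

open Finset

/-- Since 1 - cos x = 2 sin²(x/2), this is the squared form of |sin(v/2)| ≤ |sin((u+v)/2)| +
|sin(u/2)|. It allows either angle to be treated as the perturbation. -/
theorem one_sub_cos_add_ge (u v : ℝ) :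
    (1 - Real.cos v) / 2 - (1 - Real.cos u) ≤ 1 - Real.cos (u + v) := by
  have key : Real.sin (v / 2) ^ 2 ≤ 2 * Real.sin ((u + v) / 2) ^ 2 + 2 * Real.sin (u / 2) ^ 2 := by
    have h : Real.sin (v / 2) = Real.sin ((u + v) / 2) * Real.cos (u / 2)
        - Real.cos ((u + v) / 2) * Real.sin (u / 2) := by
      rw [← Real.sin_sub]
      congr 1
      ring
    have h1 := Real.cos_sq_le_one (u / 2)
    have h2 := Real.cos_sq_le_one ((u + v) / 2)
    rw [h]
    set S := Real.sin ((u + v) / 2)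
    set a := Real.cos (u / 2)
    set b := Real.cos ((u + v) / 2)
    set c := Real.sin (u / 2)
    nlinarith [sq_nonneg (S * a + b * c), mul_nonneg (sq_nonneg S) (sub_nonneg.2 h1),
      mul_nonneg (sq_nonneg c) (sub_nonneg.2 h2)]
  have hhalf : ∀ x : ℝ, 1 - Real.cos x = 2 * Real.sin (x / 2) ^ 2 := fun x => by
    rw [Real.sin_sq_eq_half_sub, mul_div_cancel₀ x two_ne_zero]
    ring
  rw [hhalf, hhalf, hhalf]
  linarith

theorem one_sub_cos_ge (u : ℝ) : u ^ 2 / 4 - |u| ^ 3 ≤ 1 - Real.cos u := by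
  rcases le_or_gt |u| 1 with h | h
  · have h1 := Real.cos_bound h
    rw [abs_le] at h1
    have h2 : |u| ^ 4 ≤ |u| ^ 2 := pow_le_pow_of_le_one (abs_nonneg u) h (by norm_num)
    have h3 : |u| ^ 2 = u ^ 2 := sq_abs u
    have h4 : 0 ≤ |u| ^ 3 := by positivity
    nlinarith [h1.2, sq_nonneg u]
  · have h1 := Real.cos_le_one u
    have h2 : u ^ 2 = |u| ^ 2 := (sq_abs u).symm
    have h3 : |u| ^ 2 ≤ |u| ^ 3 := pow_le_pow_right₀ h.le (by norm_num)
    nlinarith [sq_nonneg |u|]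

theorem one_sub_cos_le_sq (u : ℝ) : 1 - Real.cos u ≤ u ^ 2 / 2 := by
  linarith [Real.one_sub_sq_div_two_le_cos (x := u)]

theorem one_sub_cos_le_cube {ε : ℝ} (hε : 0 < ε) (u : ℝ) :
    1 - Real.cos u ≤ ε ^ 2 / 2 + 2 / ε ^ 3 * |u| ^ 3 := by
  rcases le_or_gt |u| ε with h | h
  · have h1 := one_sub_cos_le_sq u
    have h2 : u ^ 2 ≤ ε ^ 2 := by
      rw [← sq_abs u]
      exact pow_le_pow_left₀ (abs_nonneg u) h 2
    have : 0 ≤ 2 / ε ^ 3 * |u| ^ 3 := by positivity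
    linarith
  · have h1 := Real.neg_one_le_cos u
    have h2 : ε ^ 3 ≤ |u| ^ 3 := pow_le_pow_left₀ hε.le h.le 3
    have h3 : 2 ≤ 2 / ε ^ 3 * |u| ^ 3 := by
      rw [div_mul_eq_mul_div, le_div_iff₀ (by positivity)]
      linarith
    have : 0 ≤ ε ^ 2 / 2 := by positivity
    linarith

theorem sq_le_add_cube {ε : ℝ} (hε : 0 < ε) (u : ℝ) : u ^ 2 ≤ ε ^ 2 + 1 / ε * |u| ^ 3 := by
  rw [← sq_abs u]
  rcases le_or_gt |u| ε with h | h
  · have h2 : |u| ^ 2 ≤ ε ^ 2 := pow_le_pow_left₀ (abs_nonneg u) h 2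
    have : 0 ≤ 1 / ε * |u| ^ 3 := by positivity
    linarith
  · have h3 : |u| ^ 2 ≤ 1 / ε * |u| ^ 3 := by
      rw [div_mul_eq_mul_div, one_mul, le_div_iff₀ hε, pow_succ |u| 2]
      exact mul_le_mul_of_nonneg_left h.le (by positivity)
    have : 0 ≤ ε ^ 2 := by positivity
    linarith

-- For z = r e^{iφ} the weighted sum ∑ r^i (1 - cos iφ)/i equals log|1 - z| - log(1 - r). With r =
-- e^{-1/n} one has 1 - r ≤ 1/n and |1 - z| ≥ (1/n + |φ|)/4, so this is at least log(1 + n|φ|) - log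
-- 4. The terms beyond n contribute at most 4, and log 4 ≤ 2; hence the constant 6.
set_option maxHeartbeats 1000000 in
theorem log_le_sum_one_sub_cos (n : ℕ) {φ : ℝ} (hφ : |φ| ≤ Real.pi) :
    Real.log (1 + n * |φ|) - 6 ≤ ∑ i ∈ Icc 1 n, (1 - Real.cos (i * φ)) / i := by
  rcases Nat.eq_zero_or_pos n with rfl | hn
  · simp
  have hn0 : (0 : ℝ) < n := by exact_mod_cast hn
  have hn1 : (1 : ℝ) ≤ n := by exact_mod_cast hn
  set r : ℝ := Real.exp (-(1 / n)) with hr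
  have hr0 : 0 < r := Real.exp_pos _
  have hinv : (1 : ℝ) / n ≤ 1 := by rw [div_le_one hn0]; exact hn1
  have hinv0 : (0 : ℝ) < 1 / n := by positivity
  have h1r : 1 - r ≤ 1 / n := by
    have := Real.add_one_le_exp (-(1 / (n : ℝ)))
    linarith
  have h1r' : 1 / (2 * n : ℝ) ≤ 1 - r := by
    have h := Real.add_one_le_exp (1 / (n : ℝ))
    have h2 : r * Real.exp (1 / n) = 1 := by rw [hr, ← Real.exp_add]; simp
    have h3 : r * (1 / n + 1) ≤ 1 := by
      exact (mul_le_mul_of_nonneg_left h hr0.le).trans h2.le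
    have h4 : 1 / (2 * n : ℝ) = 1 / n / 2 := by field_simp
    rw [h4]
    nlinarith
  have hr3 : 1 / 3 ≤ r := by
    have h1 : Real.exp (-1) ≤ r := Real.exp_le_exp.2 (by linarith)
    have h2 : Real.exp 1 < 3 := lt_trans Real.exp_one_lt_d9 (by norm_num)
    rw [Real.exp_neg] at h1
    have h3 : (3 : ℝ)⁻¹ ≤ (Real.exp 1)⁻¹ := inv_anti₀ (Real.exp_pos 1) h2.le
    linarith
  have hr1 : r < 1 := by
    have : 0 < 1 / (2 * n : ℝ) := by positivity
    linarith
  set z : ℂ := r * Complex.exp (φ * Complex.I) with hz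
  have hznorm : ‖z‖ = r := by
    rw [hz, norm_mul, Complex.norm_exp_ofReal_mul_I, mul_one, Complex.norm_real,
      Real.norm_of_nonneg hr0.le]
  have hs1 := Complex.hasSum_taylorSeries_neg_log (z := z) (by rw [hznorm]; exact hr1)
  have hs2 := Complex.hasSum_taylorSeries_neg_log (z := (r : ℂ))
    (by rw [Complex.norm_real, Real.norm_of_nonneg hr0.le]; exact hr1)
  have hs := Complex.hasSum_re (hs2.sub hs1)
  have hterm : ∀ i : ℕ, ((r : ℂ) ^ i / i - z ^ i / i).re = r ^ i * (1 - Real.cos (i * φ)) / i := by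
    intro i
    have h1 : z ^ i = ((r ^ i : ℝ) : ℂ) * Complex.exp (((i * φ : ℝ) : ℂ) * Complex.I) := by
      rw [hz, mul_pow, ← Complex.exp_nat_mul]
      push_cast
      congr 2
      ring
    have h2 : ((r : ℂ) ^ i / i - z ^ i / i)
        = ((r ^ i / i : ℝ) : ℂ) * (1 - Complex.exp (((i * φ : ℝ) : ℂ) * Complex.I)) := by
      rw [h1]
      push_cast
      ring
    rw [h2, Complex.re_ofReal_mul, Complex.sub_re, Complex.one_re, Complex.exp_ofReal_mul_I_re]
    ring
  have hval : (-Complex.log (1 - (r : ℂ)) - -Complex.log (1 - z)).re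
      = Real.log ‖1 - z‖ - Real.log (1 - r) := by
    rw [Complex.sub_re, Complex.neg_re, Complex.neg_re, Complex.log_re, Complex.log_re]
    have : ‖(1 : ℂ) - r‖ = 1 - r := by
      rw [← Complex.ofReal_one, ← Complex.ofReal_sub, Complex.norm_real,
        Real.norm_of_nonneg (by linarith)]
    rw [this]
    ring
  rw [hval] at hs
  simp only [hterm] at hs
  have hbound : ∀ i : ℕ, 0 ≤ 1 - Real.cos (i * φ) ∧ 1 - Real.cos (i * φ) ≤ 2 := fun i =>
    ⟨by linarith [Real.cos_le_one (i * φ)], by linarith [Real.neg_one_le_cos (i * φ)]⟩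
  have htail : ∑' i, r ^ (i + (n + 1)) * (1 - Real.cos ((i + (n + 1) : ℕ) * φ)) / (i + (n + 1) : ℕ)
      ≤ 4 := by
    have hgeo := (summable_geometric_of_lt_one hr0.le hr1).mul_left (2 / (n : ℝ))
    have hle : ∀ i : ℕ, r ^ (i + (n + 1)) * (1 - Real.cos ((i + (n + 1) : ℕ) * φ))
        / (i + (n + 1) : ℕ) ≤ 2 / n * r ^ i := by
      intro i
      have h1 : r ^ (i + (n + 1)) ≤ r ^ i := pow_le_pow_of_le_one hr0.le hr1.le (by omega)
      have h2 : (n : ℝ) ≤ ((i + (n + 1) : ℕ) : ℝ) := by exact_mod_cast (by omega : n ≤ i + (n + 1))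
      calc _ ≤ r ^ i * 2 / n := by
            refine div_le_div₀ (by positivity) ?_ hn0 h2
            exact mul_le_mul h1 (hbound _).2 (hbound _).1 (by positivity)
        _ = _ := by ring
    refine (Summable.tsum_le_tsum hle ((summable_nat_add_iff (n + 1)).2 hs.summable) hgeo).trans ?_
    rw [tsum_mul_left, tsum_geometric_of_lt_one hr0.le hr1, ← div_eq_mul_inv,
      div_le_iff₀ (by linarith)]
    have h4 : 2 / (n : ℝ) = 4 * (1 / (2 * n)) := by field_simp; norm_num
    rw [h4]
    exact mul_le_mul_of_nonneg_left h1r' (by norm_num)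
  have hhead : ∑ i ∈ range (n + 1), r ^ i * (1 - Real.cos (i * φ)) / i
      ≤ ∑ i ∈ Icc 1 n, (1 - Real.cos (i * φ)) / i := by
    rw [Finset.sum_range_succ', sum_Icc_one_eq_sum_range]
    simp only [Nat.cast_zero, div_zero, add_zero]
    refine Finset.sum_le_sum fun i _ => ?_
    refine div_le_div_of_nonneg_right ?_ (Nat.cast_nonneg _)
    exact mul_le_of_le_one_left (hbound _).1 (pow_le_one₀ hr0.le hr1.le)
  have htot := hs.summable.sum_add_tsum_nat_add (n + 1)
  rw [hs.tsum_eq] at htot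
  have hnorm : (1 / n + |φ|) / 4 ≤ ‖1 - z‖ := by
    have hsq : ‖1 - z‖ ^ 2 = (1 - r) ^ 2 + 2 * r * (1 - Real.cos φ) := by
      rw [← Complex.normSq_eq_norm_sq, Complex.normSq_apply, hz]
      simp only [Complex.sub_re, Complex.one_re, Complex.re_ofReal_mul, Complex.sub_im,
        Complex.one_im, Complex.im_ofReal_mul, Complex.exp_ofReal_mul_I_re,
        Complex.exp_ofReal_mul_I_im]
      nlinarith [Real.sin_sq_add_cos_sq φ]
    have hcos := Real.cos_le_one_sub_mul_cos_sq hφ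
    have hpi : Real.pi ^ 2 < 10 := by
      nlinarith [Real.pi_lt_d2, Real.pi_pos]
    have hcos' : φ ^ 2 / 5 ≤ 1 - Real.cos φ := by
      have : φ ^ 2 / 5 ≤ 2 / Real.pi ^ 2 * φ ^ 2 := by
        rw [div_mul_eq_mul_div, div_le_div_iff₀ (by norm_num) (by positivity)]
        nlinarith [sq_nonneg φ]
      linarith
    refine abs_le_of_sq_le_sq' ?_ (norm_nonneg _) |>.2
    rw [hsq]
    have h1 : (1 / (2 * n : ℝ)) ^ 2 ≤ (1 - r) ^ 2 := pow_le_pow_left₀ (by positivity) h1r' 2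
    have h2 : φ ^ 2 / 8 ≤ 2 * r * (1 - Real.cos φ) := by nlinarith [sq_nonneg φ]
    have h3 : (1 / (2 * n : ℝ)) ^ 2 = (1 / n : ℝ) ^ 2 / 4 := by field_simp; norm_num
    have h4 : |φ| ^ 2 = φ ^ 2 := sq_abs φ
    nlinarith [sq_nonneg (1 / (n : ℝ) - |φ|), sq_nonneg (1 / (n : ℝ)), sq_nonneg φ]
  have hlog : Real.log (1 + n * |φ|) - 2 ≤ Real.log ‖1 - z‖ - Real.log (1 - r) := by
    have h1 : Real.log ((1 / n + |φ|) / 4) ≤ Real.log ‖1 - z‖ :=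
      Real.log_le_log (by positivity) hnorm
    have h2 : Real.log (1 - r) ≤ Real.log (1 / n) := Real.log_le_log (by linarith) h1r
    have h3 : Real.log ((1 / n + |φ|) / 4) - Real.log (1 / n)
        = Real.log (1 + n * |φ|) - Real.log 4 := by
      rw [← Real.log_div (by positivity) (by positivity),
        ← Real.log_div (by positivity) (by positivity)]
      congr 1
      field_simp
    have h4 : Real.log 4 ≤ 2 := by
      rw [show (4 : ℝ) = 2 ^ 2 by norm_num, Real.log_pow]
      have := Real.log_two_lt_d9
      push_cast
      linarith
    linarith
  linarith

/-- If (n+1) a > 1, then log(1 + na) grows by at least 1/(2(n+1)) in passing to n + 1, which pays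
for the new term. -/
theorem sum_inv_le_two_log (n : ℕ) {a : ℝ} (ha : 0 ≤ a) :
    ∑ i ∈ Icc 1 n with (1 : ℝ) < (i : ℕ) * a, (1 : ℝ) / (i : ℕ) ≤ 2 * Real.log (1 + n * a) := by
  induction n with
  | zero => simp
  | succ n ih =>
    have hmono : Real.log (1 + n * a) ≤ Real.log (1 + (n + 1 : ℕ) * a) := by
      refine Real.log_le_log (by positivity) ?_
      push_cast
      nlinarith
    rw [show Icc 1 (n + 1) = insert (n + 1) (Icc 1 n) by
      rw [Finset.insert_Icc_right_eq_Icc_add_one (by omega)], Finset.filter_insert]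
    split_ifs with h
    · rw [Finset.sum_insert (by simp)]
      have hn0 : (0 : ℝ) < ((n + 1 : ℕ) : ℝ) := by positivity
      have h1 : 1 / (((n + 1 : ℕ) : ℝ)) ≤ 2 * (Real.log (1 + (n + 1 : ℕ) * a) - Real.log (1 + n * a)) := by
        have h2 := Real.one_sub_inv_le_log_of_pos
          (show 0 < (1 + (n + 1 : ℕ) * a) / (1 + n * a) by positivity)
        rw [Real.log_div (by positivity) (by positivity), inv_div] at h2
        have h3 : 1 / (2 * ((n + 1 : ℕ) : ℝ)) ≤ 1 - (1 + n * a) / (1 + (n + 1 : ℕ) * a) := by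
          rw [one_sub_div (by positivity), div_le_div_iff₀ (by positivity) (by positivity)]
          push_cast at h ⊢
          nlinarith
        have h4 : 1 / (2 * ((n + 1 : ℕ) : ℝ)) = 1 / ((n + 1 : ℕ) : ℝ) / 2 := by
          field_simp
        linarith
      linarith
    · linarith

-- The indices are split at i|φ| = 1. Below it iφ is a perturbation of total cost O(1), and the u_i
-- supply a fixed fraction of their quadratic sum. Above it u_i is the perturbation: iφ supplies a
-- multiple of log(1 + n|φ|), and the quadratic sum of the u_i over these indices is itself
-- dominated by a small multiple of that logarithm plus cubic terms. The cubic terms are absorbed by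
-- the smallness hypothesis with η.
set_option maxHeartbeats 1000000 in
theorem le_sum_one_sub_cos {dm dp : ℝ} (hdm : 0 < dm) (hdd : dm ≤ dp) :
    ∃ η Cy : ℝ, 0 < η ∧ 0 < Cy ∧ ∀ (d u : ℕ → ℝ) (n : ℕ),
      (∀ i ∈ Icc 1 n, dm ≤ d i ∧ d i ≤ dp) →
      (∑ i ∈ Icc 1 n, |u i| ^ 3 / i ≤ η * ∑ i ∈ Icc 1 n, d i * (u i ^ 2 / i)) →
      ∀ φ : ℝ, |φ| ≤ Real.pi →
        (∑ i ∈ Icc 1 n, d i * (u i ^ 2 / i)) / 16 + dm / 4 * Real.log (1 + n * |φ|) - Cy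
          ≤ ∑ i ∈ Icc 1 n, d i / i * (1 - Real.cos (u i + i * φ)) := by
  have hdp : 0 < dp := hdm.trans_le hdd
  -- With dp ε² = dm/8 the large indices lose dm/8 of their dm/2 multiples of the logarithm, and
  -- their quadratic terms, entering with weight 1/8, take dm/32 more. The remaining 11 dm/32
  -- exceeds the claimed dm/4.
  set ε : ℝ := Real.sqrt (dm / (8 * dp)) with hε
  have hε0 : 0 < ε := Real.sqrt_pos.2 (by positivity)
  have hε2 : dp * ε ^ 2 = dm / 8 := by
    rw [hε, Real.sq_sqrt (by positivity)]
    field_simp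
  set C' : ℝ := dp * (1 / 2 + 2 / ε ^ 3 + 1 / (8 * ε)) with hC'
  have hC'0 : 0 < C' := by positivity
  refine ⟨1 / (16 * C'), dp / 2 + dm / 2 * (6 + 1 / 2), by positivity, by positivity, ?_⟩
  intro d u n hd hcub φ hφ
  set ℓ := Real.log (1 + n * |φ|) with hℓ
  have hℓ0 : 0 ≤ ℓ := Real.log_nonneg (by
    have : 0 ≤ (n : ℝ) * |φ| := by positivity
    linarith)
  set Q := ∑ i ∈ Icc 1 n, d i * (u i ^ 2 / i) with hQ
  set T := ∑ i ∈ Icc 1 n, |u i| ^ 3 / (i : ℝ) with hT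
  have hcub' : C' * T ≤ Q / 16 := by
    calc C' * T ≤ C' * (1 / (16 * C') * Q) := mul_le_mul_of_nonneg_left hcub hC'0.le
      _ = _ := by field_simp
  have hsplit : ∀ g : ℕ → ℝ, ∑ i ∈ Icc 1 n, g i
      = ∑ i ∈ Icc 1 n with (1 : ℝ) < (i : ℕ) * |φ|, g i
        + ∑ i ∈ Icc 1 n with ¬ (1 : ℝ) < (i : ℕ) * |φ|, g i := fun g =>
    (Finset.sum_filter_add_sum_filter_not _ _ _).symm
  set I2 := (Icc 1 n).filter fun i : ℕ => (1 : ℝ) < (i : ℕ) * |φ| with hI2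
  set I1 := (Icc 1 n).filter fun i : ℕ => ¬ (1 : ℝ) < (i : ℕ) * |φ| with hI1
  have hpos : ∀ i ∈ Icc 1 n, (0 : ℝ) < i := fun i hi => by
    rw [Finset.mem_Icc] at hi
    exact_mod_cast hi.1
  -- the quadratic terms with small index
  have hquad : ∑ i ∈ I1, (1 - Real.cos (i * φ)) / i ≤ 1 / 2 := by
    have h1 : ∀ i ∈ I1, (1 - Real.cos (i * φ)) / i ≤ |φ| / 2 := by
      intro i hi
      rw [hI1, Finset.mem_filter, not_lt] at hi
      have hi0 := hpos i hi.1
      rw [div_le_iff₀ hi0]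
      refine (one_sub_cos_le_sq _).trans ?_
      rw [← sq_abs, abs_mul, Nat.abs_cast]
      nlinarith [mul_nonneg hi0.le (abs_nonneg φ)]
    refine (Finset.sum_le_sum h1).trans ?_
    rw [Finset.sum_const, nsmul_eq_mul]
    rcases (abs_nonneg φ).eq_or_lt with h0 | h0
    · rw [← h0]
      norm_num
    · have hsub : I1 ⊆ Icc 1 ⌊1 / |φ|⌋₊ := by
        intro i hi
        rw [hI1, Finset.mem_filter, not_lt] at hi
        rw [Finset.mem_Icc]
        refine ⟨(Finset.mem_Icc.1 hi.1).1, Nat.le_floor ?_⟩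
        rw [le_div_iff₀ h0]
        exact hi.2
      have hcard : (#I1 : ℝ) ≤ 1 / |φ| := by
        have h2 := Finset.card_le_card hsub
        rw [Nat.card_Icc, Nat.add_sub_cancel] at h2
        exact (by exact_mod_cast h2 : (#I1 : ℝ) ≤ (⌊1 / |φ|⌋₊ : ℝ)).trans
          (Nat.floor_le (by positivity))
      calc (#I1 : ℝ) * (|φ| / 2) ≤ 1 / |φ| * (|φ| / 2) :=
            mul_le_mul_of_nonneg_right hcard (by positivity)
        _ = 1 / 2 := by field_simp
  have hG : ℓ - (6 + 1 / 2) ≤ ∑ i ∈ I2, (1 - Real.cos (i * φ)) / i := by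
    have h1 := log_le_sum_one_sub_cos n hφ
    rw [hsplit] at h1
    linarith
  have hΛ : ∑ i ∈ I2, (1 : ℝ) / i ≤ 2 * ℓ := sum_inv_le_two_log n (abs_nonneg φ)
  have hTsplit := hsplit fun i => |u i| ^ 3 / (i : ℝ)
  have hQsplit := hsplit fun i => d i * (u i ^ 2 / i)
  rw [← hT] at hTsplit
  rw [← hQ] at hQsplit
  set T1 := ∑ i ∈ I1, |u i| ^ 3 / (i : ℝ) with hT1
  set T2 := ∑ i ∈ I2, |u i| ^ 3 / (i : ℝ) with hT2
  set Q1 := ∑ i ∈ I1, d i * (u i ^ 2 / i) with hQ1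
  set Q2 := ∑ i ∈ I2, d i * (u i ^ 2 / i) with hQ2
  have hT10 : 0 ≤ T1 := Finset.sum_nonneg fun i _ => by positivity
  have hT20 : 0 ≤ T2 := Finset.sum_nonneg fun i _ => by positivity
  have hmem1 : ∀ i ∈ I1, i ∈ Icc 1 n := fun i hi => (Finset.mem_filter.1 hi).1
  have hmem2 : ∀ i ∈ I2, i ∈ Icc 1 n := fun i hi => (Finset.mem_filter.1 hi).1
  -- small indices
  have hA : Q1 / 8 - dp / 2 * T1 - dp / 2
      ≤ ∑ i ∈ I1, d i / i * (1 - Real.cos (u i + i * φ)) := by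
    have h1 : ∀ i ∈ I1, d i * (u i ^ 2 / i) / 8 - dp / 2 * (|u i| ^ 3 / i)
        - dp * ((1 - Real.cos (i * φ)) / i) ≤ d i / i * (1 - Real.cos (u i + i * φ)) := by
      intro i hi
      have hi0 := hpos i (hmem1 i hi)
      have hdi := hd i (hmem1 i hi)
      have h2 := one_sub_cos_add_ge (i * φ) (u i)
      rw [add_comm] at h2
      have h3 := one_sub_cos_ge (u i)
      have h4 : 0 ≤ d i / i := div_nonneg (hdm.le.trans hdi.1) hi0.le
      have h5 : d i / i ≤ dp / i := div_le_div_of_nonneg_right hdi.2 hi0.le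
      have h6 : 0 ≤ 1 - Real.cos (i * φ) := by linarith [Real.cos_le_one (i * φ)]
      have h7 : d i / i * ((u i ^ 2 / 4 - |u i| ^ 3) / 2 - (1 - Real.cos (i * φ)))
          ≤ d i / i * (1 - Real.cos (u i + i * φ)) :=
        mul_le_mul_of_nonneg_left (by linarith) h4
      refine le_trans ?_ h7
      have h8 := mul_le_mul_of_nonneg_right h5 h6
      have h9 := mul_le_mul_of_nonneg_right h5 (by positivity : 0 ≤ |u i| ^ 3)
      have e1 : d i * (u i ^ 2 / i) = d i / i * u i ^ 2 := by ring
      have e2 : dp / 2 * (|u i| ^ 3 / i) = dp / i * |u i| ^ 3 / 2 := by ring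
      have e3 : dp * ((1 - Real.cos (i * φ)) / i) = dp / i * (1 - Real.cos (i * φ)) := by ring
      rw [e1, e2, e3]
      nlinarith
    have h2 := Finset.sum_le_sum h1
    rw [Finset.sum_sub_distrib, Finset.sum_sub_distrib, ← Finset.sum_div, ← Finset.mul_sum,
      ← Finset.mul_sum] at h2
    have h3 := mul_le_mul_of_nonneg_left hquad hdp.le
    linarith
  -- large indices
  have hB : dm / 2 * (ℓ - (6 + 1 / 2)) - dm / 8 * ℓ - dp * (2 / ε ^ 3) * T2
      ≤ ∑ i ∈ I2, d i / i * (1 - Real.cos (u i + i * φ)) := by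
    have h1 : ∀ i ∈ I2, dm / 2 * ((1 - Real.cos (i * φ)) / i) - dp * (ε ^ 2 / 2) * (1 / i)
        - dp * (2 / ε ^ 3) * (|u i| ^ 3 / i) ≤ d i / i * (1 - Real.cos (u i + i * φ)) := by
      intro i hi
      have hi0 := hpos i (hmem2 i hi)
      have hdi := hd i (hmem2 i hi)
      have h2 := one_sub_cos_add_ge (u i) (i * φ)
      have h3 := one_sub_cos_le_cube hε0 (u i)
      have h4 : 0 ≤ d i / i := div_nonneg (hdm.le.trans hdi.1) hi0.le
      have h5 : d i / i ≤ dp / i := div_le_div_of_nonneg_right hdi.2 hi0.le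
      have h5' : dm / i ≤ d i / i := div_le_div_of_nonneg_right hdi.1 hi0.le
      have h6 : 0 ≤ 1 - Real.cos (i * φ) := by linarith [Real.cos_le_one (i * φ)]
      have h7 : d i / i * ((1 - Real.cos (i * φ)) / 2 - (ε ^ 2 / 2 + 2 / ε ^ 3 * |u i| ^ 3))
          ≤ d i / i * (1 - Real.cos (u i + i * φ)) :=
        mul_le_mul_of_nonneg_left (by linarith) h4
      refine le_trans ?_ h7
      have h8 := mul_le_mul_of_nonneg_right h5' h6
      have h9 := mul_le_mul_of_nonneg_right h5
        (by positivity : 0 ≤ ε ^ 2 / 2 + 2 / ε ^ 3 * |u i| ^ 3)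
      have e1 : dm / 2 * ((1 - Real.cos (i * φ)) / i) = dm / i * (1 - Real.cos (i * φ)) / 2 := by
        ring
      have e2 : dp * (ε ^ 2 / 2) * (1 / i) + dp * (2 / ε ^ 3) * (|u i| ^ 3 / i)
          = dp / i * (ε ^ 2 / 2 + 2 / ε ^ 3 * |u i| ^ 3) := by ring
      rw [e1]
      linarith
    have h2 := Finset.sum_le_sum h1
    rw [Finset.sum_sub_distrib, Finset.sum_sub_distrib, ← Finset.mul_sum, ← Finset.mul_sum,
      ← Finset.mul_sum] at h2
    have h3 := mul_le_mul_of_nonneg_left hG (by positivity : 0 ≤ dm / 2)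
    have h4 := mul_le_mul_of_nonneg_left hΛ (by positivity : 0 ≤ dp * (ε ^ 2 / 2))
    have h5 : dp * (ε ^ 2 / 2) * (2 * ℓ) = dm / 8 * ℓ := by
      rw [← hε2]
      ring
    linarith
  have hQ2b : Q2 ≤ dm / 4 * ℓ + dp * (1 / ε) * T2 := by
    have h1 : ∀ i ∈ I2, d i * (u i ^ 2 / i) ≤ dp * ε ^ 2 * (1 / i) + dp * (1 / ε) * (|u i| ^ 3 / i) := by
      intro i hi
      have hi0 := hpos i (hmem2 i hi)
      have hdi := hd i (hmem2 i hi)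
      have h3 := sq_le_add_cube hε0 (u i)
      have h5 : d i / i ≤ dp / i := div_le_div_of_nonneg_right hdi.2 hi0.le
      calc d i * (u i ^ 2 / i) = d i / i * u i ^ 2 := by ring
        _ ≤ dp / i * (ε ^ 2 + 1 / ε * |u i| ^ 3) := by
            exact mul_le_mul h5 h3 (sq_nonneg _) (by positivity)
        _ = _ := by ring
    have h2 := Finset.sum_le_sum h1
    rw [Finset.sum_add_distrib, ← Finset.mul_sum, ← Finset.mul_sum, hε2] at h2
    have h4 := mul_le_mul_of_nonneg_left hΛ (by positivity : 0 ≤ dm / 8)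
    linarith
  rw [hsplit]
  have hC'T : C' * T = dp / 2 * T1 + dp / 2 * T2 + dp * (2 / ε ^ 3) * T1 + dp * (2 / ε ^ 3) * T2
      + dp * (1 / ε) * T1 / 8 + dp * (1 / ε) * T2 / 8 := by
    rw [hTsplit, hC']
    field_simp
    ring
  have p1 : 0 ≤ dp / 2 * T2 := by positivity
  have p2 : 0 ≤ dp * (2 / ε ^ 3) * T1 := by positivity
  have p3 : 0 ≤ dp * (1 / ε) * T1 / 8 := by positivity
  have p4 := mul_nonneg hdm.le hℓ0
  linarith

/-- The interpolated multipliers `1 + s (e^{i u_j} - 1)`. -/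
noncomputable def interp (u : ℕ → ℝ) (s : ℝ) (i : ℕ) : ℂ :=
  1 + s * (Complex.exp (u i * Complex.I) - 1)

/-- The decay sum is affine in the multipliers, and those at s are a convex combination of 1 and
e^{i u_i}. The bound is therefore the combination of the case u and the case u = 0, which has the
same logarithmic gain and no Gaussian gain. -/
theorem exists_decay_interp {dm dp : ℝ} (hdm : 0 < dm) (hdd : dm ≤ dp) :
    ∃ η Cy : ℝ, 0 < η ∧ 0 < Cy ∧ ∀ (d u : ℕ → ℝ) (n : ℕ),
      (∀ i ∈ Icc 1 n, dm ≤ d i ∧ d i ≤ dp) →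
      (∑ i ∈ Icc 1 n, |u i| ^ 3 / i ≤ η * ∑ i ∈ Icc 1 n, d i * (u i ^ 2 / i)) →
      ∀ s : ℝ, 0 ≤ s → s ≤ 1 →
        Decay dm dp d (interp u s) n (s * ((∑ i ∈ Icc 1 n, d i * (u i ^ 2 / i)) / 16))
          (dm / 4) Cy := by
  obtain ⟨η, Cy, hη, hCy, h⟩ := le_sum_one_sub_cos hdm hdd
  refine ⟨η, Cy, hη, hCy, fun d u n hd hcub s hs0 hs1 => ⟨hd, fun i _ => ?_, fun φ hφ => ?_⟩⟩
  · have h1 : interp u s i = ((1 - s : ℝ) : ℂ) + (s : ℂ) * Complex.exp (u i * Complex.I) := by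
      rw [interp]
      push_cast
      ring
    rw [h1]
    refine (norm_add_le _ _).trans ?_
    rw [norm_mul, Complex.norm_exp_ofReal_mul_I, Complex.norm_real, Complex.norm_real,
      Real.norm_of_nonneg hs0, Real.norm_of_nonneg (by linarith)]
    linarith
  · have h1 := h d u n hd hcub φ hφ
    have h0 := h d (fun _ => 0) n hd (by simp) φ hφ
    simp only [zero_add, ne_eq, OfNat.ofNat_ne_zero, not_false_eq_true, zero_pow, zero_div,
      mul_zero, Finset.sum_const_zero] at h0
    have h2 : decaySum d (interp u s) n φ
        = (1 - s) * ∑ i ∈ Icc 1 n, d i / i * (1 - Real.cos (i * φ))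
          + s * ∑ i ∈ Icc 1 n, d i / i * (1 - Real.cos (u i + i * φ)) := by
      rw [decaySum, Finset.mul_sum, Finset.mul_sum, ← Finset.sum_add_distrib]
      refine Finset.sum_congr rfl fun i _ => ?_
      have h3 : interp u s i * Complex.exp (i * φ * Complex.I)
          = ((1 - s : ℝ) : ℂ) * Complex.exp (((i * φ : ℝ) : ℂ) * Complex.I)
            + (s : ℂ) * Complex.exp (((u i + i * φ : ℝ) : ℂ) * Complex.I) := by
        rw [interp]
        push_cast
        rw [add_mul (u i : ℂ), Complex.exp_add]
        ring
      rw [h3, Complex.add_re, Complex.re_ofReal_mul, Complex.re_ofReal_mul,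
        Complex.exp_ofReal_mul_I_re, Complex.exp_ofReal_mul_I_re]
      ring
    rw [h2]
    have h4 := mul_le_mul_of_nonneg_left h1 hs0
    have h5 := mul_le_mul_of_nonneg_left h0 (by linarith : 0 ≤ 1 - s)
    linarith

end DecayBound
end RandPerm

namespace RandPerm

/-! ### The differential system in s and its second order expansion. -/

section Interpolation

open Finset

theorem sum_Icc_Icc_swap {E : Type*} [AddCommMonoid E] (F : ℕ → ℕ → E) (k : ℕ) :
    ∑ i ∈ Icc 1 k, ∑ l ∈ Icc 1 (k - i), F i l = ∑ l ∈ Icc 1 k, ∑ i ∈ Icc 1 (k - l), F i l := by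
  refine Finset.sum_comm' fun i l => ?_
  simp only [Finset.mem_Icc]
  omega

/-- The s-derivative of the generating function is the function times ∑ β_i z^i / i. At the level of
coefficients the proof is an induction on the recursion. -/
theorem hasDerivAt_expCoeff (α β : ℕ → ℂ) (k : ℕ) (s : ℝ) :
    HasDerivAt (fun s : ℝ => expCoeff (fun i => α i + s * β i) k)
      (∑ i ∈ Icc 1 k, β i / i * expCoeff (fun i => α i + s * β i) (k - i)) s := by
  induction k using Nat.strong_induction_on with
  | _ k ih =>
    rcases Nat.eq_zero_or_pos k with rfl | hk
    · simp only [expCoeff_zero]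
      simpa using hasDerivAt_const s (1 : ℂ)
    have hk0 : (k : ℂ) ≠ 0 := by exact_mod_cast hk.ne'
    have hfun : (fun s : ℝ => expCoeff (fun i => α i + s * β i) k)
        = fun s : ℝ => (k : ℂ)⁻¹ * ∑ i ∈ Icc 1 k, (α i + s * β i)
            * expCoeff (fun i => α i + s * β i) (k - i) := by
      funext s
      rw [← expCoeff_rec, inv_mul_cancel_left₀ hk0]
    rw [hfun]
    have hterm : ∀ i ∈ Icc 1 k, HasDerivAt
        (fun s : ℝ => (α i + s * β i) * expCoeff (fun i => α i + s * β i) (k - i))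
        (β i * expCoeff (fun i => α i + s * β i) (k - i) + (α i + s * β i) *
          ∑ l ∈ Icc 1 (k - i), β l / l * expCoeff (fun i => α i + s * β i) (k - i - l)) s := by
      intro i hi
      rw [Finset.mem_Icc] at hi
      have h1 : HasDerivAt (fun s : ℝ => α i + s * β i) (β i) s := by
        have := ((hasDerivAt_id s).ofReal_comp.mul_const (β i)).const_add (α i)
        simpa using this
      exact h1.mul (ih (k - i) (by omega))
    refine ((HasDerivAt.fun_sum hterm).const_mul (k : ℂ)⁻¹).congr_deriv ?_
    set M := expCoeff (fun i => α i + s * β i) with hM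
    have hswap : ∑ i ∈ Icc 1 k, (α i + s * β i) * ∑ l ∈ Icc 1 (k - i), β l / l * M (k - i - l)
        = ∑ l ∈ Icc 1 k, β l / l * (((k - l : ℕ) : ℂ) * M (k - l)) := by
      simp only [Finset.mul_sum]
      rw [sum_Icc_Icc_swap]
      refine Finset.sum_congr rfl fun l _ => ?_
      rw [hM, expCoeff_rec, Finset.mul_sum]
      refine Finset.sum_congr rfl fun i _ => ?_
      rw [Nat.sub_right_comm]
      ring
    rw [Finset.sum_add_distrib, hswap, ← Finset.sum_add_distrib, Finset.mul_sum]
    refine Finset.sum_congr rfl fun i hi => ?_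
    rw [Finset.mem_Icc] at hi
    have hi0 : (i : ℂ) ≠ 0 := by exact_mod_cast (by omega : i ≠ 0)
    rw [Nat.cast_sub hi.2]
    field_simp
    ring

/-- Variation of constants: e^{-sΛ} g(s) has derivative e^{-sΛ} r(s). Because Re Λ ≤ -κ the
exponential rate of r survives unchanged, so the estimate may be iterated without loss of decay. -/
theorem norm_sub_exp_mul_le {g r : ℝ → ℂ} {Λ : ℂ} {κ K : ℝ}
    (hg : ∀ s, 0 ≤ s → s ≤ 1 → HasDerivAt g (Λ * g s + r s) s)
    (hr : ∀ s, 0 ≤ s → s ≤ 1 → ‖r s‖ ≤ K * Real.exp (-(κ * s))) (hΛ : Λ.re ≤ -κ) {s : ℝ}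
    (hs0 : 0 ≤ s) (hs1 : s ≤ 1) :
    ‖g s - Complex.exp (s * Λ) * g 0‖ ≤ K * Real.exp (-(κ * s)) := by
  have hK : 0 ≤ K := by
    have := (norm_nonneg _).trans (hr 0 le_rfl zero_le_one)
    simpa using this
  have hw : ∀ σ ∈ Set.Icc 0 s, HasDerivWithinAt (fun σ : ℝ => Complex.exp (-(σ * Λ)) * g σ)
      (Complex.exp (-(σ * Λ)) * r σ) (Set.Icc 0 s) σ := by
    intro σ hσ
    have h1 : HasDerivAt (fun σ : ℝ => Complex.exp (-(σ * Λ)))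
        (Complex.exp (-(σ * Λ)) * -Λ) σ := by
      have h2 : HasDerivAt (fun σ : ℝ => -((σ : ℂ) * Λ)) (-Λ) σ := by
        simpa using ((hasDerivAt_id σ).ofReal_comp.mul_const Λ).fun_neg
      exact h2.cexp
    refine ((h1.mul (hg σ hσ.1 (hσ.2.trans hs1))).congr_deriv ?_).hasDerivWithinAt
    ring
  have hb : ∀ σ ∈ Set.Ico 0 s, ‖Complex.exp (-(σ * Λ)) * r σ‖
      ≤ K * Real.exp (-(s * (Λ.re + κ))) := by
    intro σ hσ
    rw [norm_mul, Complex.norm_exp]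
    have h1 : (-((σ : ℂ) * Λ)).re = -(σ * Λ.re) := by
      rw [Complex.neg_re, Complex.re_ofReal_mul]
    rw [h1]
    calc Real.exp (-(σ * Λ.re)) * ‖r σ‖
        ≤ Real.exp (-(σ * Λ.re)) * (K * Real.exp (-(κ * σ))) :=
          mul_le_mul_of_nonneg_left (hr σ hσ.1 (hσ.2.le.trans hs1)) (Real.exp_pos _).le
      _ = K * Real.exp (-(σ * (Λ.re + κ))) := by
          rw [mul_left_comm, ← Real.exp_add]
          congr 2
          ring
      _ ≤ _ := by
          refine mul_le_mul_of_nonneg_left (Real.exp_le_exp.2 ?_) hK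
          nlinarith [hσ.1, hσ.2]
  have h := norm_image_sub_le_of_norm_deriv_le_segment' hw hb s ⟨hs0, le_rfl⟩
  simp only [Complex.ofReal_zero, zero_mul, neg_zero, Complex.exp_zero, one_mul, sub_zero] at h
  have h2 : g s - Complex.exp (s * Λ) * g 0
      = Complex.exp (s * Λ) * (Complex.exp (-(s * Λ)) * g s - g 0) := by
    rw [mul_sub, ← mul_assoc, ← Complex.exp_add, add_neg_cancel, Complex.exp_zero, one_mul]
  rw [h2, norm_mul, Complex.norm_exp, Complex.re_ofReal_mul]
  calc Real.exp (s * Λ.re) * ‖Complex.exp (-(s * Λ)) * g s - g 0‖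
      ≤ Real.exp (s * Λ.re) * (K * Real.exp (-(s * (Λ.re + κ))) * s) :=
        mul_le_mul_of_nonneg_left h (Real.exp_pos _).le
    _ = K * Real.exp (-(κ * s)) * s := by
        rw [← mul_assoc, mul_left_comm, ← Real.exp_add]
        congr 3
        ring
    _ ≤ _ := mul_le_of_le_one_right (mul_nonneg hK (Real.exp_pos _).le) hs1

/-- `((n + 1) / (k + 1)) ^ b`, the growth of the coefficients away from the last index. -/
noncomputable def growth (n : ℕ) (b : ℝ) (k : ℕ) : ℝ := ((n + 1 : ℝ) / (k + 1)) ^ b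

theorem one_le_div_succ {n k : ℕ} (hk : k ≤ n) : 1 ≤ (n + 1 : ℝ) / (k + 1) := by
  rw [one_le_div (by positivity)]
  have : (k : ℝ) ≤ n := by exact_mod_cast hk
  linarith

theorem growth_pos (n : ℕ) (b : ℝ) (k : ℕ) : 0 < growth n b k := by
  rw [growth]
  positivity

theorem one_le_growth {n k : ℕ} {b : ℝ} (hk : k ≤ n) (hb : 0 ≤ b) : 1 ≤ growth n b k :=
  Real.one_le_rpow (one_le_div_succ hk) hb

theorem growth_mono {n k : ℕ} {b b' : ℝ} (hk : k ≤ n) (hb : b ≤ b') :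
    growth n b k ≤ growth n b' k :=
  Real.rpow_le_rpow_of_exponent_le (one_le_div_succ hk) hb

theorem growth_self (n : ℕ) (b : ℝ) : growth n b n = 1 := by
  rw [growth, div_self (by positivity), Real.one_rpow]

theorem growth_mul_growth {n m k : ℕ} (b : ℝ) : growth n b m * growth m b k = growth n b k := by
  rw [growth, growth, growth, ← Real.mul_rpow (by positivity) (by positivity)]
  congr 1
  field_simp

/-- Covers shifts by i that run past index 0: there is then no increment to exploit, but k < i makes
the missing factor (i/n)^θ recoverable at the price of raising the exponent by θ. -/
theorem growth_le_rpow_mul {n k i : ℕ} {β θ : ℝ} (hn : 1 ≤ n) (hk : k + 1 ≤ i)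
    (hθ : 0 ≤ θ) : growth n β k ≤ ((i : ℝ) / n) ^ θ * growth n (β + θ) k := by
  have hn0 : (0 : ℝ) < n := by exact_mod_cast hn
  have h1 : growth n (β + θ) k = growth n β k * ((n + 1 : ℝ) / (k + 1)) ^ θ := by
    rw [growth, growth, Real.rpow_add (by positivity)]
  have h2 : 1 ≤ ((i : ℝ) / n) ^ θ * ((n + 1 : ℝ) / (k + 1)) ^ θ := by
    rw [← Real.mul_rpow (by positivity) (by positivity)]
    refine Real.one_le_rpow ?_ hθ
    rw [div_mul_div_comm, one_le_div (by positivity)]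
    have h3 : (k + 1 : ℝ) ≤ i := by exact_mod_cast hk
    have h4 : (0 : ℝ) ≤ i := i.cast_nonneg
    nlinarith
  rw [h1]
  have := (growth_pos n β k).le
  nlinarith

/-- Bounds for coefficients depending on a parameter `s ∈ [0, 1]`, for their increments and for
the weights of the differential system which they satisfy. -/
structure CoeffSystem (n : ℕ) (a : ℕ → ℂ) (M : ℕ → ℝ → ℂ) (p C κ θ β ρ : ℝ) : Prop where
  one_le : 1 ≤ n
  p_pos : 0 < p
  one_le_C : 1 ≤ C
  θ_nonneg : 0 ≤ θ
  β_nonneg : 0 ≤ β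
  at_zero : M n 0 = p
  deriv : ∀ k, k ≤ n → ∀ s, HasDerivAt (M k) (∑ i ∈ Icc 1 k, a i * M (k - i) s) s
  norm_le : ∀ k, k ≤ n → ∀ s, 0 ≤ s → s ≤ 1 →
    ‖M k s‖ ≤ C * p * growth n β k * Real.exp (-(κ * s))
  norm_sub_le : ∀ k j, k + j ≤ n → ∀ s, 0 ≤ s → s ≤ 1 →
    ‖M (k + j) s - M k s‖ ≤ C * p * ((j : ℝ) / n) ^ θ * growth n β k * Real.exp (-(κ * s))
  re_le : (∑ i ∈ Icc 1 n, a i).re ≤ -κ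
  sum_le : ∀ m, 1 ≤ m → m ≤ n →
    ∑ i ∈ Icc 1 m, ‖a i‖ * (((i : ℝ) / m) ^ (θ / 2) * growth m (β + θ) (m - i)) ≤ ρ

variable {n : ℕ} {a : ℕ → ℂ} {M : ℕ → ℝ → ℂ} {p C κ θ β ρ : ℝ}

/-- An increment by the shorter of two steps is shared equally between both indices, so that double
sums in i and j factor. -/
theorem min_rpow_le {n i j : ℕ} {θ : ℝ} (hθ : 0 ≤ θ) (h : i ≤ j) :
    ((i : ℝ) / n) ^ θ ≤ ((i : ℝ) / n) ^ (θ / 2) * ((j : ℝ) / n) ^ (θ / 2) := by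
  rcases (by positivity : 0 ≤ (i : ℝ) / n).eq_or_lt with h0 | h0
  · rcases hθ.eq_or_lt with h1 | h1
    · simp [← h1]
    · rw [← h0, Real.zero_rpow h1.ne', Real.zero_rpow (by linarith), zero_mul]
  · have h1 : ((i : ℝ) / n) ^ θ = ((i : ℝ) / n) ^ (θ / 2) * ((i : ℝ) / n) ^ (θ / 2) := by
      rw [← Real.rpow_add h0]
      congr 1
      ring
    rw [h1]
    refine mul_le_mul_of_nonneg_left (Real.rpow_le_rpow h0.le ?_ (by linarith)) (by positivity)
    exact div_le_div_of_nonneg_right (by exact_mod_cast h) n.cast_nonneg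

theorem CoeffSystem.norm_sub_last_le (h : CoeffSystem n a M p C κ θ β ρ) {i : ℕ} (hi : i ≤ n)
    {s : ℝ} (hs0 : 0 ≤ s) (hs1 : s ≤ 1) :
    ‖M (n - i) s - M n s‖
      ≤ C * p * ((i : ℝ) / n) ^ θ * growth n β (n - i) * Real.exp (-(κ * s)) := by
  have := h.norm_sub_le (n - i) i (by omega) s hs0 hs1
  rwa [Nat.sub_add_cancel hi, norm_sub_rev] at this

theorem CoeffSystem.sum_weight_le (h : CoeffSystem n a M p C κ θ β ρ) {e : ℕ → ℂ} {B : ℝ}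
    (hB : 0 ≤ B)
    (he : ∀ i ∈ Icc 1 n, ‖e i‖ ≤ B * (((i : ℝ) / n) ^ (θ / 2) * growth n (β + θ) (n - i))) :
    ‖∑ i ∈ Icc 1 n, a i * e i‖ ≤ B * ρ := by
  refine (norm_sum_le _ _).trans (le_trans ?_ (mul_le_mul_of_nonneg_left
    (h.sum_le n h.one_le le_rfl) hB))
  rw [Finset.mul_sum]
  refine Finset.sum_le_sum fun i hi => ?_
  rw [norm_mul]
  refine (mul_le_mul_of_nonneg_left (he i hi) (norm_nonneg _)).trans (le_of_eq ?_)
  ring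

theorem CoeffSystem.norm_sub_last_le' (h : CoeffSystem n a M p C κ θ β ρ) {i : ℕ}
    (hi : i ∈ Icc 1 n) {s : ℝ} (hs0 : 0 ≤ s) (hs1 : s ≤ 1) :
    ‖M (n - i) s - M n s‖ ≤ C * p * Real.exp (-(κ * s))
      * (((i : ℝ) / n) ^ (θ / 2) * growth n (β + θ) (n - i)) := by
  have hi' := Finset.mem_Icc.1 hi
  have hC : 0 ≤ C := zero_le_one.trans h.one_le_C
  have hn0 : (0 : ℝ) < n := by exact_mod_cast h.one_le
  have hi0 : (0 : ℝ) < i := by exact_mod_cast hi'.1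
  refine (h.norm_sub_last_le hi'.2 hs0 hs1).trans ?_
  have h1 : ((i : ℝ) / n) ^ θ ≤ ((i : ℝ) / n) ^ (θ / 2) := by
    refine Real.rpow_le_rpow_of_exponent_ge (by positivity) ?_ (by linarith [h.θ_nonneg])
    rw [div_le_one hn0]
    exact_mod_cast hi'.2
  have h2 : growth n β (n - i) ≤ growth n (β + θ) (n - i) :=
    growth_mono (Nat.sub_le _ _) (by linarith [h.θ_nonneg])
  have h3 := (growth_pos n β (n - i)).le
  have hp := h.p_pos.le
  calc C * p * ((i : ℝ) / n) ^ θ * growth n β (n - i) * Real.exp (-(κ * s))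
      = C * p * Real.exp (-(κ * s)) * (((i : ℝ) / n) ^ θ * growth n β (n - i)) := by ring
    _ ≤ _ := by gcongr

/-- The first order term `∑ a_j (p_{n-j} / p_n - 1)`. -/
noncomputable def linTerm (n : ℕ) (a : ℕ → ℂ) (M : ℕ → ℝ → ℂ) (p : ℝ) : ℂ :=
  ∑ j ∈ Icc 1 n, a j * (M (n - j) 0 / p - 1)

theorem CoeffSystem.norm_linTerm_le (h : CoeffSystem n a M p C κ θ β ρ) :
    ‖linTerm n a M p‖ ≤ C * ρ := by
  refine h.sum_weight_le (zero_le_one.trans h.one_le_C) fun i hi => ?_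
  have h1 := h.norm_sub_last_le' hi le_rfl zero_le_one
  rw [h.at_zero, mul_zero, neg_zero, Real.exp_zero, mul_one] at h1
  have hp0 : (p : ℂ) ≠ 0 := by exact_mod_cast h.p_pos.ne'
  have h2 : M (n - i) 0 / p - 1 = (M (n - i) 0 - p) / p := by field_simp
  rw [h2, norm_div, Complex.norm_real, Real.norm_of_nonneg h.p_pos.le, div_le_iff₀ h.p_pos]
  linarith

/-- First order approximation: M_n solves an equation with rate Λ, forced by the increments weighted
by the a_i. -/
theorem CoeffSystem.norm_sub_main_le (h : CoeffSystem n a M p C κ θ β ρ) {s : ℝ} (hs0 : 0 ≤ s)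
    (hs1 : s ≤ 1) :
    ‖M n s - Complex.exp (s * ∑ i ∈ Icc 1 n, a i) * p‖ ≤ C * p * ρ * Real.exp (-(κ * s)) := by
  have hC : 0 ≤ C := zero_le_one.trans h.one_le_C
  have hp := h.p_pos.le
  have := norm_sub_exp_mul_le (g := M n) (κ := κ) (K := C * p * ρ)
    (r := fun s => ∑ i ∈ Icc 1 n, a i * (M (n - i) s - M n s))
    (Λ := ∑ i ∈ Icc 1 n, a i) (fun s _ _ => ?_) (fun s h0 h1 => ?_) h.re_le hs0 hs1
  · rwa [h.at_zero] at this
  · refine (h.deriv n le_rfl s).congr_deriv ?_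
    simp only [mul_sub, Finset.sum_sub_distrib, Finset.sum_mul]
    ring
  · refine (h.sum_weight_le (B := C * p * Real.exp (-(κ * s))) (by positivity)
      fun i hi => h.norm_sub_last_le' hi h0 h1).trans (le_of_eq ?_)
    ring

/-- The deviation `p_n M_{n-j} - p_{n-j} M_n`. -/
noncomputable def crossTerm (n : ℕ) (M : ℕ → ℝ → ℂ) (p : ℝ) (j : ℕ) (s : ℝ) : ℂ :=
  p * M (n - j) s - M (n - j) 0 * M n s

/-- A preliminary bound that uses only the increment in j and carries no factor ρ; it feeds the
estimate of the forcing term below. -/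
theorem CoeffSystem.norm_crossTerm_le_first (h : CoeffSystem n a M p C κ θ β ρ) {j : ℕ}
    (hj : j ≤ n) {s : ℝ} (hs0 : 0 ≤ s) (hs1 : s ≤ 1) :
    ‖crossTerm n M p j s‖ ≤ 2 * (C ^ 2 * p ^ 2 * Real.exp (-(κ * s))
      * (((j : ℝ) / n) ^ θ * growth n β (n - j))) := by
  have hC1 := h.one_le_C
  have hC : 0 ≤ C := zero_le_one.trans hC1
  have hp := h.p_pos.le
  have hG := (growth_pos n β (n - j)).le
  have h1 := h.norm_sub_last_le hj hs0 hs1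
  have h2 := h.norm_sub_last_le hj le_rfl zero_le_one
  have h3 := h.norm_le n le_rfl s hs0 hs1
  rw [growth_self, mul_one] at h3
  rw [mul_zero, neg_zero, Real.exp_zero, mul_one, h.at_zero] at h2
  have he : crossTerm n M p j s = p * (M (n - j) s - M n s) - (M (n - j) 0 - p) * M n s := by
    rw [crossTerm]
    ring
  set X := Real.exp (-(κ * s)) * (((j : ℝ) / n) ^ θ * growth n β (n - j)) with hX
  have hX0 : 0 ≤ X := by positivity
  rw [he]
  calc ‖(p : ℂ) * (M (n - j) s - M n s) - (M (n - j) 0 - p) * M n s‖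
      ≤ p * (C * p * ((j : ℝ) / n) ^ θ * growth n β (n - j) * Real.exp (-(κ * s)))
        + (C * p * ((j : ℝ) / n) ^ θ * growth n β (n - j)) * (C * p * Real.exp (-(κ * s))) := by
        refine (_root_.norm_sub_le _ _).trans (add_le_add ?_ ?_)
        · rw [norm_mul, Complex.norm_real, Real.norm_of_nonneg hp]
          exact mul_le_mul_of_nonneg_left h1 hp
        · rw [norm_mul]
          exact mul_le_mul h2 h3 (norm_nonneg _) (by positivity)
    _ = (C + C ^ 2) * (p ^ 2 * X) := by
        rw [hX]
        ring
    _ ≤ (2 * C ^ 2) * (p ^ 2 * X) := by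
        refine mul_le_mul_of_nonneg_right (by nlinarith) (by positivity)
    _ = _ := by
        rw [hX]
        ring

/-- The shifted coefficient `M_{m-i}`, equal to zero for `i > m`. -/
noncomputable def shifted (M : ℕ → ℝ → ℂ) (m i : ℕ) (s : ℝ) : ℂ :=
  if i ≤ m then M (m - i) s else 0

/-- The weight controlling the inhomogeneous term of the equation of `crossTerm`. -/
noncomputable def crossWeight (n : ℕ) (b : ℝ) (m i : ℕ) : ℝ :=
  (if i ≤ m then growth n b (m - i) else 0) + growth n b m * growth n b (n - i)

-- The bracket is an approximate second difference and must be small in both i and j. If i ≤ j, both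
-- differences have step i and are bounded separately. If j ≤ i, it is regrouped as p (M_{n-j-i} -
-- M_{n-i}) - (p_{n-j} - p) M_{n-i} minus `crossTerm`, every part of which has step j. Shifts past
-- index 0 are handled by `growth_le_rpow_mul`, which explains the exponent β + θ.
set_option maxHeartbeats 1000000 in
theorem CoeffSystem.norm_bracket_le (h : CoeffSystem n a M p C κ θ β ρ) {i j : ℕ}
    (hi : i ∈ Icc 1 n) (hj : j ∈ Icc 1 n) {s : ℝ} (hs0 : 0 ≤ s) (hs1 : s ≤ 1) :
    ‖p * (shifted M (n - j) i s - M (n - j) s) - M (n - j) 0 * (M (n - i) s - M n s)‖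
      ≤ 4 * (C ^ 2 * p ^ 2 * Real.exp (-(κ * s))) *
        ((((i : ℝ) / n) ^ (θ / 2) * ((j : ℝ) / n) ^ (θ / 2)) * crossWeight n (β + θ) (n - j) i) := by
  rw [Finset.mem_Icc] at hi hj
  have hC1 := h.one_le_C
  have hC : 0 ≤ C := zero_le_one.trans hC1
  have hCC : C ≤ C ^ 2 := by nlinarith
  have hp := h.p_pos.le
  have hθ := h.θ_nonneg
  have hβ := h.β_nonneg
  set E := Real.exp (-(κ * s)) with hE
  have hE0 : 0 < E := Real.exp_pos _
  set b := β + θ with hb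
  have hb0 : 0 ≤ b := add_nonneg hβ hθ
  set m := n - j with hm
  have hmn : m ≤ n := Nat.sub_le _ _
  have hni : n - i ≤ n := Nat.sub_le _ _
  set Gm := growth n b m with hGm
  set Gi := growth n b (n - i) with hGi
  have hGm1 : 1 ≤ Gm := one_le_growth hmn hb0
  have hGi1 : 1 ≤ Gi := one_le_growth hni hb0
  have hgm : growth n β m ≤ Gm := growth_mono hmn (by linarith)
  have hgi : growth n β (n - i) ≤ Gi := growth_mono hni (by linarith)
  have hgm0 := growth_pos n β m
  have hgi0 := growth_pos n β (n - i)
  have hGG1 : Gm ≤ Gm * Gi := le_mul_of_one_le_right (by linarith) hGi1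
  have hGG2 : Gi ≤ Gm * Gi := le_mul_of_one_le_left (by linarith) hGm1
  have hGG : growth n β m * growth n β (n - i) ≤ Gm * Gi :=
    mul_le_mul hgm hgi hgi0.le (by linarith)
  have hM0 : ‖M m 0‖ ≤ C * p * growth n β m := by
    have := h.norm_le m hmn 0 le_rfl zero_le_one
    rwa [mul_zero, neg_zero, Real.exp_zero, mul_one] at this
  have hMi : ‖M (n - i) s - M n s‖ ≤ C * p * ((i : ℝ) / n) ^ θ * growth n β (n - i) * E :=
    h.norm_sub_last_le hi.2 hs0 hs1
  set U := C ^ 2 * p ^ 2 * E with hU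
  have hU0 : 0 ≤ U := by positivity
  have hpp : p * (C * p) * E ≤ U := by
    rw [hU]
    nlinarith [mul_nonneg (mul_nonneg hp hp) hE0.le]
  set W := crossWeight n b m i with hW
  have hWG : Gm * Gi ≤ W := by
    rw [hW, crossWeight]
    refine le_add_of_nonneg_left ?_
    split_ifs
    · exact (growth_pos _ _ _).le
    · exact le_rfl
  have hWs : i ≤ m → growth n β (m - i) ≤ W := fun him => by
    rw [hW, crossWeight, if_pos him]
    have h1 : growth n β (m - i) ≤ growth n b (m - i) := growth_mono (by omega) (by linarith)
    have h2 : 0 ≤ Gm * Gi := by positivity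
    linarith
  have hW0 : 0 ≤ W := (by positivity : 0 ≤ Gm * Gi).trans hWG
  rcases le_total i j with hij | hij
  · -- the increment in `i` is the short one
    have hμ := min_rpow_le (n := n) hθ hij
    set t := ((i : ℝ) / n) ^ θ with ht
    have ht0 : 0 ≤ t := by positivity
    set μ := ((i : ℝ) / n) ^ (θ / 2) * ((j : ℝ) / n) ^ (θ / 2) with hμ'
    have hA : ‖(p : ℂ) * (shifted M m i s - M m s)‖ ≤ U * (t * W) := by
      rw [norm_mul, Complex.norm_real, Real.norm_of_nonneg hp, shifted]
      split_ifs with him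
      · have h1 := h.norm_sub_le (m - i) i (by omega) s hs0 hs1
        rw [Nat.sub_add_cancel him, norm_sub_rev] at h1
        calc p * ‖M (m - i) s - M m s‖ ≤ p * (C * p * t * growth n β (m - i) * E) :=
              mul_le_mul_of_nonneg_left h1 hp
          _ = p * (C * p) * E * (t * growth n β (m - i)) := by ring
          _ ≤ U * (t * W) :=
              mul_le_mul hpp (mul_le_mul_of_nonneg_left (hWs him) ht0)
                (mul_nonneg ht0 (growth_pos _ _ _).le) hU0
      · rw [zero_sub, norm_neg]
        have h1 := h.norm_le m hmn s hs0 hs1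
        have h2 : growth n β m ≤ t * Gm := growth_le_rpow_mul h.one_le (by omega) hθ
        calc p * ‖M m s‖ ≤ p * (C * p * growth n β m * E) := mul_le_mul_of_nonneg_left h1 hp
          _ = p * (C * p) * E * growth n β m := by ring
          _ ≤ U * (t * W) := by
              refine mul_le_mul hpp (h2.trans ?_) hgm0.le hU0
              exact mul_le_mul_of_nonneg_left (hGG1.trans hWG) ht0
    have hB : ‖M m 0 * (M (n - i) s - M n s)‖ ≤ U * (t * W) := by
      rw [norm_mul]
      calc ‖M m 0‖ * ‖M (n - i) s - M n s‖
          ≤ (C * p * growth n β m) * (C * p * t * growth n β (n - i) * E) :=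
            mul_le_mul hM0 hMi (norm_nonneg _) (by positivity)
        _ = U * (t * (growth n β m * growth n β (n - i))) := by
            rw [hU]
            ring
        _ ≤ U * (t * W) := by
            have := hGG.trans hWG
            gcongr
    calc _ ≤ U * (t * W) + U * (t * W) := (_root_.norm_sub_le _ _).trans (add_le_add hA hB)
      _ = 2 * (U * (t * W)) := by ring
      _ ≤ 2 * (U * (μ * W)) := by gcongr
      _ ≤ 4 * U * (μ * W) := by
          have : 0 ≤ U * (μ * W) := by positivity
          linarith
  · -- the increment in `j` is the short one
    have hμ := min_rpow_le (n := n) hθ hij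
    rw [mul_comm (((j : ℝ) / n) ^ (θ / 2))] at hμ
    set t := ((j : ℝ) / n) ^ θ with ht
    have ht0 : 0 ≤ t := by positivity
    set μ := ((i : ℝ) / n) ^ (θ / 2) * ((j : ℝ) / n) ^ (θ / 2) with hμ'
    have he : p * (shifted M m i s - M m s) - M m 0 * (M (n - i) s - M n s)
        = p * (shifted M m i s - M (n - i) s) - (M m 0 - p) * M (n - i) s - crossTerm n M p j s := by
      rw [crossTerm]
      ring
    have hA : ‖(p : ℂ) * (shifted M m i s - M (n - i) s)‖ ≤ U * (t * W) := by
      rw [norm_mul, Complex.norm_real, Real.norm_of_nonneg hp, shifted]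
      split_ifs with him
      · have h1 := h.norm_sub_le (m - i) j (by omega) s hs0 hs1
        rw [show m - i + j = n - i by omega, norm_sub_rev] at h1
        calc p * ‖M (m - i) s - M (n - i) s‖ ≤ p * (C * p * t * growth n β (m - i) * E) :=
              mul_le_mul_of_nonneg_left h1 hp
          _ = p * (C * p) * E * (t * growth n β (m - i)) := by ring
          _ ≤ U * (t * W) :=
              mul_le_mul hpp (mul_le_mul_of_nonneg_left (hWs him) ht0)
                (mul_nonneg ht0 (growth_pos _ _ _).le) hU0
      · rw [zero_sub, norm_neg]
        have h1 := h.norm_le (n - i) hni s hs0 hs1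
        have h2 : growth n β (n - i) ≤ t * Gi := growth_le_rpow_mul h.one_le (by omega) hθ
        calc p * ‖M (n - i) s‖ ≤ p * (C * p * growth n β (n - i) * E) :=
              mul_le_mul_of_nonneg_left h1 hp
          _ = p * (C * p) * E * growth n β (n - i) := by ring
          _ ≤ U * (t * W) := by
              refine mul_le_mul hpp (h2.trans ?_) hgi0.le hU0
              exact mul_le_mul_of_nonneg_left (hGG2.trans hWG) ht0
    have hB : ‖(M m 0 - p) * M (n - i) s‖ ≤ U * (t * W) := by
      have h1 := h.norm_sub_last_le hj.2 le_rfl zero_le_one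
      rw [mul_zero, neg_zero, Real.exp_zero, mul_one, h.at_zero] at h1
      rw [norm_mul]
      calc ‖M m 0 - p‖ * ‖M (n - i) s‖
          ≤ (C * p * t * growth n β m) * (C * p * growth n β (n - i) * E) :=
            mul_le_mul h1 (h.norm_le _ hni s hs0 hs1) (norm_nonneg _) (by positivity)
        _ = U * (t * (growth n β m * growth n β (n - i))) := by
            rw [hU]
            ring
        _ ≤ U * (t * W) := by
            have := hGG.trans hWG
            gcongr
    have hD : ‖crossTerm n M p j s‖ ≤ 2 * (U * (t * W)) := by
      refine (h.norm_crossTerm_le_first hj.2 hs0 hs1).trans ?_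
      have : growth n β m ≤ W := hgm.trans (hGG1.trans hWG)
      gcongr
    rw [he]
    calc _ ≤ U * (t * W) + U * (t * W) + 2 * (U * (t * W)) :=
          (_root_.norm_sub_le _ _).trans (add_le_add ((_root_.norm_sub_le _ _).trans (add_le_add hA hB)) hD)
      _ = 4 * U * (t * W) := by ring
      _ ≤ 4 * U * (μ * W) := by gcongr

/-- The terms of the shorter system need the bound on the weights at m = n - j, which is why
`CoeffSystem.sum_le` is required for every m ≤ n. Since m ≤ n, (i/n)^{θ/2} ≤ (i/m)^{θ/2}, and the
growth factors multiply. -/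
theorem CoeffSystem.sum_crossWeight_le (h : CoeffSystem n a M p C κ θ β ρ) (j : ℕ) :
    ∑ i ∈ Icc 1 n, ‖a i‖ * (((i : ℝ) / n) ^ (θ / 2) * crossWeight n (β + θ) (n - j) i)
      ≤ 2 * (growth n (β + θ) (n - j) * ρ) := by
  set b := β + θ with hb
  set m := n - j with hm
  have hmn : m ≤ n := Nat.sub_le _ _
  have hθ := h.θ_nonneg
  have hG := growth_pos n b m
  have hn0 : (0 : ℝ) < n := by exact_mod_cast h.one_le
  have h1 : ∑ i ∈ Icc 1 n, ‖a i‖ * (((i : ℝ) / n) ^ (θ / 2) * (growth n b m * growth n b (n - i)))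
      ≤ growth n b m * ρ := by
    refine le_trans (le_of_eq ?_) (mul_le_mul_of_nonneg_left (h.sum_le n h.one_le le_rfl) hG.le)
    rw [Finset.mul_sum]
    exact Finset.sum_congr rfl fun i _ => by ring
  have h2 : ∑ i ∈ Icc 1 n, ‖a i‖ * (((i : ℝ) / n) ^ (θ / 2) *
      (if i ≤ m then growth n b (m - i) else 0)) ≤ growth n b m * ρ := by
    have h3 : ∑ i ∈ Icc 1 n, ‖a i‖ * (((i : ℝ) / n) ^ (θ / 2) *
        (if i ≤ m then growth n b (m - i) else 0))
        = ∑ i ∈ Icc 1 m, ‖a i‖ * (((i : ℝ) / n) ^ (θ / 2) * growth n b (m - i)) := by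
      rw [← Finset.sum_subset (Finset.Icc_subset_Icc_right hmn)]
      · refine Finset.sum_congr rfl fun i hi => ?_
        rw [if_pos (Finset.mem_Icc.1 hi).2]
      · intro i hi hi'
        rw [Finset.mem_Icc] at hi hi'
        rw [if_neg (by omega), mul_zero, mul_zero]
    rw [h3]
    rcases Nat.eq_zero_or_pos m with h0 | h0
    · rw [h0]
      have hρ : 0 ≤ ρ := (Finset.sum_nonneg fun i _ => mul_nonneg (norm_nonneg _)
        (mul_nonneg (by positivity) (growth_pos _ _ _).le)).trans (h.sum_le n h.one_le le_rfl)
      have := growth_pos n b 0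
      simp only [zero_lt_one, Finset.Icc_eq_empty_of_lt, Finset.sum_empty]
      positivity
    · refine le_trans ?_ (mul_le_mul_of_nonneg_left (h.sum_le m h0 hmn) hG.le)
      rw [Finset.mul_sum]
      refine Finset.sum_le_sum fun i hi => ?_
      have hm0 : (0 : ℝ) < m := by exact_mod_cast h0
      have h4 : ((i : ℝ) / n) ^ (θ / 2) ≤ ((i : ℝ) / m) ^ (θ / 2) := by
        refine Real.rpow_le_rpow (by positivity) ?_ (by linarith)
        exact div_le_div_of_nonneg_left i.cast_nonneg hm0 (by exact_mod_cast hmn)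
      rw [← growth_mul_growth (n := n) (m := m) (k := m - i) b]
      have h5 := growth_pos m b (m - i)
      calc ‖a i‖ * (((i : ℝ) / n) ^ (θ / 2) * (growth n b m * growth m b (m - i)))
          ≤ ‖a i‖ * (((i : ℝ) / m) ^ (θ / 2) * (growth n b m * growth m b (m - i))) := by gcongr
        _ = _ := by ring
  calc _ = ∑ i ∈ Icc 1 n, ‖a i‖ * (((i : ℝ) / n) ^ (θ / 2) *
        (if i ≤ m then growth n b (m - i) else 0))
        + ∑ i ∈ Icc 1 n, ‖a i‖ * (((i : ℝ) / n) ^ (θ / 2) * (growth n b m * growth n b (n - i))) := by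
        rw [← Finset.sum_add_distrib]
        refine Finset.sum_congr rfl fun i _ => ?_
        rw [crossWeight]
        ring
    _ ≤ _ := by linarith

/-- Starting from 0, the cross term is driven only by the brackets, whose weighted sum is of order
ρ. -/
theorem CoeffSystem.norm_crossTerm_le (h : CoeffSystem n a M p C κ θ β ρ) {j : ℕ}
    (hj : j ∈ Icc 1 n) {s : ℝ} (hs0 : 0 ≤ s) (hs1 : s ≤ 1) :
    ‖crossTerm n M p j s‖ ≤ 8 * (C ^ 2 * p ^ 2 * ρ) *
      (((j : ℝ) / n) ^ (θ / 2) * growth n (β + θ) (n - j)) * Real.exp (-(κ * s)) := by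
  have hj' := Finset.mem_Icc.1 hj
  have hp := h.p_pos.le
  have hz : crossTerm n M p j 0 = 0 := by
    rw [crossTerm, h.at_zero]
    ring
  have := norm_sub_exp_mul_le (g := crossTerm n M p j) (κ := κ)
    (K := 8 * (C ^ 2 * p ^ 2 * ρ) * (((j : ℝ) / n) ^ (θ / 2) * growth n (β + θ) (n - j)))
    (r := fun s => ∑ i ∈ Icc 1 n, a i * (p * (shifted M (n - j) i s - M (n - j) s)
      - M (n - j) 0 * (M (n - i) s - M n s)))
    (Λ := ∑ i ∈ Icc 1 n, a i) (fun s _ _ => ?_) (fun s h0 h1 => ?_) h.re_le hs0 hs1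
  · rwa [hz, mul_zero, sub_zero] at this
  · have h1 := ((h.deriv (n - j) (Nat.sub_le _ _) s).const_mul (p : ℂ)).fun_sub
      ((h.deriv n le_rfl s).const_mul (M (n - j) 0))
    refine h1.congr_deriv ?_
    have h2 : ∑ i ∈ Icc 1 (n - j), a i * M (n - j - i) s
        = ∑ i ∈ Icc 1 n, a i * shifted M (n - j) i s := by
      rw [← Finset.sum_subset (Finset.Icc_subset_Icc_right (Nat.sub_le n j))]
      · refine Finset.sum_congr rfl fun i hi => ?_
        rw [shifted, if_pos (Finset.mem_Icc.1 hi).2]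
      · intro i hi hi'
        rw [Finset.mem_Icc] at hi hi'
        rw [shifted, if_neg (by omega), mul_zero]
    rw [h2, crossTerm, Finset.mul_sum, Finset.mul_sum, Finset.sum_mul, ← Finset.sum_sub_distrib,
      ← Finset.sum_add_distrib]
    refine Finset.sum_congr rfl fun i _ => ?_
    ring
  · refine (norm_sum_le _ _).trans ?_
    set U := C ^ 2 * p ^ 2 * Real.exp (-(κ * s)) with hU
    have hU0 : 0 ≤ U := by positivity
    calc ∑ i ∈ Icc 1 n, ‖a i * (p * (shifted M (n - j) i s - M (n - j) s)
          - M (n - j) 0 * (M (n - i) s - M n s))‖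
        ≤ ∑ i ∈ Icc 1 n, (4 * U * ((j : ℝ) / n) ^ (θ / 2)) *
          (‖a i‖ * (((i : ℝ) / n) ^ (θ / 2) * crossWeight n (β + θ) (n - j) i)) := by
          refine Finset.sum_le_sum fun i hi => ?_
          rw [norm_mul]
          refine (mul_le_mul_of_nonneg_left (h.norm_bracket_le hi hj h0 h1)
            (norm_nonneg _)).trans (le_of_eq ?_)
          ring
      _ ≤ (4 * U * ((j : ℝ) / n) ^ (θ / 2)) * (2 * (growth n (β + θ) (n - j) * ρ)) := by
          rw [← Finset.mul_sum]
          exact mul_le_mul_of_nonneg_left (h.sum_crossWeight_le j) (by positivity)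
      _ = _ := by
          rw [hU]
          ring

/-- With l the linear term, M_n - e^{sΛ} p (1 + s l) vanishes at s = 0 and solves the equation with
rate Λ and forcing l (M_n - e^{sΛ} p) + ∑ a_j `crossTerm`_j / p. Each summand is a product of two
quantities of order ρ; the constants 1 and 8 add up to 9. -/
theorem CoeffSystem.norm_sub_second_order_le (h : CoeffSystem n a M p C κ θ β ρ) :
    ‖M n 1 - Complex.exp (∑ i ∈ Icc 1 n, a i) * (p * (1 + linTerm n a M p))‖
      ≤ 9 * (C ^ 2 * p * ρ ^ 2) * Real.exp (-κ) := by
  have hC : 0 ≤ C := zero_le_one.trans h.one_le_C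
  have hp := h.p_pos.le
  have hp0 : (p : ℂ) ≠ 0 := by exact_mod_cast h.p_pos.ne'
  have hρ : 0 ≤ ρ := (Finset.sum_nonneg fun i _ => mul_nonneg (norm_nonneg _)
    (mul_nonneg (by positivity) (growth_pos _ _ _).le)).trans (h.sum_le n h.one_le le_rfl)
  set Λ := ∑ i ∈ Icc 1 n, a i with hΛ
  set l := linTerm n a M p with hl
  have hlin := h.norm_linTerm_le
  rw [← hl] at hlin
  have := norm_sub_exp_mul_le (κ := κ) (K := 9 * (C ^ 2 * p * ρ ^ 2)) (Λ := Λ)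
    (g := fun s => M n s - Complex.exp (s * Λ) * (p * (1 + s * l)))
    (r := fun s => l * (M n s - Complex.exp (s * Λ) * p)
      + ∑ j ∈ Icc 1 n, a j * (crossTerm n M p j s / p))
    (fun s _ _ => ?_) (fun s h0 h1 => ?_) h.re_le zero_le_one le_rfl
  · simpa [h.at_zero] using this
  · have e1 : HasDerivAt (fun s : ℝ => Complex.exp (s * Λ)) (Complex.exp (s * Λ) * Λ) s := by
      have h2 : HasDerivAt (fun σ : ℝ => (σ : ℂ) * Λ) Λ s := by
        simpa using (hasDerivAt_id s).ofReal_comp.mul_const Λ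
      exact h2.cexp
    have e2 : HasDerivAt (fun s : ℝ => (p : ℂ) * (1 + s * l)) (p * l) s := by
      have h2 : HasDerivAt (fun σ : ℝ => (1 : ℂ) + (σ : ℂ) * l) l s := by
        simpa using ((hasDerivAt_id s).ofReal_comp.mul_const l).const_add (1 : ℂ)
      exact h2.const_mul _
    refine ((h.deriv n le_rfl s).fun_sub (e1.mul e2)).congr_deriv ?_
    have h3 : ∑ j ∈ Icc 1 n, a j * (crossTerm n M p j s / p)
        = ∑ j ∈ Icc 1 n, a j * M (n - j) s - l * M n s - Λ * M n s := by
      rw [hl, hΛ, linTerm, Finset.sum_mul, Finset.sum_mul, ← Finset.sum_sub_distrib,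
        ← Finset.sum_sub_distrib]
      refine Finset.sum_congr rfl fun j _ => ?_
      rw [crossTerm]
      field_simp
      ring
    simp only [h3]
    ring
  · have h2 : ‖∑ j ∈ Icc 1 n, a j * (crossTerm n M p j s / p)‖
        ≤ (8 * (C ^ 2 * p * ρ) * Real.exp (-(κ * s))) * ρ := by
      refine h.sum_weight_le (by positivity) fun j hj => ?_
      rw [norm_div, Complex.norm_real, Real.norm_of_nonneg hp, div_le_iff₀ h.p_pos]
      refine (h.norm_crossTerm_le hj h0 h1).trans (le_of_eq ?_)
      ring
    have h3 : ‖l * (M n s - Complex.exp (s * Λ) * p)‖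
        ≤ (C * ρ) * (C * p * ρ * Real.exp (-(κ * s))) := by
      rw [norm_mul]
      exact mul_le_mul hlin (h.norm_sub_main_le h0 h1) (norm_nonneg _) (by positivity)
    refine (norm_add_le _ _).trans ((add_le_add h3 h2).trans (le_of_eq ?_))
    ring

end Interpolation
end RandPerm

namespace RandPerm

/-! ### Fejér kernel and the smoothing inequality. -/

section Smoothing

open MeasureTheory

/-- The unnormalised Fejér kernel `(1 - cos y) / y ^ 2`. -/
noncomputable def fejer (y : ℝ) : ℝ := Real.sinc (y / 2) ^ 2 / 2

theorem fejer_nonneg (y : ℝ) : 0 ≤ fejer y := by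
  rw [fejer]
  positivity

theorem fejer_neg (y : ℝ) : fejer (-y) = fejer y := by
  rw [fejer, fejer, neg_div, Real.sinc_neg]

theorem continuous_fejer : Continuous fejer := by
  unfold fejer
  have := Real.continuous_sinc
  fun_prop

theorem fejer_of_ne_zero {y : ℝ} (hy : y ≠ 0) : fejer y = (1 - Real.cos y) / y ^ 2 := by
  have h2 := Real.cos_sq (y / 2)
  rw [mul_div_cancel₀ _ (two_ne_zero' ℝ)] at h2
  rw [fejer, Real.sinc_of_ne_zero (by positivity), div_pow, Real.sin_sq, h2]
  field_simp
  ring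

theorem fejer_le (y : ℝ) : fejer y ≤ 4 * (1 + y ^ 2)⁻¹ := by
  have h1 : fejer y ≤ 1 / 2 := by
    rw [fejer]
    have := Real.abs_sinc_le_one (y / 2)
    have h2 : Real.sinc (y / 2) ^ 2 ≤ 1 := by
      rw [← sq_abs]
      exact pow_le_one₀ (abs_nonneg _) this
    linarith
  have h2 : fejer y * y ^ 2 ≤ 2 := by
    rcases eq_or_ne y 0 with rfl | hy
    · norm_num
    · rw [fejer_of_ne_zero hy, div_mul_cancel₀ _ (by positivity)]
      linarith [Real.neg_one_le_cos y]
  rw [← div_eq_mul_inv, le_div_iff₀ (by positivity)]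
  linarith

theorem integrable_fejer : Integrable fejer := by
  refine (integrable_inv_one_add_sq.const_mul 4).mono' continuous_fejer.aestronglyMeasurable ?_
  refine Filter.Eventually.of_forall fun y => ?_
  rw [Real.norm_of_nonneg (fejer_nonneg y)]
  exact fejer_le y

theorem integral_fejer_pos : 0 < ∫ y, fejer y := by
  rw [integral_pos_iff_support_of_nonneg fejer_nonneg integrable_fejer]
  refine IsOpen.measure_pos _ continuous_fejer.isOpen_support ⟨0, ?_⟩
  simp [fejer]

theorem integral_one_sub_mul_cos (y : ℝ) :
    ∫ t in (0 : ℝ)..1, (1 - t) * Real.cos (t * y) = fejer y := by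
  rcases eq_or_ne y 0 with rfl | hy
  · have h : ∀ t ∈ Set.uIcc (0 : ℝ) 1, HasDerivAt (fun t : ℝ => t - t ^ 2 / 2)
        ((1 - t) * Real.cos (t * 0)) t := by
      intro t _
      refine ((hasDerivAt_id t).fun_sub ((hasDerivAt_pow 2 t).div_const 2)).congr_deriv ?_
      simp
    rw [intervalIntegral.integral_eq_sub_of_hasDerivAt h
      (Continuous.intervalIntegrable (by fun_prop) _ _)]
    norm_num [fejer]
  · have h : ∀ t ∈ Set.uIcc (0 : ℝ) 1, HasDerivAt
        (fun t : ℝ => (1 - t) * (Real.sin (t * y) / y) - Real.cos (t * y) / y ^ 2)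
        ((1 - t) * Real.cos (t * y)) t := by
      intro t _
      have h0 : HasDerivAt (fun t : ℝ => t * y) y t := by
        simpa using (hasDerivAt_id t).mul_const y
      refine ((((hasDerivAt_id t).const_sub 1).mul (h0.sin.div_const y)).fun_sub
        (h0.cos.div_const (y ^ 2))).congr_deriv ?_
      simp only [id]
      field_simp
      ring
    rw [intervalIntegral.integral_eq_sub_of_hasDerivAt h
      (Continuous.intervalIntegrable (by fun_prop) _ _), fejer_of_ne_zero hy]
    simp
    field_simp
    ring

theorem integral_cos_mul (t z : ℝ) :
    ∫ y in (0 : ℝ)..z, Real.cos (t * y) = z * Real.sinc (t * z) := by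
  rcases eq_or_ne t 0 with rfl | ht
  · simp
  rcases eq_or_ne z 0 with rfl | hz
  · simp
  · rw [intervalIntegral.integral_comp_mul_left _ ht, integral_cos, mul_zero, Real.sin_zero,
      sub_zero, Real.sinc_of_ne_zero (mul_ne_zero ht hz), smul_eq_mul]
    field_simp

theorem integral_fejer_eq (z : ℝ) :
    ∫ y in (0 : ℝ)..z, fejer y = ∫ t in (0 : ℝ)..1, (1 - t) * (z * Real.sinc (t * z)) := by
  simp_rw [← integral_one_sub_mul_cos, ← integral_cos_mul, ← intervalIntegral.integral_const_mul]
  simp_rw [intervalIntegral.integral_of_le (zero_le_one' ℝ)]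
  refine intervalIntegral_integral_swap ?_
  have h1 : Continuous (Function.uncurry fun y t : ℝ => (1 - t) * Real.cos (t * y)) := by
    fun_prop
  have h2 : IntegrableOn (Function.uncurry fun y t : ℝ => (1 - t) * Real.cos (t * y))
      (Set.uIcc 0 z ×ˢ Set.Icc 0 1) (volume.prod volume) :=
    h1.continuousOn.integrableOn_compact (isCompact_uIcc.prod isCompact_Icc)
  rw [Measure.prod_restrict]
  exact h2.mono_set (Set.prod_mono Set.uIoc_subset_uIcc Set.Ioc_subset_Icc_self)

/-- As `fejer` is the cosine transform of 1 - t on [0, 1], its distribution function is half the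
mass plus an integral over the bounded frequency range 0 < t ≤ 1. -/
theorem integral_Iio_fejer (z : ℝ) :
    ∫ y in Set.Iio z, fejer y
      = (∫ y, fejer y) / 2 + ∫ t in (0 : ℝ)..1, (1 - t) * (z * Real.sinc (t * z)) := by
  have h1 : ∫ y in Set.Iic (0 : ℝ), fejer y = ∫ y in Set.Ioi (0 : ℝ), fejer y := by
    have := integral_comp_neg_Iic 0 fejer
    simpa only [fejer_neg, neg_zero] using this
  have h2 := intervalIntegral.integral_Iic_add_Ioi (b := (0 : ℝ)) (f := fejer)
    integrable_fejer.integrableOn integrable_fejer.integrableOn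
  have h3 := intervalIntegral.integral_Iic_sub_Iic (a := (0 : ℝ)) (b := z) (f := fejer)
    integrable_fejer.integrableOn integrable_fejer.integrableOn
  rw [← integral_Iic_eq_integral_Iio, ← integral_fejer_eq, ← h3]
  linarith

variable {Ω : Type*} [MeasurableSpace Ω] {μ : Measure Ω} {w X : Ω → ℝ}

theorem integrable_sinc_kernel [SFinite μ] (hw : Integrable w μ) (hX : Measurable X)
    (hwX : Integrable (fun ω => w ω * X ω) μ) (x : ℝ) :
    Integrable (Function.uncurry fun (t : ℝ) (ω : Ω) =>
      (1 - t) * (w ω * ((x - X ω) * Real.sinc (t * (x - X ω)))))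
      ((volume.restrict (Set.uIoc 0 1)).prod μ) := by
  have hwx : Integrable (fun ω => w ω * (x - X ω)) μ := by
    refine ((hw.mul_const x).sub hwX).congr (Filter.Eventually.of_forall fun ω => ?_)
    simp only [Pi.sub_apply]
    ring
  have h1 : Integrable (fun t : ℝ => 1 - t) (volume.restrict (Set.uIoc (0 : ℝ) 1)) := by
    have : IntervalIntegrable (fun t : ℝ => 1 - t) volume 0 1 :=
      Continuous.intervalIntegrable (by fun_prop) _ _
    exact intervalIntegrable_iff.1 this
  have h2 : Measurable fun q : ℝ × Ω => Real.sinc (q.1 * (x - X q.2)) :=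
    Real.continuous_sinc.measurable.comp (by fun_prop)
  refine ((h1.mul_prod hwx).mul_bdd (c := 1) h2.aestronglyMeasurable
    (Filter.Eventually.of_forall fun q => Real.abs_sinc_le_one _)).congr
    (Filter.Eventually.of_forall fun q => ?_)
  simp only [Function.uncurry]
  ring

theorem integrable_ite_kernel [SFinite μ] (hw : Integrable w μ) (hX : Measurable X) (x : ℝ) :
    Integrable (Function.uncurry fun (y : ℝ) (ω : Ω) =>
      (if X ω < x - y then w ω else 0) * fejer y) (volume.prod μ) := by
  have hmeas : MeasurableSet {q : ℝ × Ω | X q.2 < x - q.1} :=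
    measurableSet_lt (by fun_prop) (by fun_prop)
  refine ((integrable_fejer.mul_prod hw).indicator hmeas).congr
    (Filter.Eventually.of_forall fun q => ?_)
  simp only [Set.indicator, Set.mem_ofPred_eq, Function.uncurry]
  split_ifs <;> ring

/-- Fubini for a weighted distribution function smoothed by the kernel. Taking weights w on an
arbitrary measure treats the discrete law and the signed Gaussian approximation alike;
`integral_mul_sinc` then turns the inner integral into a characteristic function. -/
theorem integral_mul_fejer [SFinite μ] (hw : Integrable w μ) (hX : Measurable X)
    (hwX : Integrable (fun ω => w ω * X ω) μ) (x : ℝ) :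
    ∫ y, (∫ ω, (if X ω < x - y then w ω else 0) ∂μ) * fejer y
      = (∫ y, fejer y) / 2 * ∫ ω, w ω ∂μ
        + ∫ t in (0 : ℝ)..1, ∫ ω, (1 - t) * (w ω * ((x - X ω) * Real.sinc (t * (x - X ω)))) ∂μ := by
  have hint := integrable_ite_kernel hw hX x
  have hint2 := integrable_sinc_kernel hw hX hwX x
  simp_rw [← integral_mul_const]
  rw [integral_integral_swap hint, intervalIntegral_integral_swap hint2, ← integral_const_mul,
    ← integral_add (hw.const_mul _)]
  · refine integral_congr_ae (Filter.Eventually.of_forall fun ω => ?_)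
    have h1 : ∀ y, (if X ω < x - y then w ω else 0) * fejer y
        = (Set.Iio (x - X ω)).indicator (fun y => w ω * fejer y) y := by
      intro y
      simp only [Set.indicator, Set.mem_Iio, lt_sub_comm]
      split_ifs <;> ring
    simp only [h1]
    rw [integral_indicator measurableSet_Iio, integral_const_mul, integral_Iio_fejer, mul_add,
      ← intervalIntegral.integral_const_mul]
    congr 1
    · ring
    · refine intervalIntegral.integral_congr fun t _ => ?_
      ring
  · have := hint2.swap.integral_prod_left
    refine this.congr (Filter.Eventually.of_forall fun ω => ?_)
    simp [intervalIntegral.integral_of_le, Function.uncurry]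

theorem integral_mul_sinc (hw : Integrable w μ) (hX : Measurable X) (x : ℝ) {t : ℝ} (ht : 0 < t) :
    ∫ ω, w ω * ((x - X ω) * Real.sinc (t * (x - X ω))) ∂μ
      = -(Complex.exp (-(t * x * Complex.I)) * ∫ ω, w ω * Complex.exp (t * X ω * Complex.I) ∂μ).im
        / t := by
  have hint : Integrable (fun ω => (w ω : ℂ) * Complex.exp (t * X ω * Complex.I)) μ := by
    refine hw.ofReal.mul_bdd (c := 1) (Measurable.aestronglyMeasurable (by fun_prop))
      (Filter.Eventually.of_forall fun ω => ?_)
    rw [← Complex.ofReal_mul, Complex.norm_exp_ofReal_mul_I]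
  rw [← integral_const_mul]
  have := integral_im (hint.const_mul (Complex.exp (-(t * x * Complex.I))))
  simp only [RCLike.im_to_complex] at this
  rw [← this, ← integral_neg, ← integral_div]
  refine integral_congr_ae (Filter.Eventually.of_forall fun ω => ?_)
  have h1 : Complex.exp (-(t * x * Complex.I)) * (w ω * Complex.exp (t * X ω * Complex.I))
      = w ω * Complex.exp ((t * (X ω - x) : ℝ) * Complex.I) := by
    rw [mul_left_comm, ← Complex.exp_add]
    congr 2
    push_cast
    ring
  simp only [h1]
  rw [Complex.im_ofReal_mul, Complex.exp_ofReal_mul_I_im]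
  have h2 : Real.sin (t * (X ω - x)) = -Real.sin (t * (x - X ω)) := by
    rw [← Real.sin_neg]
    congr 1
    ring
  rw [h2]
  rcases eq_or_ne (x - X ω) 0 with h0 | h0
  · simp [h0]
  · rw [Real.sinc_of_ne_zero (mul_ne_zero ht.ne' h0)]
    field_simp

/-- Half of the smoothing inequality: a function which cannot decrease fast is bounded above by its
Fejér means, up to a fraction of its supremum. -/
theorem le_of_fejer_mean_le {a : ℝ}
    (ha : 7 / 8 * ∫ y, fejer y ≤ ∫ y in Set.Icc (-a) a, fejer y) {D : ℝ → ℝ} {m S Δ : ℝ}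
    (hD : Measurable D) (hm : 0 ≤ m) (hdec : ∀ x u, 0 ≤ u → D x - m * u ≤ D (x + u))
    (hΔ : ∀ x, |D x| ≤ Δ) (hS : ∀ x, |∫ y, D (x - y) * fejer y| ≤ S) (x : ℝ) :
    D x ≤ 2 * a * m + 2 * S / (∫ y, fejer y) + Δ / 2 := by
  set l := ∫ y, fejer y with hl
  set I := ∫ y in Set.Icc (-a) a, fejer y with hI
  have hl0 : 0 < l := integral_fejer_pos
  have hIl : I ≤ l := setIntegral_le_integral integrable_fejer
    (Filter.Eventually.of_forall fejer_nonneg)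
  have hS0 : 0 ≤ S := (abs_nonneg _).trans (hS 0)
  have hΔ0 : 0 ≤ Δ := (abs_nonneg _).trans (hΔ 0)
  have hind : Integrable ((Set.Icc (-a) a).indicator fejer) :=
    integrable_fejer.indicator measurableSet_Icc
  -- The mean is taken at x + a, so that for |y| ≤ a the argument lies to the right of x by at most
  -- 2a and D has dropped by at most 2am. Outside the window only D ≥ -Δ is used.
  have hlow : (D x - 2 * a * m + Δ) * I - Δ * l ≤ ∫ y, D (x + a - y) * fejer y := by
    rw [hI, hl, ← integral_indicator measurableSet_Icc, ← integral_const_mul,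
      ← integral_const_mul, ← integral_sub (hind.const_mul _) (integrable_fejer.const_mul _)]
    refine integral_mono ((hind.const_mul _).sub (integrable_fejer.const_mul _)) ?_ fun y => ?_
    · exact integrable_fejer.bdd_mul (c := Δ)
        (Measurable.aestronglyMeasurable (hD.comp (by fun_prop)))
        (Filter.Eventually.of_forall fun y => hΔ _)
    · have h0 := fejer_nonneg y
      have h1 := neg_le_of_abs_le (hΔ (x + a - y))
      by_cases hy : y ∈ Set.Icc (-a) a
      · have h2 := hdec x (a - y) (by linarith [hy.2])
        rw [show x + (a - y) = x + a - y by ring] at h2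
        have h3 : m * (a - y) ≤ m * (2 * a) :=
          mul_le_mul_of_nonneg_left (by linarith [hy.1]) hm
        simp only [Set.indicator_of_mem hy]
        nlinarith
      · simp only [Set.indicator_of_notMem hy]
        nlinarith
  have hup := le_of_abs_le (hS (x + a))
  by_cases hneg : D x - 2 * a * m ≤ 0
  · have : 0 ≤ 2 * S / l := by positivity
    linarith
  · rw [not_le] at hneg
    have h1 : (D x - 2 * a * m) * (7 / 8 * l) ≤ (D x - 2 * a * m) * I :=
      mul_le_mul_of_nonneg_left ha hneg.le
    have h2 : Δ * (l - I) ≤ Δ * (l / 8) := mul_le_mul_of_nonneg_left (by linarith) hΔ0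
    have h3 : (D x - 2 * a * m) * (7 / 8 * l) ≤ S + Δ * (l / 8) := by linarith
    have h4 : D x - 2 * a * m ≤ (S + Δ * (l / 8)) / (7 / 8 * l) :=
      (le_div_iff₀ (by positivity)).2 h3
    have h5 : (S + Δ * (l / 8)) / (7 / 8 * l) = 8 / 7 * (S / l) + Δ / 7 := by
      field_simp
    have h6 : 0 ≤ S / l := by positivity
    rw [h5] at h4
    rw [mul_div_assoc]
    linarith

/-- Applying the one-sided bound to D and to its reflection gives Δ ≤ 2am + 2S/l + Δ/2 for the
supremum Δ, which is finite by hypothesis, so the last term is absorbed. -/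
theorem exists_smoothing_inequality : ∃ K : ℝ, 0 < K ∧ ∀ (D : ℝ → ℝ) (m S : ℝ), Measurable D →
    0 ≤ m → (∀ x u, 0 ≤ u → D x - m * u ≤ D (x + u)) → (∃ B, ∀ x, |D x| ≤ B) →
    (∀ x, |∫ y, D (x - y) * fejer y| ≤ S) → ∀ x, |D x| ≤ K * (S + m) := by
  have hl0 := integral_fejer_pos
  obtain ⟨a, ha0, ha⟩ : ∃ a : ℝ, 0 ≤ a ∧
      7 / 8 * ∫ y, fejer y ≤ ∫ y in Set.Icc (-a) a, fejer y := by
    have h1 := intervalIntegral_tendsto_integral integrable_fejer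
      Filter.tendsto_neg_atTop_atBot (Filter.tendsto_id (α := ℝ))
    have h2 := h1.eventually (lt_mem_nhds (show 7 / 8 * ∫ y, fejer y < ∫ y, fejer y by linarith))
    obtain ⟨a, h3, h4⟩ := (h2.and (Filter.eventually_ge_atTop (0 : ℝ))).exists
    refine ⟨a, h4, ?_⟩
    rw [integral_Icc_eq_integral_Ioc, ← intervalIntegral.integral_of_le (by linarith)]
    exact h3.le
  set l := ∫ y, fejer y with hl
  refine ⟨4 * a + 4 / l, by positivity, fun D m S hD hm hdec hbdd hS x => ?_⟩
  have hS0 : 0 ≤ S := (abs_nonneg _).trans (hS 0)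
  have hbdd' : BddAbove (Set.range fun x => |D x|) := by
    obtain ⟨B, hB⟩ := hbdd
    exact ⟨B, by rintro _ ⟨y, rfl⟩; exact hB y⟩
  set Δ := ⨆ x, |D x| with hΔdef
  have hΔ : ∀ x, |D x| ≤ Δ := fun x => le_ciSup hbdd' x
  have hle : ∀ x, |D x| ≤ 2 * a * m + 2 * S / l + Δ / 2 := by
    intro x
    refine abs_le'.2 ⟨le_of_fejer_mean_le ha hD hm hdec hΔ hS x, ?_⟩
    -- The reflection x ↦ -D(-x) again cannot decrease fast, and its smoothed means agree in
    -- absolute value because the kernel is even.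
    have := le_of_fejer_mean_le (D := fun x => -D (-x)) (m := m) (S := S) (Δ := Δ) ha
      (by fun_prop) hm (fun z u hu => ?_) (fun z => ?_) (fun z => ?_) (-x)
    · simpa using this
    · have := hdec (-(z + u)) u hu
      rw [show -(z + u) + u = -z by ring] at this
      linarith
    · rw [abs_neg]
      exact hΔ _
    · have h1 : ∫ y, -D (-(z - y)) * fejer y = -∫ y, D (-z - y) * fejer y := by
        rw [← integral_neg, ← integral_neg_eq_self]
        refine integral_congr_ae (Filter.Eventually.of_forall fun y => ?_)
        simp only [fejer_neg]
        rw [show -(z - -y) = -z - y by ring]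
        ring
      rw [h1, abs_neg]
      exact hS _
  have hΔle : Δ ≤ 2 * a * m + 2 * S / l + Δ / 2 := ciSup_le hle
  have h1 : 0 ≤ S / l := by positivity
  have h2 : 0 ≤ a * S := by positivity
  have h3 : 0 ≤ m / l := by positivity
  calc |D x| ≤ Δ := hΔ x
    _ ≤ 4 * a * m + 4 * (S / l) := by
        rw [mul_div_assoc] at hΔle
        linarith
    _ ≤ 4 * a * m + 4 * (S / l) + 4 * (a * S) + 4 * (m / l) := by linarith
    _ = _ := by ring

end Smoothing
end RandPerm

namespace RandPerm

/-! ### Esseen's inequality for the approximation Φ - c φ. -/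

section Esseen

open MeasureTheory ProbabilityTheory

/-- The standard normal density. -/
noncomputable def gaussDensity (x : ℝ) : ℝ := 1 / Real.sqrt (2 * Real.pi) * Real.exp (-x ^ 2 / 2)

theorem gaussDensity_eq : gaussDensity = gaussianPDFReal 0 1 := by
  funext x
  simp [gaussDensity, gaussianPDFReal]

theorem gaussDensity_nonneg (x : ℝ) : 0 ≤ gaussDensity x := by
  rw [gaussDensity]
  positivity

theorem gaussDensity_le_exp (x : ℝ) : gaussDensity x ≤ Real.exp (-x ^ 2 / 2) := by
  rw [gaussDensity]
  refine mul_le_of_le_one_left (Real.exp_pos _).le ?_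
  rw [div_le_one (by positivity), Real.one_le_sqrt]
  linarith [Real.pi_gt_three]

theorem gaussDensity_le_one (x : ℝ) : gaussDensity x ≤ 1 := by
  refine (gaussDensity_le_exp x).trans (Real.exp_le_one_iff.2 ?_)
  have := sq_nonneg x
  linarith

theorem abs_mul_gaussDensity_le_one (x : ℝ) : |x| * gaussDensity x ≤ 1 := by
  have h1 : |x| ≤ Real.exp (x ^ 2 / 2) := by
    have h2 := Real.add_one_le_exp (x ^ 2 / 2)
    have h3 : |x| ≤ x ^ 2 / 2 + 1 := by
      rw [← sq_abs x]
      nlinarith [sq_nonneg (|x| - 1)]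
    linarith
  calc |x| * gaussDensity x ≤ Real.exp (x ^ 2 / 2) * Real.exp (-x ^ 2 / 2) :=
        mul_le_mul h1 (gaussDensity_le_exp x) (gaussDensity_nonneg x) (Real.exp_pos _).le
    _ = 1 := by
        rw [← Real.exp_add]
        simp [neg_div]

theorem hasDerivAt_gaussDensity (x : ℝ) : HasDerivAt gaussDensity (-(x * gaussDensity x)) x := by
  have h1 : HasDerivAt (fun x : ℝ => -x ^ 2 / 2) (-x) x := by
    refine ((hasDerivAt_pow 2 x).fun_neg.div_const 2).congr_deriv ?_
    simp
    ring
  refine (h1.exp.const_mul (1 / Real.sqrt (2 * Real.pi))).congr_deriv ?_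
  rw [gaussDensity]
  ring

theorem continuous_gaussDensity : Continuous gaussDensity :=
  continuous_iff_continuousAt.2 fun x => (hasDerivAt_gaussDensity x).continuousAt

theorem integrable_gaussDensity : Integrable gaussDensity := by
  rw [gaussDensity_eq]
  exact integrable_gaussianPDFReal 0 1

theorem integrable_mul_gaussDensity : Integrable fun x => x * gaussDensity x := by
  have := (integrable_mul_exp_neg_mul_sq (b := 1 / 2) (by norm_num)).const_mul
    (1 / Real.sqrt (2 * Real.pi))
  refine this.congr (Filter.Eventually.of_forall fun x => ?_)
  simp only [gaussDensity]
  rw [show -(1 / 2) * x ^ 2 = -x ^ 2 / 2 by ring]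
  ring

theorem tendsto_gaussDensity {l : Filter ℝ} (hl : Filter.Tendsto (fun x : ℝ => |x|) l Filter.atTop) :
    Filter.Tendsto gaussDensity l (nhds 0) := by
  have h1 : Filter.Tendsto (fun x : ℝ => |x|⁻¹) l (nhds 0) := tendsto_inv_atTop_zero.comp hl
  refine squeeze_zero' (Filter.Eventually.of_forall gaussDensity_nonneg) ?_ h1
  filter_upwards [hl.eventually_gt_atTop 0] with x hx
  rw [← one_div, le_div_iff₀ hx, mul_comm]
  exact abs_mul_gaussDensity_le_one x

theorem integral_gaussianReal_eq {E : Type*} [NormedAddCommGroup E] [NormedSpace ℝ E]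
    (f : ℝ → E) : ∫ x, f x ∂gaussianReal 0 1 = ∫ x, gaussDensity x • f x := by
  rw [integral_gaussianReal_eq_integral_smul one_ne_zero, gaussDensity_eq]

theorem Phi_eq (z : ℝ) : Phi z = ∫ a in Set.Iic z, gaussDensity a := by
  rw [Phi, cdf_eq_real, measureReal_def, gaussianReal_apply_eq_integral 0 one_ne_zero,
    ← gaussDensity_eq, ENNReal.toReal_ofReal]
  exact setIntegral_nonneg measurableSet_Iic fun x _ => gaussDensity_nonneg x

theorem integral_Iic_mul_gaussDensity (z : ℝ) :
    ∫ a in Set.Iic z, a * gaussDensity a = -gaussDensity z := by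
  have h := integral_Iic_of_hasDerivAt_of_tendsto' (a := z) (f := fun a => -gaussDensity a)
    (f' := fun a => a * gaussDensity a) (m := -0)
    (fun x _ => by simpa using (hasDerivAt_gaussDensity x).fun_neg)
    integrable_mul_gaussDensity.integrableOn
    (tendsto_gaussDensity Filter.tendsto_abs_atBot_atTop).neg
  simpa using h

/-- The first order Edgeworth-type approximation `Φ - c φ`. -/
noncomputable def edgeworth (c z : ℝ) : ℝ := Phi z - c * gaussDensity z

theorem integrable_edgeworth_density (c : ℝ) :
    Integrable fun a => (1 + c * a) * gaussDensity a := by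
  refine (integrable_gaussDensity.add (integrable_mul_gaussDensity.const_mul c)).congr
    (Filter.Eventually.of_forall fun x => ?_)
  simp only [Pi.add_apply]
  ring

/-- As φ' = -xφ, the correction -cφ has density c a φ(a); the approximation is a signed measure with
density 1 + c a relative to the Gaussian. -/
theorem edgeworth_eq (c z : ℝ) :
    edgeworth c z = ∫ a in Set.Iic z, (1 + c * a) * gaussDensity a := by
  have h1 : ∀ a, (1 + c * a) * gaussDensity a = gaussDensity a + c * (a * gaussDensity a) :=
    fun a => by ring
  simp_rw [h1]
  rw [integral_add integrable_gaussDensity.integrableOn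
    (integrable_mul_gaussDensity.const_mul c).integrableOn, integral_const_mul,
    integral_Iic_mul_gaussDensity, ← Phi_eq, edgeworth]
  ring

theorem edgeworth_sub_le (c : ℝ) {z z' : ℝ} (h : z ≤ z') :
    edgeworth c z' - edgeworth c z ≤ (1 + |c|) * (z' - z) := by
  have hi := integrable_edgeworth_density c
  rw [edgeworth_eq, edgeworth_eq,
    intervalIntegral.integral_Iic_sub_Iic hi.integrableOn hi.integrableOn]
  refine (le_abs_self _).trans ?_
  have := intervalIntegral.norm_integral_le_of_norm_le_const (a := z) (b := z') (C := 1 + |c|)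
    (f := fun a => (1 + c * a) * gaussDensity a) fun a _ => ?_
  · rwa [abs_of_nonneg (by linarith : (0 : ℝ) ≤ z' - z)] at this
  · have h1 := gaussDensity_le_one a
    have h2 := abs_mul_gaussDensity_le_one a
    have h3 := gaussDensity_nonneg a
    rw [Real.norm_eq_abs, abs_mul, abs_of_nonneg h3]
    calc |1 + c * a| * gaussDensity a ≤ (1 + |c| * |a|) * gaussDensity a := by
          refine mul_le_mul_of_nonneg_right ((abs_add_le _ _).trans ?_) h3
          rw [abs_one, abs_mul]
      _ = gaussDensity a + |c| * (|a| * gaussDensity a) := by ring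
      _ ≤ 1 + |c| * 1 := by gcongr
      _ = _ := by ring

theorem abs_edgeworth_le (c z : ℝ) : |edgeworth c z| ≤ 1 + |c| := by
  have h0 : 0 ≤ Phi z := cdf_nonneg _ _
  have h1 : Phi z ≤ 1 := cdf_le_one _ _
  rw [edgeworth]
  refine (abs_sub _ _).trans (add_le_add ?_ ?_)
  · rwa [abs_of_nonneg h0]
  · rw [abs_mul, abs_of_nonneg (gaussDensity_nonneg z)]
    exact mul_le_of_le_one_right (abs_nonneg _) (gaussDensity_le_one z)

theorem norm_cexp_mul_mul_I (t x : ℝ) : ‖Complex.exp (t * x * Complex.I)‖ = 1 := by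
  rw [← Complex.ofReal_mul, Complex.norm_exp_ofReal_mul_I]

theorem integrable_smul_cexp {f : ℝ → ℝ} (hf : Integrable f) (t : ℝ) :
    Integrable fun x : ℝ => (f x : ℂ) * Complex.exp (t * x * Complex.I) := by
  refine hf.ofReal.mul_bdd (c := 1) (Measurable.aestronglyMeasurable (by fun_prop))
    (Filter.Eventually.of_forall fun x => ?_)
  exact (norm_cexp_mul_mul_I t x).le

theorem integral_gaussDensity_cexp (t : ℝ) :
    ∫ x : ℝ, (gaussDensity x : ℂ) * Complex.exp (t * x * Complex.I)
      = Complex.exp (-(t ^ 2 / 2)) := by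
  have h := charFun_gaussianReal (μ := 0) (v := 1) t
  rw [charFun_apply_real, integral_gaussianReal_eq] at h
  simp only [Complex.real_smul] at h
  rw [h]
  congr 1
  push_cast
  ring

theorem integral_mul_gaussDensity_cexp (t : ℝ) :
    ∫ x : ℝ, ((x * gaussDensity x : ℝ) : ℂ) * Complex.exp (t * x * Complex.I)
      = t * Complex.I * Complex.exp (-(t ^ 2 / 2)) := by
  have hder : ∀ x : ℝ, HasDerivAt
      (fun x : ℝ => (gaussDensity x : ℂ) * Complex.exp (t * x * Complex.I))
      (t * Complex.I * ((gaussDensity x : ℂ) * Complex.exp (t * x * Complex.I))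
        - ((x * gaussDensity x : ℝ) : ℂ) * Complex.exp (t * x * Complex.I)) x := by
    intro x
    have h1 : HasDerivAt (fun x : ℝ => (t : ℂ) * x * Complex.I) (t * Complex.I) x := by
      simpa using ((hasDerivAt_id x).ofReal_comp.const_mul (t : ℂ)).mul_const Complex.I
    refine ((hasDerivAt_gaussDensity x).ofReal_comp.mul h1.cexp).congr_deriv ?_
    push_cast
    ring
  have hlim : ∀ l : Filter ℝ, Filter.Tendsto (fun x : ℝ => |x|) l Filter.atTop →
      Filter.Tendsto (fun x : ℝ => (gaussDensity x : ℂ) * Complex.exp (t * x * Complex.I)) l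
        (nhds 0) := by
    intro l hl
    rw [tendsto_zero_iff_norm_tendsto_zero]
    refine (tendsto_gaussDensity hl).congr fun x => ?_
    rw [norm_mul, norm_cexp_mul_mul_I, mul_one, Complex.norm_real,
      Real.norm_of_nonneg (gaussDensity_nonneg x)]
  have hi1 := (integrable_smul_cexp integrable_gaussDensity t).const_mul (t * Complex.I)
  have hi2 := integrable_smul_cexp integrable_mul_gaussDensity t
  have h := integral_of_hasDerivAt_of_tendsto hder (hi1.sub hi2)
    (hlim _ Filter.tendsto_abs_atBot_atTop) (hlim _ Filter.tendsto_abs_atTop_atTop)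
  rw [integral_sub hi1 hi2, integral_const_mul, integral_gaussDensity_cexp, sub_zero,
    sub_eq_zero] at h
  exact h.symm

theorem integral_edgeworth_cexp (c t : ℝ) :
    ∫ x, ((1 + c * x : ℝ) : ℂ) * Complex.exp (t * x * Complex.I) ∂gaussianReal 0 1
      = Complex.exp (-(t ^ 2 / 2)) * (1 + c * t * Complex.I) := by
  rw [integral_gaussianReal_eq]
  have h1 : ∀ x : ℝ, gaussDensity x • (((1 + c * x : ℝ) : ℂ) * Complex.exp (t * x * Complex.I))
      = (gaussDensity x : ℂ) * Complex.exp (t * x * Complex.I)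
        + c * (((x * gaussDensity x : ℝ) : ℂ) * Complex.exp (t * x * Complex.I)) := by
    intro x
    rw [Complex.real_smul]
    push_cast
    ring
  simp_rw [h1]
  rw [integral_add (integrable_smul_cexp integrable_gaussDensity t)
    ((integrable_smul_cexp integrable_mul_gaussDensity t).const_mul _), integral_const_mul,
    integral_gaussDensity_cexp, integral_mul_gaussDensity_cexp]
  ring

/-- The scaled difference between a discrete distribution function and `edgeworth c`. -/
noncomputable def cdfDiff {ι : Type*} [Fintype ι] (w X : ι → ℝ) (c T x : ℝ) : ℝ :=
  (∑ i, if T * X i < x then w i else 0) - edgeworth c (x / T)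

variable {ι : Type*} [Fintype ι] {w X : ι → ℝ} {c T : ℝ}

theorem edgeworth_eq_integral_ite (c : ℝ) {T : ℝ} (hT : 0 < T) (x : ℝ) :
    edgeworth c (x / T) = ∫ a, (if T * a < x then 1 + c * a else 0) ∂gaussianReal 0 1 := by
  rw [edgeworth_eq, integral_gaussianReal_eq, integral_Iic_eq_integral_Iio,
    ← integral_indicator measurableSet_Iio]
  refine integral_congr_ae (Filter.Eventually.of_forall fun a => ?_)
  simp only [Set.indicator, Set.mem_Iio, lt_div_iff₀ hT, mul_comm a T]
  split_ifs
  · rw [smul_eq_mul, mul_comm]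
  · rw [smul_zero]

/-- Both measures have total mass 1, so the half-mass terms cancel and only the difference of
characteristic functions remains. Scaling the variables by T moves the frequency range (0, 1] to (0,
T]; the weight 1 - t is bounded by 1. -/
theorem abs_integral_cdfDiff_mul_fejer_le (hw1 : ∑ i, w i = 1) (hT : 0 < T) {b : ℝ → ℝ}
    (hb : IntegrableOn b (Set.Ioc 0 T))
    (hfg : ∀ t ∈ Set.Ioc 0 T, ‖∑ i, w i * Complex.exp (t * X i * Complex.I)
      - Complex.exp (-(t ^ 2 / 2)) * (1 + c * t * Complex.I)‖ ≤ t * b t) (x : ℝ) :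
    |∫ y, cdfDiff w X c T (x - y) * fejer y| ≤ ∫ t in Set.Ioc 0 T, b t := by
  let _ : MeasurableSpace ι := ⊤
  have hv : Integrable (fun a : ℝ => 1 + c * a) (gaussianReal 0 1) := by
    have h1 : Integrable (fun a : ℝ => a) (gaussianReal 0 1) :=
      (memLp_id_gaussianReal 1).integrable (by norm_num)
    exact (integrable_const 1).add (h1.const_mul c)
  have hvX : Integrable (fun a : ℝ => (1 + c * a) * (T * a)) (gaussianReal 0 1) := by
    have h1 : Integrable (fun a : ℝ => a) (gaussianReal 0 1) :=
      (memLp_id_gaussianReal 1).integrable (by norm_num)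
    have h2 : Integrable (fun a : ℝ => a ^ 2) (gaussianReal 0 1) :=
      (memLp_id_gaussianReal 2).integrable_sq
    refine ((h1.const_mul T).add (h2.const_mul (c * T))).congr
      (Filter.Eventually.of_forall fun a => ?_)
    simp only [Pi.add_apply]
    ring
  have hv1 : ∫ a, (1 + c * a) ∂gaussianReal 0 1 = 1 := by
    have := integral_edgeworth_cexp c 0
    simp only [Complex.ofReal_zero, zero_mul, Complex.exp_zero, mul_one, mul_zero] at this
    rw [integral_complex_ofReal] at this
    simpa using this
  have hwi : Integrable w Measure.count := Integrable.of_finite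
  have hwXi : Integrable (fun i => w i * (T * X i)) Measure.count := Integrable.of_finite
  have hXm : Measurable fun i => T * X i := Measurable.of_discrete
  have hTm : Measurable fun a : ℝ => T * a := by fun_prop
  have eA := integral_mul_fejer hwi hXm hwXi x
  have eB := integral_mul_fejer hv hTm hvX x
  have iA := (integrable_sinc_kernel hwi hXm hwXi x).integral_prod_left
  have iB := (integrable_sinc_kernel hv hTm hvX x).integral_prod_left
  simp only [Function.uncurry] at iA iB
  rw [hv1] at eB
  rw [integral_count, hw1] at eA
  have hsplit : ∫ y, cdfDiff w X c T (x - y) * fejer y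
      = ∫ t in (0 : ℝ)..1,
        ((∫ i, (1 - t) * (w i * ((x - T * X i) * Real.sinc (t * (x - T * X i)))) ∂Measure.count)
        - ∫ a, (1 - t) * ((1 + c * a) * ((x - T * a) * Real.sinc (t * (x - T * a))))
          ∂gaussianReal 0 1) := by
    rw [intervalIntegral.integral_sub (intervalIntegrable_iff.2 iA) (intervalIntegrable_iff.2 iB)]
    have hcd : ∀ z y, cdfDiff w X c T z * fejer y
        = (∫ i, (if T * X i < z then w i else 0) ∂Measure.count) * fejer y
        - (∫ a, (if T * a < z then 1 + c * a else 0) ∂gaussianReal 0 1) * fejer y := by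
      intro z y
      rw [cdfDiff, sub_mul, edgeworth_eq_integral_ite c hT, integral_count]
    have kA := (integrable_ite_kernel hwi hXm x).integral_prod_left
    have kB := (integrable_ite_kernel hv hTm x).integral_prod_left
    simp only [Function.uncurry, integral_mul_const] at kA kB
    simp_rw [hcd]
    rw [integral_sub kA kB, eA, eB, add_sub_add_left_eq_sub]
  rw [hsplit, ← Real.norm_eq_abs]
  have hbT : IntervalIntegrable (fun t => T * b (t * T)) volume 0 1 := by
    have h1 : IntervalIntegrable b volume 0 T :=
      (intervalIntegrable_iff_integrableOn_Ioc_of_le hT.le).2 hb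
    have h2 := (h1.comp_mul_right (c := T)).const_mul T
    simpa [hT.ne'] using h2
  refine (intervalIntegral.norm_integral_le_of_norm_le (g := fun t => T * b (t * T)) zero_le_one
    (Filter.Eventually.of_forall fun t ht => ?_) hbT).trans (le_of_eq ?_)
  · have ht' : t * T ∈ Set.Ioc 0 T :=
      ⟨mul_pos ht.1 hT, mul_le_of_le_one_left hT.le ht.2⟩
    have h1 := hfg _ ht'
    rw [integral_const_mul, integral_const_mul, integral_mul_sinc hwi hXm x ht.1,
      integral_mul_sinc hv hTm x ht.1, ← mul_sub, ← sub_div,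
      norm_mul, norm_div, Real.norm_of_nonneg ht.1.le, Real.norm_eq_abs, Real.norm_eq_abs,
      abs_of_nonneg (sub_nonneg.2 ht.2)]
    have h2 : ∀ u : ℝ, (t : ℂ) * ((T * u : ℝ) : ℂ) * Complex.I
        = ((t * T : ℝ) : ℂ) * u * Complex.I := by
      intro u
      push_cast
      ring
    simp only [h2]
    rw [integral_edgeworth_cexp, integral_count, neg_sub_neg, ← Complex.sub_im, ← mul_sub]
    have h3 : ∀ z : ℂ, |(Complex.exp (-(t * x * Complex.I)) * z).im| ≤ ‖z‖ := by
      intro z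
      refine (Complex.abs_im_le_norm _).trans (le_of_eq ?_)
      rw [norm_mul, Complex.norm_exp]
      simp
    have h4 := (h3 (Complex.exp (-(((t * T : ℝ) : ℂ) ^ 2 / 2)) *
      (1 + c * ((t * T : ℝ) : ℂ) * Complex.I)
      - ∑ i, w i * Complex.exp (((t * T : ℝ) : ℂ) * X i * Complex.I))).trans
      ((norm_sub_rev _ _).le.trans h1)
    refine (mul_le_of_le_one_left (div_nonneg (abs_nonneg _) ht.1.le) (by linarith [ht.1])).trans ?_
    rw [div_le_iff₀ ht.1]
    refine h4.trans (le_of_eq ?_)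
    ring
  · rw [intervalIntegral.integral_const_mul, ← intervalIntegral.integral_of_le hT.le]
    have := intervalIntegral.integral_comp_mul_right (a := 0) (b := 1) b hT.ne'
    rw [this]
    simp [hT.ne']

/-- The discrete distribution function increases and the approximation has slope at most 1 + |c|, so
after scaling by T the difference decreases at rate at most (1 + |c|)/T. -/
theorem exists_esseen_inequality : ∃ K : ℝ, 0 < K ∧ ∀ (ι : Type) [Fintype ι] (w X : ι → ℝ)
    (c T : ℝ) (b : ℝ → ℝ), (∀ i, 0 ≤ w i) → ∑ i, w i = 1 → 0 < T →
    IntegrableOn b (Set.Ioc 0 T) →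
    (∀ t ∈ Set.Ioc 0 T, ‖∑ i, w i * Complex.exp (t * X i * Complex.I)
      - Complex.exp (-(t ^ 2 / 2)) * (1 + c * t * Complex.I)‖ ≤ t * b t) →
    ∀ x, |(∑ i, if X i < x then w i else 0) - edgeworth c x|
      ≤ K * ((∫ t in Set.Ioc 0 T, b t) + (1 + |c|) / T) := by
  obtain ⟨K, hK, h⟩ := exists_smoothing_inequality
  refine ⟨K, hK, fun ι _ w X c T b hw hw1 hT hb hfg x => ?_⟩
  have hmono : Monotone fun x => ∑ i, if T * X i < x then w i else 0 := by
    intro x y hxy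
    refine Finset.sum_le_sum fun i _ => ?_
    split_ifs with h1 h2
    · exact le_rfl
    · exact absurd (h1.trans_le hxy) h2
    · exact hw i
    · exact le_rfl
  have hmeas : Measurable (edgeworth c) := by
    have h1 : Measurable Phi := (cdf _).mono.measurable
    exact h1.sub (continuous_gaussDensity.measurable.const_mul c)
  have h1 := h (cdfDiff w X c T) ((1 + |c|) / T) (∫ t in Set.Ioc 0 T, b t) ?_ (by positivity)
    (fun x u hu => ?_) ⟨1 + (1 + |c|), fun x => ?_⟩
    (abs_integral_cdfDiff_mul_fejer_le hw1 hT hb hfg) (T * x)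
  · simpa [cdfDiff, hT.ne', hT] using h1
  · exact hmono.measurable.sub (hmeas.comp (by fun_prop))
  · have h1 := hmono (by linarith : x ≤ x + u)
    have h2 := edgeworth_sub_le c (z := x / T) (z' := (x + u) / T) (by gcongr; linarith)
    have h3 : (1 + |c|) * ((x + u) / T - x / T) = (1 + |c|) / T * u := by
      field_simp
      ring
    simp only [cdfDiff] at h1 ⊢
    linarith
  · refine (abs_sub _ _).trans (add_le_add ?_ (abs_edgeworth_le _ _))
    rw [abs_of_nonneg (Finset.sum_nonneg fun i _ => by split_ifs; exacts [hw i, le_rfl]), ← hw1]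
    refine Finset.sum_le_sum fun i _ => ?_
    split_ifs
    exacts [le_rfl, hw i]

end Esseen
end RandPerm

namespace RandPerm

/-! ### Weighted sums of |ĥ(i)|/i bounded by L_{n,p}^{1/p}. -/

section Hoelder

open Finset

theorem sum_rpow_sub_one_le {a : ℝ} (ha0 : 0 < a) (ha1 : a ≤ 1) (m : ℕ) :
    ∑ i ∈ Icc 1 m, (i : ℝ) ^ (a - 1) ≤ (m : ℝ) ^ a / a := by
  induction m with
  | zero => simp [Real.zero_rpow ha0.ne']
  | succ m ih =>
    rw [Finset.sum_Icc_succ_top (by omega)]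
    refine (add_le_add_left ih _).trans ?_
    have hm : (0 : ℝ) < ((m + 1 : ℕ) : ℝ) := by positivity
    have h1 := rpow_one_add_le_one_add_mul_self (s := -(1 / ((m + 1 : ℕ) : ℝ))) (p := a)
      (by
        rw [neg_le_neg_iff, div_le_one hm]
        push_cast
        linarith [(m.cast_nonneg : (0 : ℝ) ≤ m)]) ha0.le ha1
    have h2 : (1 : ℝ) + -(1 / ((m + 1 : ℕ) : ℝ)) = m / ((m + 1 : ℕ) : ℝ) := by
      push_cast
      field_simp
      ring
    rw [h2, Real.div_rpow m.cast_nonneg hm.le, div_le_iff₀ (Real.rpow_pos_of_pos hm a)] at h1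
    rw [Real.rpow_sub_one hm.ne', ← sub_nonneg]
    have h3 : 0 ≤ ((1 + a * -(1 / ((m + 1 : ℕ) : ℝ))) * ((m + 1 : ℕ) : ℝ) ^ a - (m : ℝ) ^ a) / a :=
      div_nonneg (sub_nonneg.2 h1) ha0.le
    refine h3.trans (le_of_eq ?_)
    field_simp
    ring

theorem sum_div_rpow_le {a : ℝ} (ha0 : 0 < a) (ha1 : a ≤ 1) {m : ℕ} (hm : 1 ≤ m) :
    ∑ i ∈ Icc 1 m, 1 / (i : ℝ) * ((i : ℝ) / m) ^ a ≤ 1 / a := by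
  have hm0 : (0 : ℝ) < m := by exact_mod_cast hm
  have h1 : ∑ i ∈ Icc 1 m, 1 / (i : ℝ) * ((i : ℝ) / m) ^ a
      = ((m : ℝ) ^ a)⁻¹ * ∑ i ∈ Icc 1 m, (i : ℝ) ^ (a - 1) := by
    rw [Finset.mul_sum]
    refine Finset.sum_congr rfl fun i hi => ?_
    have hi0 : (0 : ℝ) < i := by exact_mod_cast (Finset.mem_Icc.1 hi).1
    rw [Real.div_rpow hi0.le hm0.le, Real.rpow_sub_one hi0.ne']
    field_simp
  have h2 := mul_le_mul_of_nonneg_left (sum_rpow_sub_one_le ha0 ha1 m)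
    (inv_nonneg.2 (Real.rpow_nonneg hm0.le a))
  rw [h1]
  refine h2.trans (le_of_eq ?_)
  have := (Real.rpow_pos_of_pos hm0 a).ne'
  field_simp

theorem sum_growth_le {b : ℝ} (hb0 : 0 ≤ b) (hb1 : b < 1) {m : ℕ} (hm : 1 ≤ m) :
    ∑ i ∈ Icc 1 m, growth m b (m - i) ≤ 2 / (1 - b) * m := by
  have hm0 : (0 : ℝ) < m := by exact_mod_cast hm
  have hb' : 0 < 1 - b := by linarith
  have h1 : ∑ i ∈ Icc 1 m, growth m b (m - i)
      = (m + 1 : ℝ) ^ b * ∑ i ∈ Icc 1 m, (i : ℝ) ^ ((1 - b) - 1) := by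
    rw [sum_Icc_reflect (growth m b), sum_Icc_one_eq_sum_range, Finset.mul_sum]
    refine Finset.sum_congr rfl fun i _ => ?_
    rw [growth, Real.div_rpow (by positivity) (by positivity), sub_sub_cancel_left,
      Real.rpow_neg (by positivity), div_eq_mul_inv]
    push_cast
    rfl
  rw [h1]
  have h2 : (m + 1 : ℝ) ^ b ≤ 2 * (m : ℝ) ^ b := by
    calc (m + 1 : ℝ) ^ b ≤ (2 * m : ℝ) ^ b := by
          refine Real.rpow_le_rpow (by positivity) ?_ hb0
          have : (1 : ℝ) ≤ m := by exact_mod_cast hm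
          linarith
      _ = 2 ^ b * (m : ℝ) ^ b := Real.mul_rpow (by norm_num) hm0.le
      _ ≤ 2 * (m : ℝ) ^ b := by
          refine mul_le_mul_of_nonneg_right ?_ (Real.rpow_nonneg hm0.le b)
          calc (2 : ℝ) ^ b ≤ 2 ^ (1 : ℝ) :=
                Real.rpow_le_rpow_of_exponent_le (by norm_num) hb1.le
            _ = 2 := Real.rpow_one 2
  calc (m + 1 : ℝ) ^ b * ∑ i ∈ Icc 1 m, (i : ℝ) ^ ((1 - b) - 1)
      ≤ 2 * (m : ℝ) ^ b * ((m : ℝ) ^ (1 - b) / (1 - b)) :=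
        mul_le_mul h2 (sum_rpow_sub_one_le hb' (by linarith) m)
          (Finset.sum_nonneg fun i _ => by positivity) (by positivity)
    _ = 2 / (1 - b) * ((m : ℝ) ^ b * (m : ℝ) ^ (1 - b)) := by ring
    _ = _ := by
        rw [← Real.rpow_add hm0]
        norm_num

/-- For i ≤ m/2 the growth factor is at most 2 and (i/m)^a makes ∑ 1/i converge. For i > m/2 one has
1/i ≤ 2/m, and b < 1 makes the singularity at i = m summable. -/
theorem sum_inv_mul_growth_le {a b : ℝ} (ha0 : 0 < a) (ha1 : a ≤ 1) (hb0 : 0 ≤ b) (hb1 : b < 1)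
    {m : ℕ} (hm : 1 ≤ m) :
    ∑ i ∈ Icc 1 m, 1 / (i : ℝ) * (((i : ℝ) / m) ^ a * growth m b (m - i))
      ≤ 2 / a + 4 / (1 - b) := by
  have hm0 : (0 : ℝ) < m := by exact_mod_cast hm
  have hterm : ∀ i ∈ Icc 1 m, 1 / (i : ℝ) * (((i : ℝ) / m) ^ a * growth m b (m - i))
      ≤ 2 * (1 / (i : ℝ) * ((i : ℝ) / m) ^ a) + 2 / m * growth m b (m - i) := by
    intro i hi
    rw [Finset.mem_Icc] at hi
    have hi0 : (0 : ℝ) < i := by exact_mod_cast hi.1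
    have him : (i : ℝ) ≤ m := by exact_mod_cast hi.2
    have hG := growth_pos m b (m - i)
    have hR : 0 ≤ ((i : ℝ) / m) ^ a := by positivity
    have hR1 : ((i : ℝ) / m) ^ a ≤ 1 :=
      Real.rpow_le_one (by positivity) ((div_le_one hm0).2 him) ha0.le
    by_cases h : 2 * i ≤ m
    · have h1 : growth m b (m - i) ≤ 2 := by
        have h2 : ((m : ℝ) + 1) / ((m - i : ℕ) + 1) ≤ 2 := by
          rw [div_le_iff₀ (by positivity), Nat.cast_sub hi.2]
          have : (2 : ℝ) * i ≤ m := by exact_mod_cast h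
          linarith
        calc growth m b (m - i) ≤ growth m 1 (m - i) := growth_mono (Nat.sub_le _ _) hb1.le
          _ ≤ 2 := by rw [growth, Real.rpow_one]; exact h2
      calc 1 / (i : ℝ) * (((i : ℝ) / m) ^ a * growth m b (m - i))
          ≤ 1 / (i : ℝ) * (((i : ℝ) / m) ^ a * 2) := by gcongr
        _ = 2 * (1 / (i : ℝ) * ((i : ℝ) / m) ^ a) := by ring
        _ ≤ _ := le_add_of_nonneg_right (by positivity)
    · have h1 : 1 / (i : ℝ) ≤ 2 / m := by
        rw [div_le_div_iff₀ hi0 hm0]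
        have : (m : ℝ) ≤ 2 * i := by exact_mod_cast (by omega : m ≤ 2 * i)
        linarith
      calc 1 / (i : ℝ) * (((i : ℝ) / m) ^ a * growth m b (m - i))
          ≤ 2 / m * (1 * growth m b (m - i)) := by gcongr
        _ = 2 / m * growth m b (m - i) := by ring
        _ ≤ _ := le_add_of_nonneg_left (by positivity)
  refine (Finset.sum_le_sum hterm).trans ?_
  rw [Finset.sum_add_distrib, ← Finset.mul_sum, ← Finset.mul_sum]
  have h1 := sum_div_rpow_le ha0 ha1 hm
  have h2 := mul_le_mul_of_nonneg_left (sum_growth_le hb0 hb1 hm) (by positivity : 0 ≤ 2 / (m : ℝ))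
  have h3 : 2 / (m : ℝ) * (2 / (1 - b) * m) = 4 / (1 - b) := by
    field_simp
    norm_num
  rw [h3] at h2
  refine (add_le_add (mul_le_mul_of_nonneg_left h1 zero_le_two) h2).trans (le_of_eq ?_)
  ring

theorem LRoot_nonneg (h : ℕ → ℝ) (n : ℕ) (p : ℝ≥0∞) : 0 ≤ LRoot h n p := by
  rw [LRoot]
  split_ifs
  · exact NNReal.coe_nonneg _
  · refine Real.rpow_nonneg (Finset.sum_nonneg fun k _ => ?_) _
    positivity

/-- Hölder with conjugate exponents r and q, the weight 1/i being divided as i^{-1/r} i^{-1/q}. The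
q-th power of the growth factor has exponent bq, and b < 1 - 1/r = 1/q is the condition for its sum
to stay bounded. -/
theorem exists_sum_abs_mul_growth_le {p : ℝ≥0∞} (hp : 1 < p) {ε b : ℝ} (hε : 0 < ε)
    (hb0 : 0 ≤ b) (hb : b < 1 - 1 / p.toReal) :
    ∃ K : ℝ, 0 < K ∧ ∀ (h : ℕ → ℝ) (n m : ℕ), 1 ≤ m → m ≤ n →
      ∑ i ∈ Icc 1 m, |h i| / i * (((i : ℝ) / m) ^ ε * growth m b (m - i)) ≤ K * LRoot h n p := by
  by_cases htop : p = ∞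
  · have hb1 : b < 1 := by simpa [htop] using hb
    have ha0 : 0 < min ε 1 := lt_min hε one_pos
    have hb' : 0 < 1 - b := by linarith
    refine ⟨2 / min ε 1 + 4 / (1 - b), by positivity, fun h n m hm hmn => ?_⟩
    have hm0 : (0 : ℝ) < m := by exact_mod_cast hm
    refine le_trans ?_ (mul_le_mul_of_nonneg_right
      (sum_inv_mul_growth_le ha0 (min_le_right _ _) hb0 hb1 hm) (LRoot_nonneg h n p))
    rw [Finset.sum_mul]
    refine Finset.sum_le_sum fun i hi => ?_
    have hi' := Finset.mem_Icc.1 hi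
    have hi0 : (0 : ℝ) < i := by exact_mod_cast hi'.1
    have h1 : |h i| ≤ LRoot h n p := by
      rw [LRoot, if_pos htop, ← Real.norm_eq_abs, ← coe_nnnorm, NNReal.coe_le_coe]
      exact Finset.le_sup (f := fun j => ‖h j‖₊) (Finset.mem_Icc.2 ⟨hi'.1, hi'.2.trans hmn⟩)
    have h2 : ((i : ℝ) / m) ^ ε ≤ ((i : ℝ) / m) ^ min ε 1 :=
      Real.rpow_le_rpow_of_exponent_ge (by positivity)
        ((div_le_one hm0).2 (by exact_mod_cast hi'.2)) (min_le_left _ _)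
    have hG := growth_pos m b (m - i)
    have hL := LRoot_nonneg h n p
    calc |h i| / i * (((i : ℝ) / m) ^ ε * growth m b (m - i))
        ≤ LRoot h n p / i * (((i : ℝ) / m) ^ min ε 1 * growth m b (m - i)) := by gcongr
      _ = _ := by ring
  · set r := p.toReal with hr
    have hr1 : 1 < r := by
      have := (ENNReal.toReal_lt_toReal ENNReal.one_ne_top htop).2 hp
      simpa using this
    set q := Real.conjExponent r with hq
    have hrq : r.HolderConjugate q := Real.HolderConjugate.conjExponent hr1
    have hq0 : 0 < q := hrq.symm.pos
    have hqi : 1 - 1 / r = 1 / q := by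
      have := hrq.inv_add_inv_eq_one
      rw [one_div, one_div]
      linarith
    have hbq : b * q < 1 := by
      rw [hqi, lt_div_iff₀ hq0] at hb
      exact hb
    have hbq0 : 0 ≤ b * q := by positivity
    have hb' : 0 < 1 - b * q := by linarith
    have ha0 : 0 < min (ε * q) 1 := lt_min (by positivity) one_pos
    set S := 2 / min (ε * q) 1 + 4 / (1 - b * q) with hS
    have hS0 : 0 < S := by positivity
    refine ⟨S ^ (1 / q), by positivity, fun h n m hm hmn => ?_⟩
    have hm0 : (0 : ℝ) < m := by exact_mod_cast hm
    have key := Real.inner_le_Lp_mul_Lq_of_nonneg (Icc 1 m) hrq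
      (f := fun i : ℕ => |h i| / (i : ℝ) ^ (1 / r))
      (g := fun i : ℕ => ((i : ℝ) / m) ^ ε * growth m b (m - i) / (i : ℝ) ^ (1 / q))
      (fun i _ => by positivity)
      (fun i _ => div_nonneg (mul_nonneg (by positivity) (growth_pos _ _ _).le) (by positivity))
    have e1 : ∑ i ∈ Icc 1 m, |h i| / i * (((i : ℝ) / m) ^ ε * growth m b (m - i))
        = ∑ i ∈ Icc 1 m, |h i| / (i : ℝ) ^ (1 / r) *
          (((i : ℝ) / m) ^ ε * growth m b (m - i) / (i : ℝ) ^ (1 / q)) := by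
      refine Finset.sum_congr rfl fun i hi => ?_
      have hi0 : (0 : ℝ) < i := by exact_mod_cast (Finset.mem_Icc.1 hi).1
      have e2 : (i : ℝ) ^ (1 / r) * (i : ℝ) ^ (1 / q) = i := by
        rw [← Real.rpow_add hi0, ← hqi, add_sub_cancel, Real.rpow_one]
      rw [div_mul_div_comm, e2]
      ring
    rw [e1]
    refine key.trans ?_
    have hf : (∑ i ∈ Icc 1 m, (|h i| / (i : ℝ) ^ (1 / r)) ^ r) ^ (1 / r) ≤ LRoot h n p := by
      rw [LRoot, if_neg htop, ← hr]
      refine Real.rpow_le_rpow (Finset.sum_nonneg fun i _ => by positivity) ?_ (by positivity)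
      rw [L]
      refine (Finset.sum_le_sum_of_subset_of_nonneg (Finset.Icc_subset_Icc_right hmn)
        fun i _ _ => by positivity).trans (le_of_eq ?_)
      refine Finset.sum_congr rfl fun i _ => ?_
      rw [Real.div_rpow (abs_nonneg _) (by positivity), ← Real.rpow_mul i.cast_nonneg,
        one_div_mul_cancel (by positivity), Real.rpow_one]
    have hg : (∑ i ∈ Icc 1 m, (((i : ℝ) / m) ^ ε * growth m b (m - i) / (i : ℝ) ^ (1 / q)) ^ q)
        ^ (1 / q) ≤ S ^ (1 / q) := by
      refine Real.rpow_le_rpow (Finset.sum_nonneg fun i _ => Real.rpow_nonneg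
        (div_nonneg (mul_nonneg (by positivity) (growth_pos _ _ _).le) (by positivity)) _) ?_
        (by positivity)
      refine le_trans (Finset.sum_le_sum fun i hi => ?_)
        (sum_inv_mul_growth_le ha0 (min_le_right _ _) hbq0 hbq hm)
      have hi' := Finset.mem_Icc.1 hi
      have hi0 : (0 : ℝ) < i := by exact_mod_cast hi'.1
      have hG := growth_pos m b (m - i)
      rw [Real.div_rpow (by positivity) (by positivity), ← Real.rpow_mul i.cast_nonneg,
        one_div_mul_cancel (by positivity), Real.rpow_one, Real.mul_rpow (by positivity) hG.le,
        ← Real.rpow_mul (by positivity), growth, ← Real.rpow_mul (by positivity), ← growth,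
        one_div_mul_eq_div]
      have h2 : ((i : ℝ) / m) ^ (ε * q) ≤ ((i : ℝ) / m) ^ min (ε * q) 1 :=
        Real.rpow_le_rpow_of_exponent_ge (by positivity)
          ((div_le_one hm0).2 (by exact_mod_cast hi'.2)) (min_le_left _ _)
      have hG' := growth_pos m (b * q) (m - i)
      gcongr
    calc _ ≤ LRoot h n p * S ^ (1 / q) :=
          mul_le_mul hf hg (Real.rpow_nonneg (Finset.sum_nonneg fun i _ => Real.rpow_nonneg
            (div_nonneg (mul_nonneg (by positivity) (growth_pos _ _ _).le) (by positivity)) _) _)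
            (LRoot_nonneg h n p)
      _ = _ := mul_comm _ _

end Hoelder
end RandPerm

namespace RandPerm

/-! ### The coefficient system of the characteristic function. -/

section CharacteristicFunction

open Finset

theorem norm_cexp_mul_I_sub_one_le (u : ℝ) : ‖Complex.exp (u * Complex.I) - 1‖ ≤ |u| := by
  rw [mul_comm]
  exact Real.norm_exp_I_mul_ofReal_sub_one_le

theorem norm_mul_I (u : ℝ) : ‖(u : ℂ) * Complex.I‖ = |u| := by
  rw [norm_mul, Complex.norm_I, mul_one, Complex.norm_real, Real.norm_eq_abs]

theorem norm_cexp_mul_I_sub_two_terms_le (u : ℝ) :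
    ‖Complex.exp (u * Complex.I) - 1 - u * Complex.I‖ ≤ 4 * u ^ 2 := by
  rw [← sq_abs u]
  rcases le_or_gt |u| 1 with h | h
  · have h1 := Complex.norm_exp_sub_one_sub_id_le (x := u * Complex.I) (by rwa [norm_mul_I])
    rw [norm_mul_I] at h1
    nlinarith [sq_nonneg |u|]
  · have h1 : ‖Complex.exp (u * Complex.I) - 1 - u * Complex.I‖ ≤ |u| + |u| :=
      (norm_sub_le _ _).trans (add_le_add (norm_cexp_mul_I_sub_one_le u) (norm_mul_I u).le)
    nlinarith

theorem norm_cexp_mul_I_sub_three_terms_le (u : ℝ) :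
    ‖Complex.exp (u * Complex.I) - 1 - u * Complex.I + (u : ℂ) ^ 2 / 2‖ ≤ 5 * |u| ^ 3 := by
  have hu := abs_nonneg u
  rcases le_or_gt |u| 1 with h | h
  · have h1 := Complex.norm_exp_sub_sum_le_norm_mul_exp (u * Complex.I) 3
    rw [norm_mul_I] at h1
    have h2 : Complex.exp (u * Complex.I)
        - ∑ m ∈ range 3, ((u : ℂ) * Complex.I) ^ m / (m.factorial : ℂ)
        = Complex.exp (u * Complex.I) - 1 - u * Complex.I + (u : ℂ) ^ 2 / 2 := by
      simp [Finset.sum_range_succ, mul_pow, Nat.factorial]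
      ring
    rw [h2] at h1
    refine h1.trans ?_
    have h3 : Real.exp |u| ≤ 5 :=
      (Real.exp_le_exp.2 h).trans (by linarith [Real.exp_one_lt_d9])
    rw [mul_comm]
    gcongr
  · have h1 : ‖Complex.exp (u * Complex.I) - 1 - u * Complex.I + (u : ℂ) ^ 2 / 2‖
        ≤ 4 * u ^ 2 + u ^ 2 / 2 := by
      refine (norm_add_le _ _).trans (add_le_add (norm_cexp_mul_I_sub_two_terms_le u) ?_)
      rw [norm_div, norm_pow, Complex.norm_real, Real.norm_eq_abs, sq_abs]
      simp
    refine h1.trans ?_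
    rw [← sq_abs u]
    nlinarith [sq_nonneg |u|]

/-- The weights `d_i (e^{i t h_i} - 1) / i`. -/
noncomputable def charWeight (d h : ℕ → ℝ) (t : ℝ) (i : ℕ) : ℂ :=
  d i * (Complex.exp ((t * h i : ℝ) * Complex.I) - 1) / i

/-- The coefficients of the interpolated generating function. -/
noncomputable def charCoeff (d h : ℕ → ℝ) (t : ℝ) (k : ℕ) (s : ℝ) : ℂ :=
  expCoeff (fun i => (d i : ℂ) + s * (d i * (Complex.exp ((t * h i : ℝ) * Complex.I) - 1))) k

theorem charCoeff_eq_interp (d h : ℕ → ℝ) (t : ℝ) (k : ℕ) (s : ℝ) :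
    charCoeff d h t k s = expCoeff (fun i => d i * interp (fun i => t * h i) s i) k := by
  rw [charCoeff]
  congr 1
  funext i
  rw [interp]
  ring

theorem charCoeff_zero (d h : ℕ → ℝ) (t : ℝ) (k : ℕ) :
    charCoeff d h t k 0 = ((expCoeff d k : ℝ) : ℂ) := by
  rw [charCoeff, ← expCoeff_ofReal]
  simp

theorem charCoeff_one (d h : ℕ → ℝ) (t : ℝ) (k : ℕ) :
    charCoeff d h t k 1 = expCoeff (fun i => d i * Complex.exp ((t * h i : ℝ) * Complex.I)) k := by
  rw [charCoeff]
  congr 1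
  funext i
  push_cast
  ring

theorem norm_charWeight_le {dp : ℝ} {d h : ℕ → ℝ} {t : ℝ} {i : ℕ} (hd : 0 ≤ d i) (hdp : d i ≤ dp) :
    ‖charWeight d h t i‖ ≤ dp * |t| * (|h i| / i) := by
  rw [charWeight, norm_div, norm_mul, Complex.norm_real, Real.norm_of_nonneg hd,
    Complex.norm_natCast]
  have h1 := norm_cexp_mul_I_sub_one_le (t * h i)
  rw [abs_mul] at h1
  have hdp0 := hd.trans hdp
  calc d i * ‖Complex.exp ((t * h i : ℝ) * Complex.I) - 1‖ / i
      ≤ dp * (|t| * |h i|) / i := by gcongr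
    _ = _ := by ring

theorem L_three (h : ℕ → ℝ) (n : ℕ) : L h n 3 = ∑ i ∈ Icc 1 n, |h i| ^ 3 / i := by
  rw [L]
  refine Finset.sum_congr rfl fun i _ => ?_
  norm_cast

theorem L_three_nonneg (h : ℕ → ℝ) (n : ℕ) : 0 ≤ L h n 3 := by
  rw [L_three]
  exact Finset.sum_nonneg fun i _ => by positivity

theorem sum_abs_cube (h : ℕ → ℝ) (n : ℕ) (t : ℝ) :
    ∑ i ∈ Icc 1 n, |t * h i| ^ 3 / i = |t| ^ 3 * L h n 3 := by
  rw [L_three, Finset.mul_sum]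
  refine Finset.sum_congr rfl fun i _ => ?_
  rw [abs_mul]
  ring

theorem abs_cube_mul_le {t l η : ℝ} (h : |t| * l ≤ η) : |t| ^ 3 * l ≤ η * t ^ 2 := by
  have : |t| ^ 3 * l = |t| * l * t ^ 2 := by
    rw [← sq_abs t]
    ring
  rw [this]
  exact mul_le_mul_of_nonneg_right h (sq_nonneg t)

theorem sum_mul_sq_eq {d h : ℕ → ℝ} {n : ℕ} (hh : ∑ k ∈ Icc 1 n, d k * (h k ^ 2 / k) = 1)
    (t : ℝ) : ∑ i ∈ Icc 1 n, d i * ((t * h i) ^ 2 / i) = t ^ 2 := by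
  rw [← mul_one (t ^ 2), ← hh, Finset.mul_sum]
  exact Finset.sum_congr rfl fun i _ => by ring

theorem re_sum_charWeight_le {dp η : ℝ} {d h : ℕ → ℝ} {n : ℕ} {t : ℝ}
    (hd : ∀ i ∈ Icc 1 n, 0 ≤ d i ∧ d i ≤ dp) (hη : dp * η ≤ 1 / 8) (hdp : 0 ≤ dp)
    (hh : ∑ k ∈ Icc 1 n, d k * (h k ^ 2 / k) = 1) (ht : |t| * L h n 3 ≤ η) :
    (∑ i ∈ Icc 1 n, charWeight d h t i).re ≤ -(t ^ 2 / 8) := by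
  have h1 : ∀ i ∈ Icc 1 n, (charWeight d h t i).re
      ≤ dp * (|t * h i| ^ 3 / i) - 1 / 4 * (d i * ((t * h i) ^ 2 / i)) := by
    intro i hi
    have hi0 : (0 : ℝ) < i := by exact_mod_cast (Finset.mem_Icc.1 hi).1
    have h2 : charWeight d h t i
        = ((d i / i : ℝ) : ℂ) * (Complex.exp ((t * h i : ℝ) * Complex.I) - 1) := by
      rw [charWeight]
      push_cast
      ring
    rw [h2, Complex.re_ofReal_mul, Complex.sub_re, Complex.exp_ofReal_mul_I_re, Complex.one_re]
    have h3 := one_sub_cos_ge (t * h i)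
    have h4 : 0 ≤ d i / i := div_nonneg (hd i hi).1 hi0.le
    have h5 : d i / i * |t * h i| ^ 3 ≤ dp / i * |t * h i| ^ 3 := by
      have := (hd i hi).2
      gcongr
    have h6 := mul_le_mul_of_nonneg_left h3 h4
    calc d i / i * (Real.cos (t * h i) - 1) = -(d i / i * (1 - Real.cos (t * h i))) := by ring
      _ ≤ -(d i / i * ((t * h i) ^ 2 / 4 - |t * h i| ^ 3)) := neg_le_neg h6
      _ = d i / i * |t * h i| ^ 3 - 1 / 4 * (d i * ((t * h i) ^ 2 / i)) := by ring
      _ ≤ dp / i * |t * h i| ^ 3 - 1 / 4 * (d i * ((t * h i) ^ 2 / i)) := by linarith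
      _ = _ := by ring
  rw [Complex.re_sum]
  refine (Finset.sum_le_sum h1).trans ?_
  rw [Finset.sum_sub_distrib, ← Finset.mul_sum, ← Finset.mul_sum, sum_abs_cube, sum_mul_sq_eq hh]
  have h2 := mul_le_mul_of_nonneg_left (abs_cube_mul_le ht) hdp
  nlinarith [sq_nonneg t]

/-- Choice of all parameters. The restriction |t| L_{n,3} ≤ η makes the cubic sum of t ĥ(i) small
against its quadratic sum t², as the decay bound requires. -/
theorem exists_coeffSystem {dm dp : ℝ} (hdm : 0 < dm) (hdd : dm ≤ dp) {p : ℝ≥0∞}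
    (hp : ENNReal.ofReal (max 2 (1 / dm)) < p) :
    ∃ η κ K θ β H : ℝ, 0 < η ∧ dp * η ≤ 1 / 40 ∧ 0 < κ ∧ κ ≤ 1 / 8 ∧ 0 < H ∧
      (∀ (h : ℕ → ℝ) (n m : ℕ), 1 ≤ m → m ≤ n →
        ∑ i ∈ Icc 1 m, |h i| / i * (((i : ℝ) / m) ^ (θ / 2) * growth m (β + θ) (m - i))
          ≤ H * LRoot h n p) ∧
      ∀ (n : ℕ) (d h : ℕ → ℝ) (t : ℝ), 1 ≤ n → (∀ i ∈ Icc 1 n, dm ≤ d i ∧ d i ≤ dp) →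
        ∑ k ∈ Icc 1 n, d k * (h k ^ 2 / k) = 1 → |t| * L h n 3 ≤ η →
        CoeffSystem n (charWeight d h t) (charCoeff d h t) (expCoeff d n) K (κ * t ^ 2) θ β
          (dp * |t| * (H * LRoot h n p)) := by
  have hdp : 0 < dp := hdm.trans_le hdd
  have hp1 : 1 < p := by
    refine lt_of_le_of_lt ?_ hp
    rw [← ENNReal.ofReal_one]
    exact ENNReal.ofReal_le_ofReal ((by norm_num : (1 : ℝ) ≤ 2).trans (le_max_left _ _))
  have hγ : 0 < 1 - 1 / p.toReal - max 0 (1 - dm) := by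
    by_cases htop : p = ∞
    · simp [htop, hdm]
    · have h1 : max 2 (1 / dm) < p.toReal :=
        (ENNReal.ofReal_lt_iff_lt_toReal (by positivity) htop).1 hp
      have h2 := (le_max_left _ _).trans_lt h1
      have h3 := (le_max_right _ _).trans_lt h1
      have hr : 0 < p.toReal := by linarith
      have h4 : 1 / p.toReal < dm := by
        rw [div_lt_iff₀ hdm] at h3
        rw [div_lt_iff₀ hr]
        linarith
      have h5 : 1 / p.toReal < 1 := by
        rw [div_lt_one hr]
        linarith
      rcases max_cases 0 (1 - dm) with ⟨h6, _⟩ | ⟨h6, _⟩ <;> rw [h6] <;> linarith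
  set γ := 1 - 1 / p.toReal - max 0 (1 - dm) with hγdef
  have hγ1 : γ ≤ 1 := by
    have h1 : 0 ≤ 1 / p.toReal := by positivity
    have h2 := le_max_left 0 (1 - dm)
    linarith
  -- γ is the room between max(0, 1 - dm) and 1 - 1/p. With th = dm/4 one gets β + θ = max(0, 1 -
  -- dm) + (5/2) c0 dm, which exceeds its first term by at most 5γ/6 and so stays below 1 - 1/p.
  obtain ⟨c0, hc0, hc1, hc2⟩ : ∃ c0 : ℝ, 0 < c0 ∧ c0 ≤ 1 / 8 ∧ c0 * dm ≤ γ / 3 := by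
    refine ⟨min (1 / 8) (γ / (3 * dm)), by positivity, min_le_left _ _, ?_⟩
    calc min (1 / 8) (γ / (3 * dm)) * dm ≤ γ / (3 * dm) * dm :=
          mul_le_mul_of_nonneg_right (min_le_right _ _) hdm.le
      _ = γ / 3 := by field_simp
  have hcd : 0 < c0 * dm := mul_pos hc0 hdm
  set β := max 0 (1 - dm) + 2 * c0 * dm + c0 * (dm / 4) with hβ
  have hβ0 : 0 ≤ β := by positivity
  obtain ⟨η0, Cy, hη0, -, hdecay⟩ := exists_decay_interp hdm hdd
  obtain ⟨C, hC, hcoef⟩ := exists_coefficient_bounds (th := dm / 4) (Cy := Cy) (c0 := c0) (β := β)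
    hdm hdd hc0.le (by positivity) (by linarith) (by field_simp; linarith) hβ0
    (by have := le_max_right 0 (1 - dm); linarith)
  obtain ⟨H, hH, hhold⟩ := exists_sum_abs_mul_growth_le hp1 (ε := c0 * (dm / 4) / 2)
    (b := β + c0 * (dm / 4)) (by positivity) (by positivity) (by linarith)
  obtain ⟨C', hC', hlow⟩ := exp_harmSum_le_expCoeff hdm hdd
  -- κ = c0/16 joins the factor c0 of the coefficient bounds to the Gaussian gain s t²/16 of the
  -- decay. The bound 1/(40 dp) on η leaves room for both κ t² ≤ -Re Λ and the cubic Taylor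
  -- remainder.
  refine ⟨min η0 (1 / (40 * dp)), c0 / 16, max 1 C, c0 * (dm / 4), β, H, by positivity, ?_,
    by positivity, by linarith, hH, hhold, fun n d h t hn hd hh ht => ?_⟩
  · calc dp * min η0 (1 / (40 * dp)) ≤ dp * (1 / (40 * dp)) :=
          mul_le_mul_of_nonneg_left (min_le_right _ _) hdp.le
      _ = 1 / 40 := by field_simp
  have hd0 : ∀ i ∈ Icc 1 n, 0 ≤ d i := fun i hi => hdm.le.trans (hd i hi).1
  have hpn : 0 < expCoeff d n := by
    have h1 := (Real.exp_pos _).trans_le (hlow d n hd)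
    exact pos_of_mul_pos_right (pos_of_mul_pos_right h1 hC'.le) (by positivity)
  have hcub : ∑ i ∈ Icc 1 n, |t * h i| ^ 3 / i
      ≤ η0 * ∑ i ∈ Icc 1 n, d i * ((t * h i) ^ 2 / i) := by
    rw [sum_abs_cube, sum_mul_sq_eq hh]
    exact abs_cube_mul_le (ht.trans (min_le_left _ _))
  have hdec := hdecay d (fun i => t * h i) n hd hcub
  simp only [sum_mul_sq_eq hh] at hdec
  have hexp : ∀ s, -(c0 * (s * (t ^ 2 / 16))) = -(c0 / 16 * t ^ 2 * s) := fun s => by ring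
  refine ⟨hn, hpn, le_max_left _ _, by positivity, hβ0, ?_, fun k _ s => ?_,
    fun k hk s hs0 hs1 => ?_, fun k j hk s hs0 hs1 => ?_, ?_, fun m hm hmn => ?_⟩
  · exact charCoeff_zero d h t n
  · refine (hasDerivAt_expCoeff (fun i => (d i : ℂ))
      (fun i => d i * (Complex.exp ((t * h i : ℝ) * Complex.I) - 1)) k s).congr_deriv ?_
    rfl
  · rw [charCoeff_eq_interp]
    refine ((hcoef d _ n _ hn (hdec s hs0 hs1)).1 k hk).trans ?_
    rw [hexp, growth]
    have h1 := le_max_right 1 C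
    calc C * (expCoeff d n * ((n + 1 : ℝ) / (k + 1)) ^ β * Real.exp (-(c0 / 16 * t ^ 2 * s)))
        ≤ max 1 C * (expCoeff d n * ((n + 1 : ℝ) / (k + 1)) ^ β
          * Real.exp (-(c0 / 16 * t ^ 2 * s))) := by gcongr
      _ = _ := by ring
  · rw [charCoeff_eq_interp, charCoeff_eq_interp]
    refine ((hcoef d _ n _ hn (hdec s hs0 hs1)).2 k j hk).trans ?_
    rw [hexp, growth]
    have h1 := le_max_right 1 C
    calc C * (expCoeff d n * ((j : ℝ) / n) ^ (c0 * (dm / 4)) * ((n + 1 : ℝ) / (k + 1)) ^ β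
          * Real.exp (-(c0 / 16 * t ^ 2 * s)))
        ≤ max 1 C * (expCoeff d n * ((j : ℝ) / n) ^ (c0 * (dm / 4)) * ((n + 1 : ℝ) / (k + 1)) ^ β
          * Real.exp (-(c0 / 16 * t ^ 2 * s))) := by gcongr
      _ = _ := by ring
  · have h1 := re_sum_charWeight_le (dp := dp) (η := 1 / (40 * dp)) (t := t)
      (fun i hi => ⟨hd0 i hi, (hd i hi).2⟩) (by field_simp; norm_num) hdp.le hh
      (ht.trans (min_le_right _ _))
    nlinarith [sq_nonneg t]
  · refine le_trans ?_ (mul_le_mul_of_nonneg_left (hhold h n m hm hmn) (by positivity))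
    rw [Finset.mul_sum]
    refine Finset.sum_le_sum fun i hi => ?_
    have hi' : i ∈ Icc 1 n := Finset.Icc_subset_Icc_right hmn hi
    refine (mul_le_mul_of_nonneg_right (norm_charWeight_le (hd0 i hi') (hd i hi').2)
      (mul_nonneg (by positivity) (growth_pos _ _ _).le)).trans (le_of_eq ?_)
    ring

end CharacteristicFunction
end RandPerm

namespace RandPerm

/-! ### Expansion of the characteristic function. -/

section Edgeworth

open Finset

variable {dp : ℝ} {d h : ℕ → ℝ} {n : ℕ}

/-- The sum of the three error terms of the main estimate. -/
noncomputable def errorSize (d h : ℕ → ℝ) (n : ℕ) (p : ℝ≥0∞) : ℝ :=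
  L h n 3 + LRoot h n p ^ 2 + L2' d h n

theorem L2'_nonneg (d h : ℕ → ℝ) (n : ℕ) : 0 ≤ L2' d h n :=
  Finset.sum_nonneg fun i _ => by positivity

theorem norm_cexp_add_sub_cexp_le {x κ : ℝ} {R : ℂ} (hR : x + ‖R‖ ≤ -κ) :
    ‖Complex.exp (x + R) - Complex.exp x‖ ≤ ‖R‖ * Real.exp (-κ) := by
  have h1 := Complex.norm_exp_sub_sum_le_norm_mul_exp R 1
  simp only [Finset.range_one, Finset.sum_singleton, pow_zero, Nat.factorial_zero, Nat.cast_one,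
    div_one, pow_one] at h1
  have h2 : Complex.exp (x + R) - Complex.exp x = Complex.exp x * (Complex.exp R - 1) := by
    rw [Complex.exp_add]
    ring
  rw [h2, norm_mul, Complex.norm_exp, Complex.ofReal_re]
  calc Real.exp x * ‖Complex.exp R - 1‖ ≤ Real.exp x * (‖R‖ * Real.exp ‖R‖) :=
        mul_le_mul_of_nonneg_left h1 (Real.exp_pos _).le
    _ = ‖R‖ * Real.exp (x + ‖R‖) := by
        rw [Real.exp_add]
        ring
    _ ≤ _ := mul_le_mul_of_nonneg_left (Real.exp_le_exp.2 hR) (norm_nonneg _)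

theorem norm_sum_weighted_le (hd : ∀ i ∈ Icc 1 n, 0 ≤ d i ∧ d i ≤ dp) (hdp : 0 ≤ dp) {e : ℕ → ℂ}
    {v : ℕ → ℝ} (he : ∀ i, ‖e i‖ ≤ v i) :
    ‖∑ i ∈ Icc 1 n, ((d i / i : ℝ) : ℂ) * e i‖ ≤ dp * ∑ i ∈ Icc 1 n, v i / i := by
  refine (norm_sum_le _ _).trans ?_
  rw [Finset.mul_sum]
  refine Finset.sum_le_sum fun i hi => ?_
  have h1 := hd i hi
  rw [norm_mul, Complex.norm_real, Real.norm_of_nonneg (div_nonneg h1.1 i.cast_nonneg)]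
  calc d i / i * ‖e i‖ ≤ dp / i * v i :=
        mul_le_mul (div_le_div_of_nonneg_right h1.2 i.cast_nonneg) (he i) (norm_nonneg _)
          (div_nonneg hdp i.cast_nonneg)
    _ = _ := by ring

/-- By the normalisation, Λ - i t A(n) is -t²/2 plus a Taylor remainder R with |R| ≤ 5 dp |t|³
L_{n,3} ≤ t²/8, so the comparison still keeps Gaussian decay. -/
theorem norm_cexp_sum_charWeight_sub_le (hd : ∀ i ∈ Icc 1 n, 0 ≤ d i ∧ d i ≤ dp) (hdp : 0 ≤ dp)
    (hh : ∑ k ∈ Icc 1 n, d k * (h k ^ 2 / k) = 1) {t η κ : ℝ} (ht : |t| * L h n 3 ≤ η)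
    (hη : dp * η ≤ 1 / 40) (hκ : κ ≤ 1 / 8) :
    ‖Complex.exp (∑ i ∈ Icc 1 n, charWeight d h t i) * Complex.exp (-(t * A d h n * Complex.I))
      - Complex.exp (-(t ^ 2 / 2))‖ ≤ 5 * dp * (|t| ^ 3 * L h n 3) * Real.exp (-(κ * t ^ 2)) := by
  set R := ∑ i ∈ Icc 1 n, ((d i / i : ℝ) : ℂ) * (Complex.exp ((t * h i : ℝ) * Complex.I) - 1
    - (t * h i : ℝ) * Complex.I + ((t * h i : ℝ) : ℂ) ^ 2 / 2) with hR
  have hRn : ‖R‖ ≤ 5 * dp * (|t| ^ 3 * L h n 3) := by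
    refine (norm_sum_weighted_le hd hdp fun i => norm_cexp_mul_I_sub_three_terms_le _).trans
      (le_of_eq ?_)
    rw [← sum_abs_cube, Finset.mul_sum, Finset.mul_sum]
    exact Finset.sum_congr rfl fun i _ => by ring
  have hsum : ∑ i ∈ Icc 1 n, charWeight d h t i + -(t * A d h n * Complex.I)
      = ((-(t ^ 2 / 2) : ℝ) : ℂ) + R := by
    have h1 : ((-(t ^ 2 / 2) : ℝ) : ℂ)
        = ∑ i ∈ Icc 1 n, -(((d i * ((t * h i) ^ 2 / i) : ℝ) : ℂ) / 2) := by
      rw [Finset.sum_neg_distrib, ← Finset.sum_div, ← Complex.ofReal_sum, sum_mul_sq_eq hh]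
      push_cast
      ring
    have h2 : -(t * A d h n * Complex.I)
        = ∑ i ∈ Icc 1 n, -((t : ℂ) * ((d i * (h i / i) : ℝ) : ℂ) * Complex.I) := by
      rw [A, Finset.sum_neg_distrib, ← Finset.sum_mul, ← Finset.mul_sum, ← Complex.ofReal_sum]
    rw [h1, h2, hR, ← Finset.sum_add_distrib, ← Finset.sum_add_distrib]
    refine Finset.sum_congr rfl fun i _ => ?_
    rw [charWeight]
    push_cast
    ring
  rw [← Complex.exp_add, hsum]
  have h3 : Complex.exp (-((t : ℂ) ^ 2 / 2)) = Complex.exp ((-(t ^ 2 / 2) : ℝ) : ℂ) := by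
    push_cast
    rfl
  rw [h3]
  refine (norm_cexp_add_sub_cexp_le (κ := κ * t ^ 2) ?_).trans
    (mul_le_mul_of_nonneg_right hRn (Real.exp_pos _).le)
  have h4 := mul_le_mul_of_nonneg_left (abs_cube_mul_le ht) hdp
  nlinarith [sq_nonneg t]

/-- Replacing e^{iu} - 1 by iu turns the linear term into i t C_n; the quadratic remainders,
weighted by |p_{n-j}/p_n - 1|, add up to L'_{n,2}. -/
theorem norm_linTerm_sub_le (hd : ∀ i ∈ Icc 1 n, 0 ≤ d i ∧ d i ≤ dp) (hdp : 0 ≤ dp) (t : ℝ) :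
    ‖linTerm n (charWeight d h t) (charCoeff d h t) (expCoeff d n) - C d h n * t * Complex.I‖
      ≤ 4 * dp * (t ^ 2 * L2' d h n) := by
  have h1 : linTerm n (charWeight d h t) (charCoeff d h t) (expCoeff d n) - C d h n * t * Complex.I
      = ∑ i ∈ Icc 1 n, ((d i / i : ℝ) : ℂ) * ((Complex.exp ((t * h i : ℝ) * Complex.I) - 1
        - (t * h i : ℝ) * Complex.I) * ((pCoeff d (n - i) / pCoeff d n - 1 : ℝ) : ℂ)) := by
    rw [linTerm, C, Complex.ofReal_sum, Finset.sum_mul, Finset.sum_mul, ← Finset.sum_sub_distrib]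
    refine Finset.sum_congr rfl fun i _ => ?_
    rw [charCoeff_zero, pCoeff_eq_expCoeff, pCoeff_eq_expCoeff, charWeight]
    push_cast
    ring
  rw [h1]
  refine (norm_sum_weighted_le hd hdp (v := fun i => 4 * (t * h i) ^ 2
    * |pCoeff d (n - i) / pCoeff d n - 1|) fun i => ?_).trans (le_of_eq ?_)
  · rw [norm_mul, Complex.norm_real, Real.norm_eq_abs]
    exact mul_le_mul_of_nonneg_right (norm_cexp_mul_I_sub_two_terms_le _) (abs_nonneg _)
  · rw [L2', Finset.mul_sum, Finset.mul_sum, Finset.mul_sum]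
    exact Finset.sum_congr rfl fun i _ => by ring

/-- The characteristic function of the centred additive function. -/
noncomputable def charFn (d h : ℕ → ℝ) (n : ℕ) (t : ℝ) : ℂ :=
  charCoeff d h t n 1 / (expCoeff d n : ℝ) * Complex.exp (-(t * A d h n * Complex.I))

/-- Three errors, one for each term of `errorSize`: the quadratic error of the expansion in s, the
error of e^Λ, and the error of the linear term. The condition L_{n,p}^{1/p} ≤ 1 serves to bound the
factor 1 + `linTerm` by a linear function of t. -/
theorem exists_abs_C_le_and_charFn_bound {dm dp : ℝ} (hdm : 0 < dm) (hdd : dm ≤ dp) {p : ℝ≥0∞}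
    (hp : ENNReal.ofReal (max 2 (1 / dm)) < p) :
    ∃ η κ K : ℝ, 0 < η ∧ 0 < κ ∧ 0 < K ∧ ∀ (n : ℕ) (d h : ℕ → ℝ), 1 ≤ n →
      (∀ i ∈ Icc 1 n, dm ≤ d i ∧ d i ≤ dp) → ∑ k ∈ Icc 1 n, d k * (h k ^ 2 / k) = 1 →
      0 < expCoeff d n ∧ |C d h n| ≤ K * LRoot h n p ∧
      ∀ t, 0 < t → t * L h n 3 ≤ η → LRoot h n p ≤ 1 →
        ‖charFn d h n t - Complex.exp (-(t ^ 2 / 2)) * (1 + C d h n * t * Complex.I)‖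
          ≤ t * (K * errorSize d h n p * ((t + t ^ 2 + t ^ 3) * Real.exp (-(κ * t ^ 2)))) := by
  obtain ⟨η, κ, K, θ, β, H, hη, hdη, hκ, hκ8, hH, hhold, hsys⟩ := exists_coeffSystem hdm hdd hp
  have hdp : 0 < dp := hdm.trans_le hdd
  refine ⟨η, κ, 9 * (K * dp * H) ^ 2 + 5 * dp + 5 * dp * |K| * dp * H + 4 * dp + dp * |K| * H,
    hη, hκ, by positivity, fun n d h hn hd hh => ?_⟩
  have hd0 : ∀ i ∈ Icc 1 n, 0 ≤ d i ∧ d i ≤ dp :=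
    fun i hi => ⟨hdm.le.trans (hd i hi).1, (hd i hi).2⟩
  have hLR := LRoot_nonneg h n p
  -- The system at t = 0 has M_k constant equal to p_k; its increment bound controls p_{n-j}/p_n - 1
  -- and hence C_n.
  have h0 := hsys n d h 0 hn hd hh (by simpa using hη.le)
  have hK1 := h0.one_le_C
  have hK0 : 0 ≤ K := zero_le_one.trans hK1
  rw [abs_of_nonneg hK0]
  have hpn := h0.p_pos
  refine ⟨hpn, ?_, fun t ht0 htη hLR1 => ?_⟩
  · have h1 : |C d h n| ≤ dp * K * (H * LRoot h n p) := by
      refine le_trans ?_ (mul_le_mul_of_nonneg_left (hhold h n n hn le_rfl) (by positivity))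
      rw [C, Finset.mul_sum]
      refine (Finset.abs_sum_le_sum_abs _ _).trans (Finset.sum_le_sum fun i hi => ?_)
      have h2 := h0.norm_sub_last_le' hi le_rfl zero_le_one
      rw [charCoeff_zero, charCoeff_zero, mul_zero, neg_zero, Real.exp_zero, mul_one,
        ← Complex.ofReal_sub, Complex.norm_real, Real.norm_eq_abs] at h2
      rw [abs_mul, abs_mul, abs_div, abs_of_nonneg (hd0 i hi).1, Nat.abs_cast, pCoeff_eq_expCoeff,
        pCoeff_eq_expCoeff, div_sub_one hpn.ne', abs_div, abs_of_pos hpn]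
      have h3 : |expCoeff d (n - i) - expCoeff d n| / expCoeff d n
          ≤ K * (((i : ℝ) / n) ^ (θ / 2) * growth n (β + θ) (n - i)) := by
        rw [div_le_iff₀ hpn]
        linarith
      have h4 := (hd0 i hi).2
      calc d i * (|h i| / i) * (|expCoeff d (n - i) - expCoeff d n| / expCoeff d n)
          ≤ dp * (|h i| / i) * (K * (((i : ℝ) / n) ^ (θ / 2) * growth n (β + θ) (n - i))) := by
            gcongr
        _ = _ := by ring
    refine h1.trans ?_
    have : 0 ≤ (9 * (K * dp * H) ^ 2 + 5 * dp + 5 * dp * K * dp * H + 4 * dp) * LRoot h n p := by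
      positivity
    linarith
  · have hs := hsys n d h t hn hd hh (by rwa [abs_of_pos ht0])
    have e1 := hs.norm_sub_second_order_le
    have e2 := hs.norm_linTerm_le
    have e3 := norm_cexp_sum_charWeight_sub_le hd0 hdp.le hh (t := t) (by rwa [abs_of_pos ht0])
      hdη hκ8
    have e4 := norm_linTerm_sub_le (h := h) hd0 hdp.le t
    rw [abs_of_pos ht0] at e1 e2 e3
    set lin := linTerm n (charWeight d h t) (charCoeff d h t) (expCoeff d n) with hlin
    set Λ := ∑ i ∈ Icc 1 n, charWeight d h t i with hΛ
    set E := Real.exp (-(κ * t ^ 2)) with hE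
    have hE0 : 0 < E := Real.exp_pos _
    set e := Complex.exp (-(t * A d h n * Complex.I)) with he
    have hen : ‖e‖ = 1 := by
      rw [he, Complex.norm_exp]
      simp
    set g := Complex.exp (-((t : ℂ) ^ 2 / 2)) with hg
    have hgn : ‖g‖ ≤ E := by
      have h1 : (-((t : ℂ) ^ 2 / 2)) = ((-(t ^ 2 / 2) : ℝ) : ℂ) := by push_cast; rfl
      rw [hg, h1, Complex.norm_exp, Complex.ofReal_re, hE]
      refine Real.exp_le_exp.2 ?_
      nlinarith [sq_nonneg t]
    have hp0 : ((expCoeff d n : ℝ) : ℂ) ≠ 0 := by exact_mod_cast hpn.ne'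
    have hsplit : charFn d h n t - g * (1 + C d h n * t * Complex.I)
        = (charCoeff d h t n 1 - Complex.exp Λ * ((expCoeff d n : ℝ) * (1 + lin)))
            / (expCoeff d n : ℝ) * e
          + (Complex.exp Λ * e - g) * (1 + lin) + g * (lin - C d h n * t * Complex.I) := by
      rw [charFn, ← he]
      field_simp
      ring
    rw [hsplit]
    set δ := errorSize d h n p with hδ
    have hL3 := L_three_nonneg h n
    have hL2 := L2'_nonneg d h n
    have hδ3 : L h n 3 ≤ δ := by rw [hδ, errorSize]; nlinarith [sq_nonneg (LRoot h n p)]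
    have hδR : LRoot h n p ^ 2 ≤ δ := by rw [hδ, errorSize]; linarith
    have hδ2 : L2' d h n ≤ δ := by rw [hδ, errorSize]; nlinarith [sq_nonneg (LRoot h n p)]
    have hδ0 : 0 ≤ δ := hL3.trans hδ3
    have b1 : ‖(charCoeff d h t n 1 - Complex.exp Λ * ((expCoeff d n : ℝ) * (1 + lin)))
            / (expCoeff d n : ℝ) * e‖ ≤ 9 * (K * dp * H) ^ 2 * (t ^ 2 * δ * E) := by
      rw [norm_mul, hen, mul_one, norm_div, Complex.norm_real, Real.norm_of_nonneg hpn.le,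
        div_le_iff₀ hpn]
      refine e1.trans ?_
      calc 9 * (K ^ 2 * expCoeff d n * (dp * t * (H * LRoot h n p)) ^ 2) * E
          = 9 * (K * dp * H) ^ 2 * (t ^ 2 * LRoot h n p ^ 2 * E) * expCoeff d n := by ring
        _ ≤ _ := by gcongr
    have hlin1 : ‖1 + lin‖ ≤ 1 + K * dp * H * t := by
      refine (norm_add_le _ _).trans ?_
      rw [norm_one]
      refine add_le_add_right (e2.trans ?_) 1
      calc K * (dp * t * (H * LRoot h n p)) = K * dp * H * t * LRoot h n p := by ring
        _ ≤ K * dp * H * t := mul_le_of_le_one_right (by positivity) hLR1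
    have b2 : ‖(Complex.exp Λ * e - g) * (1 + lin)‖
        ≤ 5 * dp * (t ^ 3 * δ) * E * (1 + K * dp * H * t) := by
      rw [norm_mul]
      refine mul_le_mul (e3.trans ?_) hlin1 (norm_nonneg _) (by positivity)
      gcongr
    have b3 : ‖g * (lin - C d h n * t * Complex.I)‖ ≤ E * (4 * dp * (t ^ 2 * δ)) := by
      rw [norm_mul]
      refine mul_le_mul hgn (e4.trans ?_) (norm_nonneg _) hE0.le
      gcongr
    refine (norm_add₃_le.trans (add_le_add (add_le_add b1 b2) b3)).trans ?_
    rw [← sub_nonneg]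
    have hnn : 0 ≤ δ * E * ((9 * (K * dp * H) ^ 2 + 4 * dp) * (t ^ 3 + t ^ 4)
        + 5 * dp * (t ^ 2 + t ^ 4) + 5 * dp * K * dp * H * (t ^ 2 + t ^ 3)
        + dp * K * H * (t ^ 2 + t ^ 3 + t ^ 4)) := by positivity
    refine hnn.trans (le_of_eq ?_)
    ring

end Edgeworth
end RandPerm

namespace RandPerm

/-! ### Conclusion by Esseen's inequality. -/

section Main

open Finset MeasureTheory

variable {d h : ℕ → ℝ} {n : ℕ}

theorem sum_multiplicative (d : ℕ → ℝ) (n : ℕ) :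
    ∑ σ : Equiv.Perm (Fin n), multiplicative d σ = n.factorial * expCoeff d n := by
  rw [← pCoeff_eq_expCoeff, pCoeff]
  have : (n.factorial : ℝ) ≠ 0 := by positivity
  field_simp

theorem sum_nuMass (hp : 0 < expCoeff d n) : ∑ σ : Equiv.Perm (Fin n), nuMass d σ = 1 := by
  simp only [nuMass]
  rw [← Finset.sum_div, div_self]
  rw [sum_multiplicative]
  positivity

theorem nuMass_nonneg (hd : ∀ i ∈ Icc 1 n, 0 ≤ d i) (σ : Equiv.Perm (Fin n)) :
    0 ≤ nuMass d σ :=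
  div_nonneg (Finset.prod_nonneg fun i hi => pow_nonneg (hd i hi) _)
    (Finset.sum_nonneg fun _ _ => Finset.prod_nonneg fun i hi => pow_nonneg (hd i hi) _)

theorem prod_mul_cexp_pow (d h : ℕ → ℝ) (t : ℝ) (σ : Equiv.Perm (Fin n)) :
    ∏ j ∈ Icc 1 n, ((d j : ℂ) * Complex.exp ((t * h j : ℝ) * Complex.I)) ^ cycleCount j σ
      = multiplicative d σ * Complex.exp (t * additive h σ * Complex.I) := by
  have h1 : (t : ℂ) * additive h σ * Complex.I
      = ∑ j ∈ Icc 1 n, (cycleCount j σ : ℂ) * ((t * h j : ℝ) * Complex.I) := by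
    rw [additive, Complex.ofReal_sum, Finset.mul_sum, Finset.sum_mul]
    refine Finset.sum_congr rfl fun j _ => ?_
    push_cast
    ring
  rw [h1, Complex.exp_sum, multiplicative, Complex.ofReal_prod, ← Finset.prod_mul_distrib]
  refine Finset.prod_congr rfl fun j _ => ?_
  rw [mul_pow, Complex.exp_nat_mul]
  push_cast
  rfl

theorem sum_nuMass_mul_cexp (hp : 0 < expCoeff d n) (t : ℝ) :
    ∑ σ : Equiv.Perm (Fin n), (nuMass d σ : ℂ)
        * Complex.exp (t * (additive h σ - A d h n : ℝ) * Complex.I) = charFn d h n t := by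
  have hp0 : ((expCoeff d n : ℝ) : ℂ) ≠ 0 := by exact_mod_cast hp.ne'
  have hn0 : (n.factorial : ℂ) ≠ 0 := by exact_mod_cast n.factorial_ne_zero
  rw [charFn, charCoeff_one, ← sum_perm_eq_expCoeff]
  simp only [prod_mul_cexp_pow, Finset.mul_sum, Finset.sum_div, Finset.sum_mul]
  refine Finset.sum_congr rfl fun σ _ => ?_
  have h1 : Complex.exp (t * (additive h σ - A d h n : ℝ) * Complex.I)
      = Complex.exp (t * additive h σ * Complex.I) * Complex.exp (-(t * A d h n * Complex.I)) := by
    rw [← Complex.exp_add]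
    congr 1
    push_cast
    ring
  rw [h1, nuMass, sum_multiplicative]
  push_cast
  field_simp

theorem F_eq_sum (d h : ℕ → ℝ) (n : ℕ) (x : ℝ) :
    F d h n x = ∑ σ : Equiv.Perm (Fin n), if additive h σ - A d h n < x then nuMass d σ else 0 := by
  rw [F, nu, Finset.sum_filter]
  refine Finset.sum_congr rfl fun σ _ => ?_
  simp only [Set.mem_ofPred_eq]

/-- The normalisation excludes ĥ = 0. This keeps the error size positive, so that the Esseen cutoff
η/δ is defined. -/
theorem L_three_pos (hh : ∑ k ∈ Icc 1 n, d k * (h k ^ 2 / k) = 1) : 0 < L h n 3 := by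
  refine lt_of_le_of_ne (L_three_nonneg h n) fun h0 => ?_
  rw [L_three, eq_comm, Finset.sum_eq_zero_iff_of_nonneg fun i _ => by positivity] at h0
  rw [Finset.sum_eq_zero] at hh
  · exact zero_ne_one hh
  · intro i hi
    have hi0 : (i : ℝ) ≠ 0 := by
      have := (Finset.mem_Icc.1 hi).1
      positivity
    have h1 : h i = 0 := by
      have := h0 i hi
      rw [div_eq_zero_iff, or_iff_left hi0, pow_eq_zero_iff (by norm_num), abs_eq_zero] at this
      exact this
    rw [h1]
    simp

theorem integrable_pow_mul_exp_neg {κ : ℝ} (hκ : 0 < κ) :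
    Integrable fun t : ℝ => (t + t ^ 2 + t ^ 3) * Real.exp (-(κ * t ^ 2)) := by
  have h1 : ∀ k : ℕ, Integrable fun t : ℝ => t ^ k * Real.exp (-(κ * t ^ 2)) := by
    intro k
    have := integrable_rpow_mul_exp_neg_mul_sq hκ (s := k) (by linarith [(k.cast_nonneg : (0 : ℝ) ≤ k)])
    simpa [Real.rpow_natCast, neg_mul] using this
  refine (((h1 1).add (h1 2)).add (h1 3)).congr (Filter.Eventually.of_forall fun t => ?_)
  simp only [Pi.add_apply]
  ring

/-- With cutoff T = η/δ, where δ is the error size, the expansion is valid for all 0 < t ≤ T since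
L_{n,3} ≤ δ, and the term (1 + |C_n|)/T of Esseen's inequality is itself of order δ. -/
theorem exists_edgeworth_bound {dm dp : ℝ} (hdm : 0 < dm) (hdd : dm ≤ dp) {p : ℝ≥0∞}
    (hp : ENNReal.ofReal (max 2 (1 / dm)) < p) :
    ∃ K : ℝ, 0 < K ∧ ∀ (n : ℕ) (d h : ℕ → ℝ), 1 ≤ n →
      (∀ j ∈ Icc 1 n, dm ≤ d j ∧ d j ≤ dp) → (∑ k ∈ Icc 1 n, d k * (h k ^ 2 / k) = 1) →
      ∀ x, |F d h n x - edgeworth (C d h n) x| ≤ K * errorSize d h n p := by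
  obtain ⟨η, κ, K, hη, hκ, hK, hmain⟩ := exists_abs_C_le_and_charFn_bound hdm hdd hp
  obtain ⟨K', hK', hess⟩ := exists_esseen_inequality
  set J := ∫ t in Set.Ioi (0 : ℝ), (t + t ^ 2 + t ^ 3) * Real.exp (-(κ * t ^ 2)) with hJ
  have hJ0 : 0 ≤ J := setIntegral_nonneg measurableSet_Ioi fun t ht => by
    have : (0 : ℝ) < t := ht
    positivity
  refine ⟨K' * (K * J + (1 + K) / η) + (2 + 2 * K), by positivity, fun n d h hn hd hh x => ?_⟩
  obtain ⟨hpn, hC, hchar⟩ := hmain n d h hn hd hh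
  have hd0 : ∀ i ∈ Icc 1 n, 0 ≤ d i := fun i hi => hdm.le.trans (hd i hi).1
  have hw := nuMass_nonneg hd0
  have hw1 := sum_nuMass hpn
  set δ := errorSize d h n p with hδ
  have hL3 := L_three_pos hh
  have hL2 := L2'_nonneg d h n
  have hLR := LRoot_nonneg h n p
  have hδ3 : L h n 3 ≤ δ := by rw [hδ, errorSize]; nlinarith [sq_nonneg (LRoot h n p)]
  have hδR : LRoot h n p ^ 2 ≤ δ := by rw [hδ, errorSize]; linarith
  have hδ0 : 0 < δ := hL3.trans_le hδ3
  rw [F_eq_sum, add_mul]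
  rcases le_or_gt δ 1 with hδ1 | hδ1
  · have hLR1 : LRoot h n p ≤ 1 := (sq_le_one_iff₀ hLR).1 (hδR.trans hδ1)
    have hint : Integrable fun t : ℝ =>
        K * δ * ((t + t ^ 2 + t ^ 3) * Real.exp (-(κ * t ^ 2))) :=
      (integrable_pow_mul_exp_neg hκ).const_mul _
    have h1 := hess (Equiv.Perm (Fin n)) (nuMass d) (fun σ => additive h σ - A d h n) (C d h n)
      (η / δ) (fun t => K * δ * ((t + t ^ 2 + t ^ 3) * Real.exp (-(κ * t ^ 2)))) hw hw1
      (by positivity) hint.integrableOn (fun t ht => ?_) x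
    · refine h1.trans ((mul_le_mul_of_nonneg_left (c := (K * J + (1 + K) / η) * δ) ?_ hK'.le).trans
        ?_)
      · rw [integral_const_mul, add_mul]
        refine add_le_add ?_ ?_
        · rw [mul_right_comm]
          refine mul_le_mul_of_nonneg_right (mul_le_mul_of_nonneg_left ?_ hK.le) hδ0.le
          refine setIntegral_mono_set (integrable_pow_mul_exp_neg hκ).integrableOn ?_
            Set.Ioc_subset_Ioi_self.eventuallyLE
          refine (ae_restrict_iff' measurableSet_Ioi).2 (Filter.Eventually.of_forall fun t ht => ?_)
          have : (0 : ℝ) < t := ht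
          simp only [Pi.zero_apply]
          positivity
        · have h2 : |C d h n| ≤ K := hC.trans (mul_le_of_le_one_right hK.le hLR1)
          rw [div_div_eq_mul_div, div_mul_eq_mul_div]
          gcongr
      · have : 0 ≤ (2 + 2 * K) * δ := by positivity
        linarith
    · have h2 := hchar t ht.1 ?_ hLR1
      · rwa [← sum_nuMass_mul_cexp hpn] at h2
      · calc t * L h n 3 ≤ η / δ * δ := mul_le_mul ht.2 hδ3 hL3.le (by positivity)
          _ = η := by field_simp
  -- For δ > 1 the bound is trivial: the difference is at most 2 + |C_n|, and |C_n| is at most a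
  -- multiple of L_{n,p}^{1/p}, which is at most 2δ.
  · have h1 : |∑ σ : Equiv.Perm (Fin n), if additive h σ - A d h n < x then nuMass d σ else 0|
        ≤ 1 := by
      rw [abs_of_nonneg (Finset.sum_nonneg fun σ _ => by split_ifs; exacts [hw σ, le_rfl]), ← hw1]
      refine Finset.sum_le_sum fun σ _ => ?_
      split_ifs
      exacts [le_rfl, hw σ]
    have h2 := abs_edgeworth_le (C d h n) x
    have h3 : LRoot h n p ≤ 2 * δ := by nlinarith [sq_nonneg (LRoot h n p - 1)]
    have h4 := mul_le_mul_of_nonneg_left h3 hK.le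
    have h5 : 0 ≤ K' * (K * J + (1 + K) / η) * δ := by positivity
    refine (abs_sub _ _).trans ?_
    nlinarith

end Main
end RandPerm

theorem theorem4 (dm dp : ℝ) (hdm : 0 < dm) (p : ℝ≥0∞)
    (hp : ENNReal.ofReal (max 2 (1 / dm)) < p) :
    ∃ K : ℝ, 0 < K ∧ ∀ (n : ℕ) (d h : ℕ → ℝ), 1 ≤ n →
      (∀ j ∈ Finset.Icc 1 n, dm ≤ d j ∧ d j ≤ dp) →
      (∑ k ∈ Finset.Icc 1 n, d k * (h k ^ 2 / k) = 1) →
      ∀ x : ℝ,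
        |RandPerm.F d h n x - RandPerm.Phi x
            + 1 / Real.sqrt (2 * Real.pi) * Real.exp (-x ^ 2 / 2) * RandPerm.C d h n|
          ≤ K * (RandPerm.L h n 3 + RandPerm.LRoot h n p ^ 2 + RandPerm.L2' d h n) := by
  rcases le_or_gt dm dp with hdd | hdd
  · obtain ⟨K, hK, hmain⟩ := RandPerm.exists_edgeworth_bound hdm hdd hp
    refine ⟨K, hK, fun n d h hn hd hh x => ?_⟩
    have h1 := hmain n d h hn hd hh x
    rw [RandPerm.errorSize] at h1
    have h2 : RandPerm.F d h n x - RandPerm.Phi x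
        + 1 / Real.sqrt (2 * Real.pi) * Real.exp (-x ^ 2 / 2) * RandPerm.C d h n
        = RandPerm.F d h n x - RandPerm.edgeworth (RandPerm.C d h n) x := by
      rw [RandPerm.edgeworth, RandPerm.gaussDensity]
      ring
    rwa [h2]
  -- If dp < dm the bounds on d at index 1 are contradictory, so any constant will do.
  · refine ⟨1, one_pos, fun n d h hn hd _ x => ?_⟩
    have h1 := hd 1 (Finset.mem_Icc.2 ⟨le_rfl, hn⟩)
    exact absurd (h1.1.trans h1.2) (not_le.2 hdd)
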